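/- Setting. Let $M$ be a smooth (Hausdorff, $\sigma$-compact) manifold of dimension $n\ge 2$, $\xi$ a smooth real line bundle over $M$, $k\ge 3$, and let $A$ be a linear differential operator of order $\le k$ on $C^\infty(\xi)$. Its symbol $\sigma=\mathrm{smbl}_k(A)$ is a section of $S^kTM$, identified with a field of homogeneous polynomials of degree $k$ on the cotangent spaces. Regular forms. Let $h$ be a homogeneous polynomial of degree $k$ on $V=\mathbb R^n$, $\Theta_l=\frac1{l!}d^lh$ at $v\in V$, and $\Theta_2^0,\Theta_3^0$ the restrictions of $\Theta_2,\Theta_3$ to $\ker\Theta_1$. The 3-jet of $h$ at $v$ is regular if $h(v)\neq0$, $\Theta_2$ is nondegenerate, and the vectors $e_1=\hat\lambda,\ e_{i+1}=\Phi e_i$ $(1\le i\le n-2)$ of $\ker\Theta_1$ are linearly independent, where $\lambda$ is the contraction of $\Theta_3^0$ with the inverse of $\Theta_2^0$, $\hat\lambda$ is its $\Theta_2^0$-dual vector and $\Theta_2^0(\Phi X,Y)=\Theta_3^0(\hat\lambda,X,Y)$. The form $h$ is regular if at some $v$ its 3-jet is regular and there are $n$ rational $GL(V)$-invariants $J_1,\dots,J_n$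 of 3-jets of forms of degree $k$ at nonzero points, with $J_n$ the value of the form, defined at this 3-jet, such that $dJ_1(h)\wedge\dots\wedge dJ_n(h)\ne0$ at $v$. The symbol $\sigma$ is regular of constant type if there is one $GL$-orbit of a regular form that contains $\sigma_q$, under every linear isomorphism $T_qM\cong\mathbb R^n$, for every $q\in M$. Wagner and Chern connections. For $\sigma$ regular of constant type, let $\nabla^\sigma$ be the Wagner connection, i.e. the affine connection on $M$ with $\nabla^\sigma_X\sigma=0$ for all $X$, let $\theta^\sigma(X)=\mathrm{Tr}(Y\mapsto T^\sigma(X,Y))$ be its torsion form, $\omega=d\theta^\sigma$, and let $\nabla^{[\sigma]}_XY=\nabla^\sigma_XY-\frac1{n-1}\theta^\sigma(X)Y$ be the Chern connection. At a point with tangent space $T$, put $\hat\omega(X)=\omega(X,\cdot)$, let $\hat\omega_{k-1}:S^{k-1}T\to S^{k-1}T^*$ be its symmetric power, $L_{[\sigma]}=\{\theta\rfloor\sigma:\theta\in T^*\}\subset S^{k-1}T$, and let $L^0_{[\sigma]}\subset S^{k-1}T$ be the annihilator of $\hat\omega_{k-1}(L_{[\sigma]})$. The operator $A$ is Chern regular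 if $\sigma$ is regular of constant type and, at every point, $L_{[\sigma]}\cap\ker\hat\omega_{k-1}=0$ and $L_{[\sigma]}\cap L^0_{[\sigma]}=0$. Subsymbols. A linear connection $\nabla$ in $\xi$ together with $\nabla^{[\sigma]}$ defines a derivation $d^s$ of degree one (the symmetrized covariant differential) on symmetric forms with values in $\xi$, the quantization $\hat\sigma(s)=\frac1{k!}\langle\sigma,(d^s)^ks\rangle$, which is an operator with symbol $\sigma$, and the subsymbol $\mathrm{smbl}_{k-1}(A-\hat\sigma)$ of $A$. Theorem. Let $A$ be Chern regular. There is one and only one smooth linear connection $\nabla=\nabla^{[A]}$ in $\xi$ such that the subsymbol of $A$ defined by $\nabla$ and $\nabla^{[\sigma]}$ lies in $L^0_{[\sigma]}$ at every point of $M$. It depends only on the conformal class $[A]=\{fA\}$: for every nowhere vanishing $f\in C^\infty(M)$, $\nabla^{[A]}$ is also the one and only smooth linear connection for which the subsymbol of $fA$, defined by it and by $\nabla^{[f\sigma]}$, lies in $L^0_{[f\sigma]}$ at every point. -/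

import Mathlib

open Bundle Manifold FiberBundle MvPolynomial
open scoped ContDiff BigOperators

noncomputable section

namespace ChernReg

/-! ### Regular homogeneous forms

Forms of degree `k` on an `n`-dimensional space are homogeneous polynomials `h` in `n` variables.
A matrix `g` acts on forms by linear substitution. -/

section Forms

variable {n : ℕ}

/-- The form `v ↦ h (g v)`. -/
def substForm (g : Matrix (Fin n) (Fin n) ℝ) (h : MvPolynomial (Fin n) ℝ) :
    MvPolynomial (Fin n) ℝ :=
  bind₁ (fun i => ∑ j, C (g i j) * X j) h

/-- Standard coordinates `x_i, u, u_i, u_ij, u_ijl` on the space of 3-jets of functions of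
`n` variables (partial derivatives are recorded with ordered indices, so that some of these
coordinates coincide on every jet). -/
inductive JetCoord (n : ℕ) : Type
  | pos (i : Fin n)
  | val
  | d1 (i : Fin n)
  | d2 (i j : Fin n)
  | d3 (i j l : Fin n)

/-- The coordinates of the 3-jet of `H` at `v`. -/
def jet3 (H : MvPolynomial (Fin n) ℝ) (v : Fin n → ℝ) : JetCoord n → ℝ
  | .pos i => v i
  | .val => eval v H
  | .d1 i => eval v (pderiv i H)
  | .d2 i j => eval v (pderiv i (pderiv j H))
  | .d3 i j l => eval v (pderiv i (pderiv j (pderiv l H)))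

/-- `P / Q` is a `GL`-invariant rational function on the space of 3-jets of forms of degree `k`
at nonzero points: `g` maps the 3-jet of `v ↦ H (g v)` at `v` to the 3-jet of `H` at `g v`. -/
def IsRationalInvariant (k : ℕ) (P Q : MvPolynomial (JetCoord n) ℝ) : Prop :=
  ∀ (H : MvPolynomial (Fin n) ℝ), H.IsHomogeneous k → ∀ (g : GL (Fin n) ℝ) (v : Fin n → ℝ), v ≠ 0 →
    eval (jet3 (substForm g.1 H) v) P * eval (jet3 H (g.1.mulVec v)) Q =
      eval (jet3 H (g.1.mulVec v)) P * eval (jet3 (substForm g.1 H) v) Q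

/-- `Θ₁ = dh` at `v`. -/
def theta1 (h : MvPolynomial (Fin n) ℝ) (v : Fin n → ℝ) : (Fin n → ℝ) →ₗ[ℝ] ℝ :=
  ∑ i, eval v (pderiv i h) • LinearMap.proj i

/-- The symmetric bilinear form of `Θ₂ = (1/2!) d²h` at `v`. -/
def theta2 (h : MvPolynomial (Fin n) ℝ) (v a b : Fin n → ℝ) : ℝ :=
  (1 / 2) * ∑ i, ∑ j, eval v (pderiv i (pderiv j h)) * a i * b j

/-- The symmetric trilinear form of `Θ₃ = (1/3!) d³h` at `v`. -/
def theta3 (h : MvPolynomial (Fin n) ℝ) (v a b c : Fin n → ℝ) : ℝ :=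
  (1 / 6) * ∑ i, ∑ j, ∑ l, eval v (pderiv i (pderiv j (pderiv l h))) * a i * b j * c l

/-- The 3-jet of `h` at `v` is regular: `h v ≠ 0`, `Θ₂` is nondegenerate, and the vectors
`e₁ = l, e₂ = Φ e₁, …, e_{n-1} = Φ e_{n-2}` of `ker Θ₁` are linearly independent. Here `Θ₂⁰`, `Θ₃⁰`
are the restrictions of `Θ₂`, `Θ₃` to `ker Θ₁`; `S X` is the operator with
`Θ₂⁰ (S X Y, Z) = Θ₃⁰ (X, Y, Z)`, so that its trace is the contraction of `Θ₃⁰ (X, ·, ·)` with the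
inverse of `Θ₂⁰`; `l` is the `Θ₂⁰`-dual vector of the covector `X ↦ Tr (S X)`, and `Φ = S l`.
(`S` and `l` are unique since `Θ₂⁰` is nondegenerate.) -/
def IsRegular3Jet (h : MvPolynomial (Fin n) ℝ) (v : Fin n → ℝ) : Prop :=
  eval v h ≠ 0 ∧
  (∀ a, (∀ b, theta2 h v a b = 0) → a = 0) ∧
  ∃ (S : LinearMap.ker (theta1 h v) →ₗ[ℝ]
        LinearMap.ker (theta1 h v) →ₗ[ℝ] LinearMap.ker (theta1 h v))
    (l : LinearMap.ker (theta1 h v)),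
    (∀ X Y Z : LinearMap.ker (theta1 h v), theta2 h v (S X Y) Z = theta3 h v X Y Z) ∧
    (∀ X : LinearMap.ker (theta1 h v), theta2 h v l X = LinearMap.trace ℝ _ (S X)) ∧
    LinearIndependent ℝ (fun i : Fin (n - 1) => ((S l) ^ (i : ℕ)) l)

/-- The 4-jet of `h` at `v` is regular: its 3-jet is regular and there are `n` rational invariants
of order at most `3`, defined at this 3-jet and with `u` among them, whose values on `h` have
linearly independent differentials at `v`. -/
def IsRegular4Jet (k : ℕ) (h : MvPolynomial (Fin n) ℝ) (v : Fin n → ℝ) : Prop :=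
  IsRegular3Jet h v ∧
  ∃ P Q : Fin n → MvPolynomial (JetCoord n) ℝ,
    (∀ i, IsRationalInvariant k (P i) (Q i)) ∧
    (∀ i, eval (jet3 h v) (Q i) ≠ 0) ∧
    (∃ i, P i = X .val ∧ Q i = 1) ∧
    LinearIndependent ℝ (fun i =>
      fderiv ℝ (fun w : Fin n → ℝ => eval (jet3 h w) (P i) / eval (jet3 h w) (Q i)) v)

/-- A regular form of degree `k`: some 4-jet of `h` is regular. -/
def IsRegularForm (k : ℕ) (h : MvPolynomial (Fin n) ℝ) : Prop :=
  h.IsHomogeneous k ∧ ∃ v, IsRegular4Jet k h v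

end Forms

/-! ### Tensors, connections and differential operators on a manifold -/

variable {n : ℕ} {M : Type*} [TopologicalSpace M] [ChartedSpace (EuclideanSpace ℝ (Fin n)) M]

/-- The model space `ℝⁿ`. -/
abbrev Mdl (n : ℕ) := EuclideanSpace ℝ (Fin n)

/-- The tangent space `T_x M`. -/
abbrev Tan (n : ℕ) {M : Type*} [TopologicalSpace M] [ChartedSpace (Mdl n) M] (x : M) :=
  TangentSpace (𝓡 n) x

instance (x : M) : FiniteDimensional ℝ (Tan n x) :=
  inferInstanceAs (FiniteDimensional ℝ (EuclideanSpace ℝ (Fin n)))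

instance (x : M) : T2Space (Tan n x) :=
  inferInstanceAs (T2Space (EuclideanSpace ℝ (Fin n)))

/-- The cotangent space `T_x^* M`. -/
abbrev Cot (n : ℕ) {M : Type*} [TopologicalSpace M] [ChartedSpace (Mdl n) M] (x : M) :=
  Tan n x →L[ℝ] ℝ

/-- `j`-linear forms on `T_x^* M`, i.e. contravariant tensors of degree `j`. -/
abbrev Contra (n : ℕ) {M : Type*} [TopologicalSpace M] [ChartedSpace (Mdl n) M]
    (j : ℕ) (x : M) := MultilinearMap ℝ (fun _ : Fin j => Cot n x) ℝ

/-- `S^j T_x`, as the symmetric `j`-linear forms `σ` on `T_x^*`; the corresponding homogeneous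
polynomial on `T_x^*` is `θ ↦ σ (θ, …, θ)`. -/
def symPow (j : ℕ) (x : M) : Submodule ℝ (Contra n j x) where
  carrier := {γ | ∀ e : Equiv.Perm (Fin j), γ.domDomCongr e = γ}
  add_mem' := by
    intro a b ha hb e
    ext v
    have h1 := congrArg (fun γ : Contra n j x => γ v) (ha e)
    have h2 := congrArg (fun γ : Contra n j x => γ v) (hb e)
    simp only [MultilinearMap.domDomCongr_apply, add_apply] at h1 h2 ⊢
    rw [h1, h2]
  zero_mem' := by
    intro e
    ext v
    simp
  smul_mem' := by
    intro c a ha e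
    have h := ha e
    ext v
    have h' := congrArg (fun γ : Contra n j x => γ v) h
    simp only [MultilinearMap.domDomCongr_apply, smul_apply] at h' ⊢
    rw [h']

/-- A basis of the tangent space. -/
def tbasis (x : M) : Module.Basis (Fin n) ℝ (Tan n x) :=
  ((EuclideanSpace.basisFun (Fin n) ℝ).toBasis : Module.Basis (Fin n) ℝ (EuclideanSpace ℝ (Fin n)))

/-- The dual basis of the cotangent space. -/
def tcoord (x : M) (a : Fin n) : Cot n x :=
  LinearMap.toContinuousLinearMap ((tbasis x).coord a)

/-- The full contraction `∑ σ^{i₁…i_j} η_{i₁…i_j}`. For symmetric tensors written as multilinear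
forms it is `1/j!` times the pairing `⟨X₁⋯X_j, θ₁⋯θ_j⟩ = ∑_s ∏_i θ_{s i}(X_i)` of symmetric
products. -/
def contract {x : M} {j : ℕ} {W : Type*} [AddCommGroup W] [Module ℝ W]
    (σ : Contra n j x) (η : (Fin j → Tan n x) → W) : W :=
  ∑ i : Fin j → Fin n,
    σ (fun a => tcoord x (i a)) • η (fun a => tbasis x (i a))

/-- The subspace `L_{[σ]} = {θ ⌟ σ}` of contravariant tensors of degree one less
(at one point). -/
def contrSpace {x : M} {m : ℕ} (σ : Contra n (m + 1) x) : Submodule ℝ (Contra n m x) :=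
  LinearMap.range (MultilinearMap.curryLeft σ : Cot n x →ₗ[ℝ] Contra n m x)

/-- The `l`-th symmetric power `ω̂_l : S^l T → S^l T^*` of `ω̂ : X ↦ ω (X, ·)`:
`(ω̂_l γ) (Y₁, …, Y_l) = γ (ω (·, Y₁), …, ω (·, Y_l))`. -/
def omegaHat {x : M} {l : ℕ} (om : LinearMap.BilinForm ℝ (Tan n x)) (γ : Contra n l x) :
    MultilinearMap ℝ (fun _ : Fin l => Tan n x) ℝ :=
  γ.compLinearMap (fun _ =>
    ((LinearMap.toContinuousLinearMap : (Tan n x →ₗ[ℝ] ℝ) ≃ₗ[ℝ] Cot n x) :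
      (Tan n x →ₗ[ℝ] ℝ) →ₗ[ℝ] Cot n x) ∘ₗ om.flip)

/-- The annihilator `L⁰_{[σ]} ⊆ S^{k-1} T` of the image `ω̂_{k-1} (L_{[σ]}) ⊆ S^{k-1} T^*`,
where `k = m + 1`. -/
def annSpace {x : M} {m : ℕ} (om : LinearMap.BilinForm ℝ (Tan n x)) (σ : Contra n (m + 1) x) :
    Submodule ℝ (Contra n m x) where
  carrier := {γ | γ ∈ symPow m x ∧ ∀ l ∈ contrSpace σ, contract γ (omegaHat om l) = 0}
  add_mem' := by
    rintro a b ⟨ha, ha'⟩ ⟨hb, hb'⟩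
    refine ⟨Submodule.add_mem _ ha hb, fun l hl => ?_⟩
    have h1 := ha' l hl
    have h2 := hb' l hl
    unfold contract at h1 h2 ⊢
    simp only [add_apply, add_smul, Finset.sum_add_distrib, h1, h2, add_zero]
  zero_mem' := ⟨Submodule.zero_mem _, fun l _ => by simp [contract]⟩
  smul_mem' := by
    rintro c a ⟨ha, ha'⟩
    refine ⟨Submodule.smul_mem _ c ha, fun l hl => ?_⟩
    have h1 := ha' l hl
    unfold contract at h1 ⊢
    simp only [smul_apply, smul_assoc, ← Finset.smul_sum, h1, smul_zero]

/-! #### Affine connections -/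

/-- Smooth vector fields on `M`. -/
abbrev VField (n : ℕ) (M : Type*) [TopologicalSpace M] [ChartedSpace (Mdl n) M]
    [IsManifold (𝓡 n) ∞ M] :=
  Cₛ^∞⟮𝓡 n; Mdl n, (fun x : M => Tan n x)⟯

/-- Affine connections on `M`. -/
abbrev AffConn (n : ℕ) (M : Type*) [TopologicalSpace M] [ChartedSpace (Mdl n) M]
    [IsManifold (𝓡 n) ∞ M] :=
  CovariantDerivative (𝓡 n) (Mdl n) (fun x : M => Tan n x)

section Affine

variable [IsManifold (𝓡 n) ∞ M]

/-- A field of covectors is smooth if its values on smooth vector fields are smooth. -/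
def IsSmoothForm (θ : Π x : M, Cot n x) : Prop :=
  ∀ X : VField n M, ContMDiff (𝓡 n) 𝓘(ℝ, ℝ) ∞ (fun x => θ x (X x))

/-- The induced connection on 1-forms: `(∇_v θ) (Y) = v (θ (Y)) - θ (∇_v Y)`, evaluated on a basis
of the tangent space. -/
def dualCov (D : AffConn n M) (θ : Π x : M, Cot n x) (x : M) (v : Tan n x) : Cot n x :=
  ∑ a, (mvfderiv (𝓡 n) (fun y => θ y (extend (Mdl n) (tbasis x a) y)) x v
      - θ x (D (extend (Mdl n) (tbasis x a)) x v)) • tcoord x a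

/-- `D` is a smooth connection with `∇_v σ = 0` for all tangent vectors `v`, i.e.
`v (σ (θ₁, …, θ_k)) = ∑_i σ (θ₁, …, ∇_v θ_i, …, θ_k)` for all smooth 1-forms `θ_i`. -/
def IsWagner {k : ℕ} (σ : Π x : M, Contra n k x) (D : AffConn n M) : Prop :=
  CovariantDerivative.ContMDiffCovariantDerivative D ∞ ∧
  ∀ θ : Fin k → Π x : M, Cot n x, (∀ i, IsSmoothForm (θ i)) → ∀ (x : M) (v : Tan n x),
    mvfderiv (𝓡 n) (fun y => σ y (fun i => θ i y)) x v =
      ∑ i, σ x (Function.update (fun i => θ i x) i (dualCov D (θ i) x v))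

/-- The torsion form `X ↦ Tr (Y ↦ T (X, Y))`. -/
def torsionForm (D : AffConn n M) (x : M) : Cot n x :=
  LinearMap.toContinuousLinearMap
    ((LinearMap.trace ℝ (Tan n x)) ∘ₗ
      (ContinuousLinearMap.coeLM ℝ : (Tan n x →L[ℝ] Tan n x) →ₗ[ℝ] (Tan n x →ₗ[ℝ] Tan n x)) ∘ₗ
      (D.torsion x : Tan n x →ₗ[ℝ] (Tan n x →L[ℝ] Tan n x)))

/-- The Chern connection `∇_X Y - (1 / (n - 1)) θ(X) Y`, where `∇` is the given (Wagner) connection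
and `θ` its torsion form. -/
def chernConn (D : AffConn n M) : AffConn n M :=
  D.addOneForm (fun x =>
    (-(1 / ((n : ℝ) - 1))) • LinearMap.toContinuousLinearMap
      (ContinuousLinearMap.smulRightₗ (torsionForm D x) :
        Tan n x →ₗ[ℝ] (Tan n x →L[ℝ] Tan n x)))

/-- The local expression of a 1-form in the preferred chart at `x`, as a covector-valued function
on the model space. -/
def formInChart (θ : Π x : M, Cot n x) (x : M) (z : Mdl n) : Mdl n →L[ℝ] ℝ :=
  (θ ((extChartAt (𝓡 n) x).symm z)).comp
    (mfderiv 𝓘(ℝ, Mdl n) (𝓡 n) (extChartAt (𝓡 n) x).symm z)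

/-- The exterior derivative of a 1-form `θ` at `x`,
`dθ (v, w) = ∂_v θ (w) - ∂_w θ (v)` in the preferred chart at `x`. -/
def extD (θ : Π x : M, Cot n x) (x : M) : LinearMap.BilinForm ℝ (Tan n x) :=
  let B : Mdl n →L[ℝ] Mdl n →L[ℝ] ℝ := fderiv ℝ (formInChart θ x) (extChartAt (𝓡 n) x x)
  let dφ : Tan n x →ₗ[ℝ] Mdl n :=
    (mvfderiv (𝓡 n) (fun y : M => extChartAt (𝓡 n) x y) x).toLinearMap
  LinearMap.mk₂ ℝ (fun v w => B (dφ v) (dφ w) - B (dφ w) (dφ v))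
    (by intros; simp only [map_add, add_apply]; ring)
    (by intros; simp only [map_smul, smul_apply, smul_eq_mul]; ring)
    (by intros; simp only [map_add, add_apply]; ring)
    (by intros; simp only [map_smul, smul_apply, smul_eq_mul]; ring)

/-- `σ` is a symbol of constant type for a regular orbit: there is a regular form `h` on `ℝⁿ` such
that for each `x` and each isomorphism `φ : T_x M ≃ ℝⁿ` the polynomial of `φ_* σ_x` lies in the
`GL`-orbit of `h`. -/
def IsRegularConstantType {k : ℕ} (σ : Π x : M, Contra n k x) : Prop :=
  ∃ h : MvPolynomial (Fin n) ℝ, IsRegularForm k h ∧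
    ∀ (x : M) (φ : Tan n x ≃L[ℝ] (Fin n → ℝ)), ∃ g : GL (Fin n) ℝ, ∀ w : Fin n → ℝ,
      σ x (fun _ => ∑ i, w i •
        ((ContinuousLinearMap.proj i : (Fin n → ℝ) →L[ℝ] ℝ).comp (φ : Tan n x →L[ℝ] (Fin n → ℝ))))
      = eval w (substForm g.1 h)

end Affine

/-! #### Operators in a line bundle -/

section Operators

variable [IsManifold (𝓡 n) ∞ M]
  {ξ : M → Type*} [TopologicalSpace (TotalSpace ℝ ξ)]
  [∀ x, AddCommGroup (ξ x)] [∀ x, Module ℝ (ξ x)] [∀ x, TopologicalSpace (ξ x)]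
  [FiberBundle ℝ ξ] [VectorBundle ℝ ℝ ξ] [ContMDiffVectorBundle ∞ ℝ ξ (𝓡 n)]

/-- Smooth sections of the line bundle `ξ`. -/
abbrev Sec (n : ℕ) {M : Type*} [TopologicalSpace M] [ChartedSpace (Mdl n) M]
    (ξ : M → Type*) [TopologicalSpace (TotalSpace ℝ ξ)]
    [∀ x, AddCommGroup (ξ x)] [∀ x, Module ℝ (ξ x)] [∀ x, TopologicalSpace (ξ x)]
    [FiberBundle ℝ ξ] [VectorBundle ℝ ℝ ξ] :=
  Cₛ^∞⟮𝓡 n; ℝ, ξ⟯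

/-- Smooth functions on `M`. -/
abbrev SFun (n : ℕ) (M : Type*) [TopologicalSpace M] [ChartedSpace (Mdl n) M] :=
  C^∞⟮𝓡 n, M; 𝓘(ℝ, ℝ), ℝ⟯

/-- Multiplication of sections by a smooth function. -/
def mulOp (f : SFun n M) : Sec n ξ →ₗ[ℝ] Sec n ξ where
  toFun s := ⟨fun x => f x • s x, f.contMDiff.smul_section s.contMDiff⟩
  map_add' s t := by
    ext x
    exact smul_add _ _ _
  map_smul' c s := by
    ext x
    exact smul_comm _ _ _

/-- The iterated commutator `[… [[B, f₁], f₂] …, f_k]` of an operator `B` (whose values are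
not required to be smooth) with multiplications by functions. -/
def iterComm : {k : ℕ} → (Sec n ξ → Π x, ξ x) → (Fin k → SFun n M) → Sec n ξ → Π x, ξ x
  | 0, B, _ => B
  | _ + 1, B, f => iterComm (fun s x => B (mulOp (f 0) s) x - f 0 x • B s x) (Fin.tail f)

/-- `A` is a linear differential operator of order at most `k`. -/
def IsDiffOp (k : ℕ) (A : Sec n ξ →ₗ[ℝ] Sec n ξ) : Prop :=
  ∀ (f : Fin (k + 1) → SFun n M) (s : Sec n ξ) (x : M), iterComm (fun s x => A s x) f s x = 0

/-- `τ` is the value at `x` of the symbol of degree `k` of the operator `B` of order at most `k`: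
`[… [B, f₁] …, f_k] = k! τ (df₁, …, df_k)` at `x`. (So `∂^α` with `|α| = k` has as symbol the
polynomial `w^α`.) -/
def IsSymbolAt (B : Sec n ξ → Π x, ξ x) (k : ℕ) (x : M) (τ : Contra n k x) : Prop :=
  τ ∈ symPow k x ∧ ∀ (f : Fin k → SFun n M) (s : Sec n ξ),
    iterComm B f s x = ((k.factorial : ℝ) * τ (fun i => mvfderiv (𝓡 n) (f i) x)) • s x

open Classical in
/-- The symbol `smbl_k (B)` of an operator `B` of order at most `k`. -/
def smbl (B : Sec n ξ → Π x, ξ x) (k : ℕ) (x : M) : Contra n k x :=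
  if h : ∃ τ, IsSymbolAt B k x τ then h.choose else 0

/-- Linear connections in `ξ`. -/
abbrev LinConn (n : ℕ) {M : Type*} [TopologicalSpace M] [ChartedSpace (Mdl n) M]
    (ξ : M → Type*) [TopologicalSpace (TotalSpace ℝ ξ)]
    [∀ x, AddCommGroup (ξ x)] [∀ x, Module ℝ (ξ x)] [∀ x, TopologicalSpace (ξ x)]
    [FiberBundle ℝ ξ] [VectorBundle ℝ ℝ ξ]
    [∀ x, IsTopologicalAddGroup (ξ x)] [∀ x, ContinuousSMul ℝ (ξ x)] :=
  CovariantDerivative (𝓡 n) ℝ ξ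

variable [∀ x, IsTopologicalAddGroup (ξ x)] [∀ x, ContinuousSMul ℝ (ξ x)]

/-- The derivation `d^s : Σ^j(ξ) → Σ^{j+1}(ξ)` of a connection `D` in `TM` and a connection `N` in
`ξ`, for symmetric `ξ`-valued forms written as functions of tangent vectors: the symmetrization
`(d^s η) (v₀, …, v_j) = (1 / (j + 1)) ∑_i (∇_{v_i} η) (v₀, …, v̂_i, …, v_j)` of the covariant
derivative. -/
def dSym (D : AffConn n M) (N : LinConn n ξ) {j : ℕ}
    (η : Π x : M, (Fin j → Tan n x) → ξ x) : Π x : M, (Fin (j + 1) → Tan n x) → ξ x :=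
  fun x v => (1 / ((j : ℝ) + 1)) • ∑ i : Fin (j + 1),
    (N (fun y => η y (fun a => extend (Mdl n) (v (i.succAbove a)) y)) x (v i)
      - ∑ a : Fin j, η x (Function.update (fun b => v (i.succAbove b)) a
          (D (extend (Mdl n) (v (i.succAbove a))) x (v i))))

/-- `(d^s)^j h`. -/
def dSymPow (D : AffConn n M) (N : LinConn n ξ) (h : Sec n ξ) :
    (j : ℕ) → Π x : M, (Fin j → Tan n x) → ξ x
  | 0 => fun x _ => h x
  | j + 1 => dSym D N (dSymPow D N h j)

/-- The quantization `σ̂ (h) = (1 / k!) ⟨σ, (d^s)^k h⟩` of the symbol `σ`, defined by the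
connections `D` in `TM` and `N` in `ξ`. -/
def quantize (D : AffConn n M) (N : LinConn n ξ) {k : ℕ} (σ : Π x : M, Contra n k x)
    (h : Sec n ξ) : Π x, ξ x :=
  fun x => contract (σ x) (dSymPow D N h k x)

/-- The principal symbol of `A`, an operator of order at most `m + 1`. -/
def principal (m : ℕ) (A : Sec n ξ →ₗ[ℝ] Sec n ξ) : Π x : M, Contra n (m + 1) x :=
  smbl (fun s x => A s x) (m + 1)

/-- The subsymbol `smbl_m (A - σ̂)` of `A`, an operator of order at most `m + 1` with principal
symbol `σ`, defined by the connections `D` in `TM` and `N` in `ξ`. -/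
def subsymbol (m : ℕ) (A : Sec n ξ →ₗ[ℝ] Sec n ξ) (D : AffConn n M) (N : LinConn n ξ) :
    Π x : M, Contra n m x :=
  smbl (fun s x => A s x - quantize D N (principal m A) s x) m

/-- `A` is a Chern regular operator of order `k = m + 1`: its symbol `σ` is regular of constant
type and, for the exterior derivative `ω` of the torsion form of the Wagner connection of `σ`, at
each point `L_{[σ]} ∩ ker ω̂_{k-1} = 0` and `L_{[σ]} ∩ L⁰_{[σ]} = 0`. -/
def IsChernRegular (m : ℕ) (A : Sec n ξ →ₗ[ℝ] Sec n ξ) : Prop :=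
  IsDiffOp (m + 1) A ∧ IsRegularConstantType (principal m A) ∧
  ∀ D : AffConn n M, IsWagner (principal m A) D → ∀ x : M,
    (∀ γ ∈ contrSpace (principal m A x), omegaHat (extD (torsionForm D) x) γ = 0 → γ = 0) ∧
    contrSpace (principal m A x) ⊓ annSpace (extD (torsionForm D) x) (principal m A x) = ⊥

/-- The linear connection `N` is such that the subsymbol of `A`, an operator of order `k = m + 1`,
defined by `N` and by the Chern connection of `[σ]`, `σ = smbl_k A`, lies in `L⁰_{[σ]}` at each
point. -/
def IsAdapted (m : ℕ) (A : Sec n ξ →ₗ[ℝ] Sec n ξ) (N : LinConn n ξ) : Prop :=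
  ∃ D : AffConn n M, IsWagner (principal m A) D ∧ ∀ x : M,
    subsymbol m A (chernConn D) N x ∈ annSpace (extD (torsionForm D) x) (principal m A x)

/-- Two linear connections coincide: they agree on all differentiable sections. -/
def SameConn (N N' : LinConn n ξ) : Prop :=
  ∀ (s : Π x, ξ x) (x : M),
    MDifferentiableAt (𝓡 n) ((𝓡 n).prod 𝓘(ℝ, ℝ)) (fun y => (⟨y, s y⟩ : TotalSpace ℝ ξ)) x →
    N s x = N' s x

end Operators

end ChernReg

end

/-! Write `k = m + 1`. If the connection `N` in the line bundle is replaced by `N + a` with a 1-form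
`a`, the `k`-th symmetrized differential changes, at order `k - 1`, by products of `a` with `k - 1`
copies of the differential. Hence the quantization changes by an operator with symbol `k (a ⌟ σ)`
and the subsymbol by `-k (a ⌟ σ)` (`subsymbol_of_add`). So, starting from any smooth connection
`N₀`, the question at each point is whether the subsymbol can be moved into `L⁰` by a unique element
of `L = {a ⌟ σ}`. The condition `L ∩ L⁰ = 0` says that the bilinear form `(a, ψ) ↦ ⟨a ⌟ σ, ω̂ (ψ ⌟
σ)⟩` on covectors is nondegenerate, because `a ↦ a ⌟ σ` is injective for a regular symbol. Linear
algebra then gives one and only one `a`, and `a` is smooth as the solution of an injective linear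
system with smooth coefficients.

This presupposes the Wagner connection. Its equation says that the derivative of `σ` in each
direction is the infinitesimal action of an endomorphism on `σ`. Constant type gives existence: in a
coordinate coframe the symbol stays in one `GL`-orbit, so its derivatives are tangent to the orbit.
The transformations realizing the orbit condition are not assumed continuous, and tangency is
obtained by a Baire category argument (`deriv_mem_range_infAct`). Regularity gives uniqueness: if an
endomorphism kills `h` infinitesimally, its flow preserves `h`, hence every rational invariant is
constant along the flow, and `n` invariants with independent differentials force the endomorphism to
vanish (`infAct_eq_zero_of_isRegularForm`). Uniqueness of the solution also yields smoothness of the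
connection.

For the conformal class, the Wagner connection of `f σ` is `D + g df` with `g = -1 / (k f)`. The
torsion form changes by `(n - 1) g df`, which is closed, so `ω` is unchanged; the Chern connection
is unchanged too, and so are `L` and `L⁰`, while the subsymbol is multiplied by `f`
(`IsAdapted.mulOp_comp`). -/

noncomputable section

namespace ChernReg

set_option linter.unusedSectionVars false

/-! ### Polarization of symmetric multilinear maps. -/

section Polarization

/-- The polarization formula for symmetric multilinear maps. -/
theorem sum_neg_one_pow_card_map_sum {R E W : Type*} [CommRing R] [AddCommGroup E] [Module R E]
    [AddCommGroup W] [Module R W] {k : ℕ} (f : MultilinearMap R (fun _ : Fin k => E) W)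
    (hf : ∀ (e : Equiv.Perm (Fin k)) (v : Fin k → E), f (fun i => v (e i)) = f v) (v : Fin k → E) :
    ∑ S : Finset (Fin k), (-1 : R) ^ (Sᶜ.card) • f (fun _ => ∑ i ∈ S, v i) =
      (k.factorial : R) • f v := by
  classical
  have h1 : ∀ S : Finset (Fin k), f (fun _ => ∑ i ∈ S, v i) =
      ∑ r : Fin k → Fin k, if ∀ a, r a ∈ S then f (fun a => v (r a)) else 0 := by
    intro S
    rw [MultilinearMap.map_sum_finset]
    rw [← Finset.sum_filter]
    refine Finset.sum_congr ?_ fun _ _ => rfl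
    ext r
    simp [Fintype.mem_piFinset]
  simp_rw [h1, Finset.smul_sum]
  rw [Finset.sum_comm]
  -- After expansion, the coefficient of `f (v ∘ r)` is the alternating sum over all `S` containing
  -- the image of `r`. It vanishes unless the image is everything, that is, unless `r` is a
  -- permutation.
  have h2 : ∀ r : Fin k → Fin k, (∑ S : Finset (Fin k), (-1 : R) ^ (Sᶜ.card) •
      (if ∀ a, r a ∈ S then f (fun a => v (r a)) else 0)) =
      if Function.Bijective r then f v else 0 := by
    intro r
    have h3 : (∑ S : Finset (Fin k), (-1 : R) ^ (Sᶜ.card) •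
        (if ∀ a, r a ∈ S then f (fun a => v (r a)) else 0)) =
        (∑ T ∈ (Finset.univ.image r)ᶜ.powerset, (-1 : R) ^ T.card) • f (fun a => v (r a)) := by
      rw [Finset.sum_smul]
      rw [← Equiv.sum_comp (Equiv.mk (fun S : Finset (Fin k) => Sᶜ) (fun S => Sᶜ)
        (fun S => compl_compl S) (fun S => compl_compl S))]
      rw [← Finset.sum_filter_add_sum_filter_not Finset.univ
        (fun T : Finset (Fin k) => T ⊆ (Finset.univ.image r)ᶜ)]
      have e1 : ∀ T : Finset (Fin k), T ⊆ (Finset.univ.image r)ᶜ ↔ ∀ a, r a ∈ Tᶜ := by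
        intro T
        rw [Finset.subset_compl_comm, Finset.image_subset_iff]
        simp
      rw [Finset.sum_eq_zero (s := Finset.univ.filter (fun T => ¬ _))]
      · rw [add_zero]
        refine Finset.sum_congr ?_ ?_
        · ext T; simp
        · intro T hT
          rw [Finset.mem_powerset] at hT
          simp only [Equiv.coe_fn_mk, compl_compl]
          rw [if_pos ((e1 T).1 hT)]
      · intro T hT
        rw [Finset.mem_filter] at hT
        simp only [Equiv.coe_fn_mk]
        rw [if_neg (fun h => hT.2 ((e1 T).2 h)), smul_zero]
    rw [h3]
    have h4 : (∑ T ∈ (Finset.univ.image r)ᶜ.powerset, (-1 : R) ^ T.card) =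
        if (Finset.univ.image r)ᶜ = ∅ then 1 else 0 := by
      have := congrArg (Int.cast : ℤ → R)
        (Finset.sum_powerset_neg_one_pow_card (x := (Finset.univ.image r)ᶜ))
      push_cast at this
      simpa using this
    rw [h4]
    have h5 : (Finset.univ.image r)ᶜ = ∅ ↔ Function.Bijective r := by
      rw [Finset.compl_eq_empty_iff, ← Finite.surjective_iff_bijective]
      constructor
      · intro h y
        have := Finset.mem_univ y
        rw [← h] at this
        simpa using this
      · intro h
        exact Finset.image_univ_of_surjective h
    by_cases hr : Function.Bijective r
    · rw [if_pos (h5.2 hr), if_pos hr, one_smul]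
      exact hf (Equiv.ofBijective r hr) v
    · rw [if_neg (fun h => hr (h5.1 h)), if_neg hr, zero_smul]
  rw [Finset.sum_congr rfl fun r _ => h2 r]
  rw [← Finset.sum_filter, Finset.sum_const]
  have h6 : (Finset.univ.filter fun r : Fin k → Fin k => Function.Bijective r).card =
      k.factorial := by
    have : Fintype.card (Equiv.Perm (Fin k)) = k.factorial := by
      rw [Fintype.card_perm, Fintype.card_fin]
    rw [← this, ← Fintype.card_subtype]
    exact Fintype.card_congr
      { toFun := fun r => Equiv.ofBijective r.1 r.2
        invFun := fun e => ⟨e, e.bijective⟩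
        left_inv := fun r => rfl
        right_inv := fun e => by ext; rfl }
  rw [h6, ← Nat.cast_smul_eq_nsmul R]

/-- A symmetric multilinear map that vanishes on the diagonal is zero. -/
theorem eq_zero_of_diagonal_eq_zero {E W : Type*} [AddCommGroup E] [Module ℝ E]
    [AddCommGroup W] [Module ℝ W] {k : ℕ} (f : MultilinearMap ℝ (fun _ : Fin k => E) W)
    (hf : ∀ (e : Equiv.Perm (Fin k)) (v : Fin k → E), f (fun i => v (e i)) = f v)
    (h : ∀ w, f (fun _ => w) = 0) : f = 0 := by
  ext v
  have := sum_neg_one_pow_card_map_sum f hf v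
  simp only [h, smul_zero, Finset.sum_const_zero] at this
  have h2 : (k.factorial : ℝ) ≠ 0 := by exact_mod_cast k.factorial_ne_zero
  exact (smul_eq_zero.1 this.symm).resolve_left h2

end Polarization

/-! ### Hadamard's lemma in a vector space. -/

section Hadamard

universe u

-- Differentiation under the integral gives an integral of the same kind, with weight `φ t * t` and
-- integrand `fderiv ℝ H`. The induction on the order therefore needs arbitrary `φ` and `W`; the
-- shared universe lets `E →L[ℝ] W` take the place of `W`.
open MeasureTheory Topology in
theorem contDiff_integral_dilation {E : Type u} [NormedAddCommGroup E] [NormedSpace ℝ E]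
    [FiniteDimensional ℝ E] (N : ℕ) :
    ∀ {W : Type u} [NormedAddCommGroup W] [NormedSpace ℝ W] (φ : ℝ → ℝ) (H : E → W),
      Continuous φ → ContDiff ℝ ∞ H →
      ContDiff ℝ N (fun z => ∫ t in (0 : ℝ)..1, φ t • H (t • z)) := by
  induction N with
  | zero =>
    intro W _ _ φ H hφ hH
    have hH' := hH.continuous
    rw [Nat.cast_zero, contDiff_zero]
    apply intervalIntegral.continuous_parametric_intervalIntegral_of_continuous'
    fun_prop
  | succ N ih =>
    intro W _ _ φ H hφ hH
    have hc := hH.continuous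
    have hH' : ContDiff ℝ ∞ (fderiv ℝ H) := hH.fderiv_right (by simp)
    have hc' := hH'.continuous
    have hd : Differentiable ℝ H := hH.differentiable (by simp)
    have key : ∀ z, HasFDerivAt (fun z => ∫ t in (0 : ℝ)..1, φ t • H (t • z))
        (∫ t in (0 : ℝ)..1, (φ t * t) • fderiv ℝ H (t • z)) z := by
      intro z
      have hcomp : IsCompact (Set.Icc (0 : ℝ) 1 ×ˢ Metric.closedBall z 1) :=
        isCompact_Icc.prod (isCompact_closedBall z 1)
      have hcont : Continuous (fun p : ℝ × E => (φ p.1 * p.1) • fderiv ℝ H (p.1 • p.2)) := by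
        fun_prop
      obtain ⟨C, hC⟩ := hcomp.exists_bound_of_continuousOn hcont.continuousOn
      refine intervalIntegral.hasFDerivAt_integral_of_dominated_of_fderiv_le
        (F := fun z t => φ t • H (t • z)) (F' := fun z t => (φ t * t) • fderiv ℝ H (t • z))
        (s := Metric.ball z 1) (bound := fun _ => C)
        (Metric.ball_mem_nhds z one_pos) ?_ ?_ ?_ ?_ ?_ ?_
      · refine Filter.Eventually.of_forall fun y => Continuous.aestronglyMeasurable ?_
        fun_prop
      · apply Continuous.intervalIntegrable
        fun_prop
      · have : SecondCountableTopologyEither ℝ (E →L[ℝ] W) :=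
          secondCountableTopologyEither_of_left _ _
        apply Continuous.aestronglyMeasurable
        fun_prop
      · refine Filter.Eventually.of_forall fun t ht y hy => ?_
        rw [Set.uIoc_of_le zero_le_one] at ht
        exact hC (t, y) ⟨⟨ht.1.le, ht.2⟩, Metric.ball_subset_closedBall hy⟩
      · exact intervalIntegrable_const
      · refine Filter.Eventually.of_forall fun t ht y hy => ?_
        have h1 : HasFDerivAt (fun y : E => t • y) (t • ContinuousLinearMap.id ℝ E) y :=
          (hasFDerivAt_id y).const_smul t
        have h2 := ((hd (t • y)).hasFDerivAt.comp y h1).const_smul (φ t)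
        refine HasFDerivAt.congr_fderiv h2 ?_
        ext w
        simp [mul_smul]
    push_cast
    rw [contDiff_succ_iff_fderiv]
    refine ⟨fun z => (key z).differentiableAt, by simp, ?_⟩
    have : fderiv ℝ (fun z => ∫ t in (0 : ℝ)..1, φ t • H (t • z)) =
        fun z => ∫ t in (0 : ℝ)..1, (φ t * t) • fderiv ℝ H (t • z) :=
      funext fun z => (key z).fderiv
    rw [this]
    exact ih (fun t => φ t * t) (fderiv ℝ H) (by fun_prop) hH'

/-- Hadamard's lemma. -/
theorem exists_contDiff_eq_add_clm {E W : Type u} [NormedAddCommGroup E] [NormedSpace ℝ E]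
    [FiniteDimensional ℝ E] [NormedAddCommGroup W] [NormedSpace ℝ W] [CompleteSpace W]
    (F : E → W) (hF : ContDiff ℝ ∞ F) :
    ∃ G : E → E →L[ℝ] W, ContDiff ℝ ∞ G ∧ G 0 = fderiv ℝ F 0 ∧ ∀ z, F z = F 0 + G z z := by
  have hF' : ContDiff ℝ ∞ (fderiv ℝ F) := hF.fderiv_right (by simp)
  have hc' := hF'.continuous
  -- `F z - F 0` is the integral over `[0, 1]` of the derivative of `t ↦ F (t • z)`. The factor `1`
  -- is the weight `φ` of `contDiff_integral_dilation`.
  refine ⟨fun z => ∫ t in (0 : ℝ)..1, (1 : ℝ) • fderiv ℝ F (t • z), ?_, ?_, ?_⟩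
  · rw [contDiff_infty]
    intro N
    exact contDiff_integral_dilation N (fun _ => 1) (fderiv ℝ F) continuous_const hF'
  · simp
  · intro z
    rw [ContinuousLinearMap.intervalIntegral_apply]
    · have hd : ∀ t ∈ Set.uIcc (0 : ℝ) 1, HasDerivAt (fun t : ℝ => F (t • z))
          ((1 : ℝ) • fderiv ℝ F (t • z) z) t := by
        intro t _
        have h1 : HasDerivAt (fun t : ℝ => t • z) z t := by
          simpa using (hasDerivAt_id t).smul_const z
        have h2 := ((hF.differentiable (by simp)) (t • z)).hasFDerivAt.comp_hasDerivAt t h1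
        simpa [Function.comp_def] using h2
      have := intervalIntegral.integral_eq_sub_of_hasDerivAt hd
        (Continuous.intervalIntegrable (by fun_prop) 0 1)
      simp only [one_smul, zero_smul] at this ⊢
      rw [this]
      abel
    · apply Continuous.intervalIntegrable
      fun_prop

end Hadamard

/-! ### Curves contained in an orbit of multilinear forms. -/

section Orbits

open Topology Filter

variable {E : Type} [NormedAddCommGroup E] [NormedSpace ℝ E] {k : ℕ}

theorem tendsto_clm_comp {ι : Type*} {l : Filter ι} {g h : ι → E →L[ℝ] E} {g₀ h₀ : E →L[ℝ] E}
    (hg : Tendsto g l (𝓝 g₀)) (hh : Tendsto h l (𝓝 h₀)) :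
    Tendsto (fun s => g s ∘L h s) l (𝓝 (g₀ ∘L h₀)) :=
  ((continuous_fst.clm_comp continuous_snd).tendsto (g₀, h₀)).comp (hg.prodMk_nhds hh)

theorem tendsto_clm_apply {ι : Type*} {l : Filter ι} {g : ι → E →L[ℝ] E} {g₀ : E →L[ℝ] E}
    (hg : Tendsto g l (𝓝 g₀)) (w : E) : Tendsto (fun s => g s w) l (𝓝 (g₀ w)) :=
  ((ContinuousLinearMap.apply ℝ E w).continuous.tendsto g₀).comp hg

/-- The substitution `(v₁, …, v_k) ↦ f (g v₁, …, g v_k)`. -/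
def substTensor (g : E →L[ℝ] E) (f : E [×k]→L[ℝ] ℝ) : E [×k]→L[ℝ] ℝ :=
  f.compContinuousLinearMap (fun _ => g)

@[simp] theorem substTensor_apply (g : E →L[ℝ] E) (f : E [×k]→L[ℝ] ℝ) (v : Fin k → E) :
    substTensor g f v = f (fun i => g (v i)) := rfl

/-- The infinitesimal action of endomorphisms on multilinear forms. -/
def infActL (E : Type) [NormedAddCommGroup E] [NormedSpace ℝ E] (k : ℕ) :
    (E [×k]→L[ℝ] ℝ) →L[ℝ] (E →L[ℝ] E) →L[ℝ] (E [×k]→L[ℝ] ℝ) :=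
  (((ContinuousMultilinearMap.compContinuousLinearMapContinuousMultilinear ℝ
    (fun _ : Fin k => E) (fun _ : Fin k => E) ℝ).linearDeriv
      (fun _ => ContinuousLinearMap.id ℝ E)).comp
    (ContinuousLinearMap.pi fun _ => ContinuousLinearMap.id ℝ (E →L[ℝ] E))).flip

/-- The infinitesimal action of endomorphisms on the multilinear form `f`. -/
abbrev infAct (f : E [×k]→L[ℝ] ℝ) : (E →L[ℝ] E) →L[ℝ] (E [×k]→L[ℝ] ℝ) := infActL E k f

theorem infAct_apply (f : E [×k]→L[ℝ] ℝ) (a : E →L[ℝ] E) (v : Fin k → E) :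
    infAct f a v = ∑ i, f (Function.update v i (a (v i))) := by
  rw [infAct, infActL, ContinuousLinearMap.flip_apply, ContinuousLinearMap.comp_apply,
    ContinuousMultilinearMap.linearDeriv_apply, sum_apply,
    sum_apply]
  refine Finset.sum_congr rfl fun i _ => ?_
  simp only [ContinuousMultilinearMap.compContinuousLinearMapContinuousMultilinear_apply_apply,
    ContinuousMultilinearMap.compContinuousLinearMap_apply]
  congr 1
  ext j : 1
  by_cases h : j = i
  · subst h; simp
  · simp [h]

theorem hasStrictFDerivAt_substTensor (f : E [×k]→L[ℝ] ℝ) :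
    HasStrictFDerivAt (fun a : E →L[ℝ] E => substTensor (ContinuousLinearMap.id ℝ E + a) f)
      (infAct f) 0 := by
  have h1 : HasStrictFDerivAt
      (fun a : E →L[ℝ] E => (fun _ : Fin k => ContinuousLinearMap.id ℝ E + a))
      (ContinuousLinearMap.pi fun _ => ContinuousLinearMap.id ℝ (E →L[ℝ] E)) 0 := by
    rw [hasStrictFDerivAt_pi]
    intro i
    exact (hasStrictFDerivAt_id _).const_add _
  have h2 := ContinuousMultilinearMap.hasStrictFDerivAt_compContinuousLinearMap
    (f, fun _ : Fin k => ContinuousLinearMap.id ℝ E + 0)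
  have h3 := h2.comp (0 : E →L[ℝ] E) ((hasStrictFDerivAt_const f 0).prodMk h1)
  refine HasStrictFDerivAt.congr_fderiv h3 ?_
  refine ContinuousLinearMap.ext fun a => ContinuousMultilinearMap.ext fun v => ?_
  rw [infAct_apply]
  simp only [ContinuousLinearMap.comp_apply, add_apply,
    ContinuousLinearMap.prod_apply, zero_apply,
    ContinuousLinearMap.coe_fst', ContinuousLinearMap.coe_snd', map_zero, zero_add,
    ContinuousMultilinearMap.fderivCompContinuousLinearMap_apply]
  refine Finset.sum_congr rfl fun i _ => ?_
  congr 1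
  ext j : 1
  by_cases h : j = i
  · subst h; simp
  · simp [h]

/-- Moving a form by `g` conjugates the acting endomorphism by `g`. Triviality of the infinitesimal
stabilizer is thus a property of the orbit. -/
theorem infAct_substTensor (f : E [×k]→L[ℝ] ℝ) (g g' a : E →L[ℝ] E)
    (h : ∀ w, g' (g w) = w) :
    infAct (substTensor g f) a = substTensor g (infAct f (g ∘L a ∘L g')) := by
  ext v
  simp only [infAct_apply, substTensor_apply]
  refine Finset.sum_congr rfl fun i _ => ?_
  congr 1
  ext j : 1
  by_cases hj : j = i
  · subst hj; simp [h]
  · simp [hj]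

theorem infAct_injective_of_substTensor (f : E [×k]→L[ℝ] ℝ) (g g' : E →L[ℝ] E)
    (h : ∀ w, g' (g w) = w) (h' : ∀ w, g (g' w) = w)
    (hf : ∀ a, infAct f a = 0 → a = 0) (a : E →L[ℝ] E) (ha : infAct (substTensor g f) a = 0) :
    a = 0 := by
  rw [infAct_substTensor f g g' a h] at ha
  have h1 : infAct f (g ∘L a ∘L g') = 0 := by
    ext v
    have := congrArg (fun φ => φ (fun i => g' (v i))) ha
    simpa [h'] using this
  have h2 := hf _ h1
  ext w
  have := congrArg (fun φ => g' (φ (g w))) h2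
  simpa [h] using this

instance [FiniteDimensional ℝ E] : FiniteDimensional ℝ (E [×k]→L[ℝ] ℝ) :=
  FiniteDimensional.of_injective
    (ContinuousMultilinearMap.toMultilinearMapLinear :
      (E [×k]→L[ℝ] ℝ) →ₗ[ℝ] MultilinearMap ℝ (fun _ : Fin k => E) ℝ)
    ContinuousMultilinearMap.toMultilinearMap_injective

variable [FiniteDimensional ℝ E]

/-- A left inverse of the infinitesimal action at `f`. -/
theorem exists_leftInverse_infAct (f : E [×k]→L[ℝ] ℝ) (hf : ∀ a, infAct f a = 0 → a = 0) :
    ∃ R : (E [×k]→L[ℝ] ℝ) →L[ℝ] (E →L[ℝ] E), ∀ a, R (infAct f a) = a := by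
  obtain ⟨R, hR⟩ := LinearMap.exists_leftInverse_of_injective
    (infAct f : (E →L[ℝ] E) →ₗ[ℝ] (E [×k]→L[ℝ] ℝ)) (by
      rw [LinearMap.ker_eq_bot']
      exact hf)
  exact ⟨LinearMap.toContinuousLinearMap R, fun a => LinearMap.congr_fun hR a⟩

/-- If a differentiable curve `c` of tensors meets the part of an orbit that comes from a bounded set
of transformations along a sequence converging to `t`, then `c' t` is tangent to the orbit. -/
theorem deriv_mem_range_infAct_of_accumulation (c : ℝ → E [×k]→L[ℝ] ℝ)
    (f₀ : E [×k]→L[ℝ] ℝ) (hf : ∀ a, infAct f₀ a = 0 → a = 0) (t : ℝ)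
    (hc : DifferentiableAt ℝ c t) (N : ℝ) (S : Set ℝ) (hS : (𝓝[S \ {t}] t).NeBot)
    (hSc : ∀ s ∈ S, ∃ g g' : E →L[ℝ] E, (∀ w, g' (g w) = w) ∧ (∀ w, g (g' w) = w) ∧
      ‖g‖ ≤ N ∧ ‖g'‖ ≤ N ∧ c s = substTensor g f₀) :
    ∃ a, deriv c t = infAct (c t) a := by
  classical
  choose! g g' hg1 hg2 hgN hgN' hgc using hSc
  -- The chosen `g s` need not depend continuously on `s`. Along an ultrafilter converging to `t`
  -- inside `S \ {t}`, the bounded families `g` and `g'` converge by compactness, and their limits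
  -- are again mutually inverse.
  let U : Ultrafilter ℝ := Ultrafilter.of (𝓝[S \ {t}] t)
  have hU : (U : Filter ℝ) ≤ 𝓝[S \ {t}] t := Ultrafilter.of_le _
  have hUS : ∀ᶠ s in (U : Filter ℝ), s ∈ S :=
    Filter.mem_of_superset (hU self_mem_nhdsWithin) fun s hs => hs.1
  have hUt : (U : Filter ℝ) ≤ 𝓝[≠] t :=
    hU.trans (nhdsWithin_mono _ fun s hs => hs.2)
  have hUn : (U : Filter ℝ) ≤ 𝓝 t := hUt.trans nhdsWithin_le_nhds
  have hcpt : ∀ γ : ℝ → E →L[ℝ] E, (∀ s ∈ S, ‖γ s‖ ≤ N) → ∃ γ₀, Tendsto γ U (𝓝 γ₀) := by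
    intro γ hγ
    obtain ⟨γ₀, -, h⟩ := (isCompact_closedBall (0 : E →L[ℝ] E) N).ultrafilter_le_nhds
      (U.map γ) (by
        rw [le_principal_iff]
        change _ ∈ (U : Filter ℝ)
        filter_upwards [hUS] with s hs
        simpa using hγ s hs)
    exact ⟨γ₀, h⟩
  obtain ⟨γ, hγ⟩ := hcpt g hgN
  obtain ⟨γ', hγ'⟩ := hcpt g' hgN'
  have e1 : ∀ w, γ' (γ w) = w := by
    intro w
    have h1 : Tendsto (fun s => (g' s ∘L g s) w) U (𝓝 ((γ' ∘L γ) w)) :=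
      tendsto_clm_apply (tendsto_clm_comp hγ' hγ) w
    refine tendsto_nhds_unique h1 (tendsto_const_nhds.congr' ?_)
    filter_upwards [hUS] with s hs
    simp [hg1 s hs]
  have e2 : ∀ w, γ (γ' w) = w := by
    intro w
    have h1 : Tendsto (fun s => (g s ∘L g' s) w) U (𝓝 ((γ ∘L γ') w)) :=
      tendsto_clm_apply (tendsto_clm_comp hγ hγ') w
    refine tendsto_nhds_unique h1 (tendsto_const_nhds.congr' ?_)
    filter_upwards [hUS] with s hs
    simp [hg2 s hs]
  have ect : c t = substTensor γ f₀ := by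
    ext v
    have h1 : Tendsto (fun s => c s v) U (𝓝 (c t v)) := by
      have : Tendsto c U (𝓝 (c t)) := hc.continuousAt.tendsto.mono_left hUn
      exact ((ContinuousMultilinearMap.apply ℝ (fun _ : Fin k => E) ℝ v).continuous.tendsto
        _).comp this
    have h2 : Tendsto (fun s => substTensor (g s) f₀ v) U (𝓝 (substTensor γ f₀ v)) := by
      simp only [substTensor_apply]
      refine (f₀.cont.tendsto _).comp (tendsto_pi_nhds.2 fun i => ?_)
      exact tendsto_clm_apply hγ _
    refine tendsto_nhds_unique h1 (h2.congr' ?_)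
    filter_upwards [hUS] with s hs
    rw [hgc s hs]
  have hinj : ∀ a, infAct (c t) a = 0 → a = 0 := by
    rw [ect]
    exact infAct_injective_of_substTensor f₀ γ γ' e1 e2 hf
  obtain ⟨R, hR⟩ := exists_leftInverse_infAct (c t) hinj
  let F : (E →L[ℝ] E) → (E [×k]→L[ℝ] ℝ) :=
    fun a => substTensor (ContinuousLinearMap.id ℝ E + a) (c t)
  have hF : HasStrictFDerivAt F (infAct (c t)) 0 := hasStrictFDerivAt_substTensor (c t)
  have hF0 : F 0 = c t := by
    ext v; simp [F]
  -- `R ∘ F` has derivative the identity at `0`, so it has a local inverse `G`; then `F ∘ G ∘ R` is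
  -- the identity on the values of `F` near `c t`.
  have hRF : HasStrictFDerivAt (fun a => R (F a))
      ((ContinuousLinearEquiv.refl ℝ (E →L[ℝ] E) : (E →L[ℝ] E) ≃L[ℝ] (E →L[ℝ] E)) :
        (E →L[ℝ] E) →L[ℝ] (E →L[ℝ] E)) 0 := by
    refine (R.hasStrictFDerivAt.comp (0 : E →L[ℝ] E) hF).congr_fderiv ?_
    refine ContinuousLinearMap.ext fun a => ?_
    simp [hR]
  let G := hRF.localInverse (fun a => R (F a)) _ 0
  have hG : HasStrictFDerivAt G (ContinuousLinearMap.id ℝ (E →L[ℝ] E)) (R (c t)) := by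
    have := hRF.to_localInverse
    rw [hF0] at this
    exact this
  have hG0 : G (R (c t)) = 0 := by
    have := hRF.localInverse_apply_image
    simp only [hF0] at this
    exact this
  -- along the ultrafilter, `c s = F (G (R (c s)))`
  have hev : ∀ᶠ s in (U : Filter ℝ), c s = F (G (R (c s))) := by
    -- The increment `γ' g s - 1` tends to `0`, and `F` maps it to `c s`, since `c t` is the
    -- substitution of `γ` and `γ γ' = 1`.
    have ha : Tendsto (fun s => γ' ∘L g s - ContinuousLinearMap.id ℝ E) U (𝓝 0) := by
      have h1 : Tendsto (fun s => γ' ∘L g s - ContinuousLinearMap.id ℝ E) U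
          (𝓝 (γ' ∘L γ - ContinuousLinearMap.id ℝ E)) :=
        ((tendsto_clm_comp tendsto_const_nhds hγ).sub tendsto_const_nhds)
      have h2 : γ' ∘L γ - ContinuousLinearMap.id ℝ E = 0 := by
        ext w; simp [e1]
      rwa [h2] at h1
    have h3 := ha.eventually hRF.eventually_left_inverse
    filter_upwards [h3, hUS] with s hs hsS
    have h4 : F (γ' ∘L g s - ContinuousLinearMap.id ℝ E) = c s := by
      rw [hgc s hsS]
      ext v
      simp [F, ect, e2]
    rw [h4] at hs
    change G (R (c s)) = _ at hs
    rw [hs, h4]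
  have hd1 : HasDerivAt (fun s => F (G (R (c s)))) (infAct (c t) (R (deriv c t))) t := by
    have h1 : HasDerivAt (fun s => R (c s)) (R (deriv c t)) t :=
      R.hasFDerivAt.comp_hasDerivAt t hc.hasDerivAt
    have h2 : HasDerivAt (fun s => G (R (c s))) (R (deriv c t)) t :=
      HasFDerivAt.comp_hasDerivAt (f := fun s => R (c s)) t hG.hasFDerivAt h1
    have h3 : HasFDerivAt F (infAct (c t)) (G (R (c t))) := by
      rw [hG0]; exact hF.hasFDerivAt
    exact h3.comp_hasDerivAt t h2
  -- `c` and `F ∘ G ∘ R ∘ c` are differentiable at `t` and agree at `t` and along the ultrafilter.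
  -- The slopes of their difference vanish there, so the two derivatives are equal.
  have hd2 := hc.hasDerivAt.sub hd1
  have h5 := (hasDerivAt_iff_tendsto_slope.1 hd2).mono_left hUt
  have h6 : deriv c t - infAct (c t) (R (deriv c t)) = 0 := by
    refine tendsto_nhds_unique h5 (tendsto_const_nhds.congr' ?_)
    filter_upwards [hev] with s hs
    simp [slope, ← hs, hG0, hF0]
  exact ⟨_, sub_eq_zero.1 h6⟩

/-- A differentiable curve of tensors which stays in the orbit of a tensor with trivial infinitesimal
stabilizer is tangent to this orbit. -/
theorem deriv_mem_range_infAct (c : ℝ → E [×k]→L[ℝ] ℝ)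
    (f₀ : E [×k]→L[ℝ] ℝ) (hf : ∀ a, infAct f₀ a = 0 → a = 0) (t₀ : ℝ)
    (hc : ∀ᶠ t in 𝓝 t₀, ContDiffAt ℝ 1 c t)
    (hSc : ∀ᶠ t in 𝓝 t₀, ∃ g g' : E →L[ℝ] E, (∀ w, g' (g w) = w) ∧ (∀ w, g (g' w) = w) ∧
      c t = substTensor g f₀) :
    ∃ a, deriv c t₀ = infAct (c t₀) a := by
  obtain ⟨ε, hε, hball⟩ := Metric.eventually_nhds_iff_ball.1 (hc.and hSc)
  set J := Metric.ball t₀ ε with hJ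
  have hJo : IsOpen J := Metric.isOpen_ball
  let A : ℕ → Set ℝ := fun N => {s | s ∈ J ∧ ∃ g g' : E →L[ℝ] E, (∀ w, g' (g w) = w) ∧
      (∀ w, g (g' w) = w) ∧ ‖g‖ ≤ N ∧ ‖g'‖ ≤ N ∧ c s = substTensor g f₀}
  -- Baire category: the complement of `J` and the closures of the sets `A N` cover the line, so
  -- their interiors have dense union. At a point of the interior of `closure (A N)` the bounded
  -- case applies.
  let D : Option ℕ → Set ℝ := fun o => o.elim Jᶜ (fun N => closure (A N))
  have hDc : ∀ o, IsClosed (D o) := by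
    rintro (_ | N)
    · exact hJo.isClosed_compl
    · exact isClosed_closure
  have hDu : ⋃ o, D o = Set.univ := by
    refine Set.eq_univ_of_forall fun s => ?_
    rw [Set.mem_iUnion]
    by_cases hs : s ∈ J
    · obtain ⟨-, g, g', h1, h2, h3⟩ := hball s hs
      obtain ⟨N, hN⟩ := exists_nat_ge (max ‖g‖ ‖g'‖)
      exact ⟨some N, subset_closure ⟨hs, g, g', h1, h2, (le_max_left _ _).trans hN,
        (le_max_right _ _).trans hN, h3⟩⟩
    · exact ⟨none, hs⟩
  have hdense := dense_iUnion_interior_of_closed hDc hDu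
  let T : Set ℝ := {t | t ∈ J ∧ ∃ a, deriv c t = infAct (c t) a}
  have hT : t₀ ∈ closure T := by
    rw [mem_closure_iff]
    intro V hV htV
    obtain ⟨t, ⟨htV, htJ⟩, hto⟩ := hdense.inter_open_nonempty (V ∩ J) (hV.inter hJo)
      ⟨t₀, htV, Metric.mem_ball_self hε⟩
    rw [Set.mem_iUnion] at hto
    obtain ⟨o, ho⟩ := hto
    refine ⟨t, htV, htJ, ?_⟩
    cases o with
    | none => exact absurd htJ (interior_subset ho)
    | some N =>
      refine deriv_mem_range_infAct_of_accumulation c f₀ hf t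
        ((hball t htJ).1.differentiableAt one_ne_zero) N (A N) ?_ (fun s hs => hs.2)
      rw [← mem_closure_iff_nhdsWithin_neBot]
      -- A point of an open subset of the line is not isolated in it, so `t` is a limit of points of
      -- `A N` other than `t`.
      have h1 : t ∈ closure (interior (D (some N)) ∩ {t}ᶜ) := by
        have h2 : t ∈ closure ({t}ᶜ : Set ℝ) := by
          have : Dense ({t}ᶜ : Set ℝ) := dense_compl_singleton t
          exact this t
        exact isOpen_interior.inter_closure (Set.mem_inter ho h2)
      have h3 : interior (D (some N)) ∩ {t}ᶜ ⊆ closure (A N \ {t}) := by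
        have h4 : IsOpen (interior (D (some N)) ∩ {t}ᶜ) :=
          isOpen_interior.inter isOpen_compl_singleton
        intro s hs
        have h5 := h4.inter_closure (Set.mem_inter hs (interior_subset hs.1))
        refine closure_mono ?_ h5
        rintro r ⟨⟨-, hr⟩, hA⟩
        exact ⟨hA, hr⟩
      exact closure_minimal h3 isClosed_closure h1
  -- continuity
  have hinj : ∀ a, infAct (c t₀) a = 0 → a = 0 := by
    obtain ⟨-, g, g', h1, h2, h3⟩ := hball t₀ (Metric.mem_ball_self hε)
    rw [h3]
    exact infAct_injective_of_substTensor f₀ g g' h1 h2 hf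
  obtain ⟨R, hR⟩ := exists_leftInverse_infAct (c t₀) hinj
  -- Passage to the limit. `K` is the identity at `t₀`, hence invertible nearby. Tangency at `t`
  -- forces the endomorphism to be `K⁻¹ R (c' t)`, which is continuous at `t₀`, so tangency on the
  -- set `T` accumulating at `t₀` extends to `t₀`.
  let K : ℝ → ((E →L[ℝ] E) →L[ℝ] (E →L[ℝ] E)) := fun t => R ∘L infAct (c t)
  have hc0 : ContDiffAt ℝ 1 c t₀ := (hball t₀ (Metric.mem_ball_self hε)).1
  have hcc : ContinuousAt c t₀ := hc0.continuousAt
  have hcd : ContinuousAt (deriv c) t₀ := by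
    have h1 : ContinuousAt (fderiv ℝ c) t₀ :=
      (hc0.fderiv_right (m := 0) (by simp)).continuousAt
    exact h1.clm_apply continuousAt_const
  have hLc : ContinuousAt (fun t => infAct (c t)) t₀ :=
    (infActL E k).continuous.continuousAt.comp hcc
  have hK : ContinuousAt K t₀ := continuousAt_const.clm_comp hLc
  have hK0 : K t₀ = 1 := by
    refine ContinuousLinearMap.ext fun a => ?_
    simp [K, hR]
  have hKi : ContinuousAt (fun t => Ring.inverse (K t)) t₀ := by
    have h1 : ContinuousAt Ring.inverse (K t₀) := by
      rw [hK0]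
      exact NormedRing.inverse_continuousAt (R := (E →L[ℝ] E) →L[ℝ] (E →L[ℝ] E)) 1
    exact ContinuousAt.comp (f := K) h1 hK
  have hKu : ∀ᶠ t in 𝓝 t₀, IsUnit (K t) := by
    refine hK.eventually (f := K) (p := IsUnit) ?_
    rw [hK0]
    exact Units.nhds (R := (E →L[ℝ] E) →L[ℝ] (E →L[ℝ] E)) 1
  have hlim : ContinuousAt
      (fun t => deriv c t - infAct (c t) (Ring.inverse (K t) (R (deriv c t)))) t₀ :=
    hcd.sub (hLc.clm_apply (hKi.clm_apply (continuousAt_const.clm_apply hcd)))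
  have hne : (𝓝[T] t₀).NeBot := mem_closure_iff_nhdsWithin_neBot.1 hT
  have h0 := tendsto_nhds_unique (hlim.tendsto.mono_left (nhdsWithin_le_nhds (s := T)))
    (tendsto_const_nhds.congr' (by
      filter_upwards [self_mem_nhdsWithin, nhdsWithin_le_nhds hKu] with t ht hu
      obtain ⟨-, a, ha⟩ := ht
      have h1 : Ring.inverse (K t) (R (deriv c t)) = a := by
        have h2 : R (deriv c t) = K t a := by rw [ha]; rfl
        rw [h2]
        have h3 := Ring.inverse_mul_cancel (K t) hu
        exact congrArg (fun φ => φ a) h3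
      rw [h1, ha, sub_self]))
  exact ⟨_, sub_eq_zero.1 h0⟩

end Orbits

/-! ### Regular forms have trivial infinitesimal stabilizer. -/

section RegularForms

open Topology Filter

variable {n : ℕ}

theorem eval_substForm (g : Matrix (Fin n) (Fin n) ℝ) (h : MvPolynomial (Fin n) ℝ)
    (w : Fin n → ℝ) : eval w (substForm g h) = eval (g.mulVec w) h := by
  induction h using MvPolynomial.induction_on with
  | C r => simp [substForm]
  | add p q hp hq =>
    have h1 : substForm g (p + q) = substForm g p + substForm g q := map_add _ _ _
    rw [h1, map_add, map_add, hp, hq]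
  | mul_X p i hp =>
    have h1 : substForm g (p * X i) = substForm g p * ∑ j, C (g i j) * X j := by
      simp [substForm]
    rw [h1, map_mul, map_mul, hp]
    simp [Matrix.mulVec, dotProduct]

theorem analyticAt_eval_jet3 (h : MvPolynomial (Fin n) ℝ) (P : MvPolynomial (JetCoord n) ℝ)
    (v : Fin n → ℝ) : AnalyticAt ℝ (fun w => eval (jet3 h w) P) v := by
  have h1 : ∀ i, AnalyticAt ℝ (fun w => jet3 h w i) v := by
    have h2 : ∀ p : MvPolynomial (Fin n) ℝ, AnalyticAt ℝ (fun w => eval w p) v :=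
      fun p => AnalyticOnNhd.eval_mvPolynomial p v (Set.mem_univ v)
    rintro (i | _ | i | ⟨i, j⟩ | ⟨i, j, l⟩)
    · exact (ContinuousLinearMap.proj (R := ℝ) (φ := fun _ : Fin n => ℝ) i).analyticAt v
    all_goals exact h2 _
  simpa [MvPolynomial.aeval_eq_eval] using AnalyticAt.aeval_mvPolynomial h1 P

/-- The derivative in `s` is `infAct f a` evaluated on copies of `exp (s a) w`, which is zero. So
the flow of `a` preserves the polynomial of `f`. -/
theorem diagonal_exp_eq {k : ℕ} (f : (Fin n → ℝ) [×k]→L[ℝ] ℝ)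
    (a : (Fin n → ℝ) →L[ℝ] (Fin n → ℝ)) (ha : infAct f a = 0) (t : ℝ) (w : Fin n → ℝ) :
    f (fun _ => NormedSpace.exp (t • a) w) = f (fun _ => w) := by
  have hd : ∀ s : ℝ, HasDerivAt (fun s : ℝ => f (fun _ => NormedSpace.exp (s • a) w)) 0 s := by
    intro s
    have h1 : HasDerivAt (fun s : ℝ => NormedSpace.exp (s • a) w)
        ((a * NormedSpace.exp (s • a)) w) s := by
      have := (hasDerivAt_exp_smul_const' (𝕂 := ℝ) a s).clm_apply (hasDerivAt_const s w)
      simpa using this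
    have h2 : HasDerivAt (fun s : ℝ => (fun _ : Fin k => NormedSpace.exp (s • a) w))
        (fun _ => (a * NormedSpace.exp (s • a)) w) s := hasDerivAt_pi.2 fun _ => h1
    have h3 := (f.hasFDerivAt (fun _ : Fin k => NormedSpace.exp (s • a) w)).comp_hasDerivAt s h2
    refine h3.congr_deriv ?_
    rw [ContinuousMultilinearMap.linearDeriv_apply]
    have h4 := congrArg (fun φ => φ (fun _ : Fin k => NormedSpace.exp (s • a) w)) ha
    simp only [infAct_apply] at h4
    exact h4
  have := is_const_of_deriv_eq_zero (fun s => (hd s).differentiableAt) (fun s => (hd s).deriv) t 0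
  simpa using this

/-- The infinitesimal stabilizer of a regular form is trivial. -/
theorem infAct_eq_zero_of_isRegularForm {k : ℕ} (hk : 0 < k) (h : MvPolynomial (Fin n) ℝ)
    (hh : IsRegularForm k h) (f : (Fin n → ℝ) [×k]→L[ℝ] ℝ)
    (hf : ∀ w, f (fun _ => w) = eval w h) (a : (Fin n → ℝ) →L[ℝ] (Fin n → ℝ))
    (ha : infAct f a = 0) : a = 0 := by
  obtain ⟨hhom, v, hreg3, P, Q, hinv, hQ, -, hlin⟩ := hh
  -- A form of positive degree vanishes at `0`, whereas `h v ≠ 0`. The invariance identity is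
  -- available only at nonzero points.
  have hv : v ≠ 0 := by
    rintro rfl
    refine hreg3.1 ?_
    have := hf 0
    rw [← this]
    exact f.map_coord_zero (⟨0, hk⟩ : Fin k) rfl
  let γ : ℝ → (Fin n → ℝ) →L[ℝ] (Fin n → ℝ) := fun t => NormedSpace.exp (t • a)
  have hγγ : ∀ t, γ t * γ (-t) = 1 := by
    intro t
    let _ : NormedAlgebra ℚ ((Fin n → ℝ) →L[ℝ] (Fin n → ℝ)) :=
      NormedAlgebra.restrictScalars ℚ ℝ _
    have h1 : Commute (t • a) ((-t) • a) := ((Commute.refl a).smul_left t).smul_right (-t)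
    have h2 := NormedSpace.exp_add_of_commute h1
    rw [← add_smul, add_neg_cancel, zero_smul, NormedSpace.exp_zero] at h2
    exact h2.symm
  have hγγ' : ∀ t, γ (-t) * γ t = 1 := by
    intro t
    have := hγγ (-t)
    rwa [neg_neg] at this
  let g : ℝ → GL (Fin n) ℝ := fun t =>
    { val := LinearMap.toMatrix' (γ t : (Fin n → ℝ) →ₗ[ℝ] (Fin n → ℝ))
      inv := LinearMap.toMatrix' (γ (-t) : (Fin n → ℝ) →ₗ[ℝ] (Fin n → ℝ))
      val_inv := by
        rw [← LinearMap.toMatrix'_mul, ← LinearMap.toMatrix'_one]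
        congr 1
        exact congrArg ContinuousLinearMap.toLinearMap (hγγ t)
      inv_val := by
        rw [← LinearMap.toMatrix'_mul, ← LinearMap.toMatrix'_one]
        congr 1
        exact congrArg ContinuousLinearMap.toLinearMap (hγγ' t) }
  have hg : ∀ t w, (g t).1.mulVec w = γ t w := by
    intro t w
    exact LinearMap.toMatrix'_mulVec _ w
  have hsub : ∀ t, substForm (g t).1 h = h := by
    intro t
    refine MvPolynomial.funext fun w => ?_
    rw [eval_substForm, hg, ← hf, ← hf]
    exact diagonal_exp_eq f a ha t w
  let Rf : Fin n → (Fin n → ℝ) → ℝ := fun i w => eval (jet3 h w) (P i) / eval (jet3 h w) (Q i)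
  have hQev : ∀ i, ∀ᶠ w in 𝓝 v, eval (jet3 h w) (Q i) ≠ 0 := fun i =>
    (analyticAt_eval_jet3 h (Q i) v).continuousAt.eventually_ne (hQ i)
  have hRan : ∀ i w, eval (jet3 h w) (Q i) ≠ 0 → AnalyticAt ℝ (Rf i) w := fun i w hw =>
    (analyticAt_eval_jet3 h (P i) w).div (analyticAt_eval_jet3 h (Q i) w) hw
  -- The flow preserves `h`, so an invariant of 3-jets takes the same value at `γ t w` and at `w`.
  -- Differentiation at `t = 0` gives the claim.
  have hkill : ∀ i w, w ≠ 0 → eval (jet3 h w) (Q i) ≠ 0 → fderiv ℝ (Rf i) w (a w) = 0 := by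
    intro i w hw hQw
    have hγd : HasDerivAt (fun t => γ t w) (a w) 0 := by
      have := (hasDerivAt_exp_smul_const' (𝕂 := ℝ) a 0).clm_apply (hasDerivAt_const 0 w)
      simpa [γ] using this
    have hγ0 : γ 0 w = w := by simp [γ]
    have h1 : HasDerivAt (fun t => Rf i (γ t w)) (fderiv ℝ (Rf i) w (a w)) 0 := by
      have h2 : HasFDerivAt (Rf i) (fderiv ℝ (Rf i) w) (γ 0 w) := by
        rw [hγ0]
        exact (hRan i w hQw).differentiableAt.hasFDerivAt
      exact h2.comp_hasDerivAt 0 hγd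
    have h3 : ∀ᶠ t in 𝓝 (0 : ℝ), eval (jet3 h (γ t w)) (Q i) ≠ 0 := by
      have h4 : ContinuousAt (fun t => eval (jet3 h (γ t w)) (Q i)) 0 := by
        have h40 : ContinuousAt (fun w' => eval (jet3 h w') (Q i)) (γ 0 w) := by
          rw [hγ0]
          exact (analyticAt_eval_jet3 h (Q i) w).continuousAt
        exact ContinuousAt.comp (f := fun t => γ t w) h40 hγd.continuousAt
      refine h4.eventually_ne ?_
      rwa [hγ0]
    have h5 : (fun t => Rf i (γ t w)) =ᶠ[𝓝 0] fun _ => Rf i w := by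
      filter_upwards [h3] with t ht
      have h6 := hinv i h hhom (g t) w hw
      rw [hsub t, hg t w] at h6
      simp only [Rf]
      rw [div_eq_div_iff ht hQw]
      linarith
    exact h1.unique ((hasDerivAt_const 0 (Rf i w)).congr_of_eventuallyEq h5)
  have hlin' : ∀ᶠ w in 𝓝 v, LinearIndependent ℝ (fun i => fderiv ℝ (Rf i) w) := by
    have h1 : ContinuousAt (fun w => (fun i => fderiv ℝ (Rf i) w)) v :=
      continuousAt_pi.2 fun i => (hRan i v (hQ i)).fderiv.continuousAt
    exact h1.eventually (isOpen_setOfPred_linearIndependent.mem_nhds hlin)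
  -- Near `v` the `n` differentials still form a basis of the dual space, and each of them
  -- annihilates `a w`.
  have hzero : ∀ᶠ w in 𝓝 v, a w = 0 := by
    filter_upwards [hlin', Filter.eventually_all.2 hQev, eventually_ne_nhds hv] with w h1 h2 h3
    have h4 : ∀ φ : (Fin n → ℝ) →L[ℝ] ℝ, φ (a w) = 0 := by
      have hb : Fintype.card (Fin n) = Module.finrank ℝ ((Fin n → ℝ) →L[ℝ] ℝ) := by
        rw [← LinearMap.toContinuousLinearMap.finrank_eq]
        simp
      have h5 := h1.span_eq_top_of_card_eq_finrank' hb
      intro φ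
      have h6 : φ ∈ Submodule.span ℝ (Set.range fun i => fderiv ℝ (Rf i) w) := by
        rw [h5]; trivial
      induction h6 using Submodule.span_induction with
      | mem x hx =>
        obtain ⟨i, rfl⟩ := hx
        exact hkill i w h3 (h2 i)
      | zero => rfl
      | add x y _ _ hx hy => simp [hx, hy]
      | smul c x _ hx => simp [hx]
    ext j
    exact h4 (ContinuousLinearMap.proj j)
  ext1 u
  have h1 : Tendsto (fun ε : ℝ => v + ε • u) (𝓝 0) (𝓝 v) := by
    have : Continuous (fun ε : ℝ => v + ε • u) := by fun_prop
    simpa using this.tendsto 0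
  have h2 := (h1.eventually hzero).filter_mono (nhdsWithin_le_nhds (s := {0}ᶜ))
  obtain ⟨ε, hε, hε0⟩ := (h2.and self_mem_nhdsWithin).exists
  have h3 := hzero.self_of_nhds
  rw [map_add, h3, zero_add, map_smul] at hε
  exact (smul_eq_zero.1 hε).resolve_left hε0

end RegularForms

/-! ### Cutoffs, global sections with given germs, and coordinates. -/

section Localization

open Topology Filter

variable {n : ℕ} {M : Type*} [TopologicalSpace M] [ChartedSpace (EuclideanSpace ℝ (Fin n)) M]
  [IsManifold (𝓡 n) ∞ M] [T2Space M]
  {F : Type*} [NormedAddCommGroup F] [NormedSpace ℝ F] {V : M → Type*}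
  [TopologicalSpace (TotalSpace F V)] [∀ x, AddCommGroup (V x)] [∀ x, Module ℝ (V x)]
  [∀ x, TopologicalSpace (V x)] [FiberBundle F V] [VectorBundle ℝ F V]
  [ContMDiffVectorBundle ∞ F V (𝓡 n)]

theorem exists_cutoff (x₀ : M) {U : Set M} (hU : U ∈ 𝓝 x₀) :
    ∃ χ : SFun n M, (∀ᶠ y in 𝓝 x₀, χ y = 1) ∧ tsupport χ ⊆ U := by
  obtain ⟨f, -, hf⟩ := (SmoothBumpFunction.nhds_basis_tsupport (I := 𝓡 n) x₀).mem_iff.1 hU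
  exact ⟨⟨f, f.contMDiff⟩, f.eventuallyEq_one, hf⟩

theorem exists_section_eventuallyEq (s : Π x, V x) (x₀ : M)
    (hs : ∀ᶠ y in 𝓝 x₀, ContMDiffAt (𝓡 n) ((𝓡 n).prod 𝓘(ℝ, F)) ∞
      (fun y => (⟨y, s y⟩ : TotalSpace F V)) y) :
    ∃ S : Cₛ^∞⟮𝓡 n; F, V⟯, ∀ᶠ y in 𝓝 x₀, S y = s y := by
  obtain ⟨U, h, hU, hxU⟩ := eventually_nhds_iff.1 hs
  obtain ⟨χ, hχ, hχU⟩ := exists_cutoff (n := n) x₀ (hU.mem_nhds hxU)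
  refine ⟨⟨(χ : M → ℝ) • s, ContMDiffOn.smul_section_of_tsupport χ.contMDiff.contMDiffOn hU hχU
    fun y hy => (h y hy).contMDiffWithinAt⟩, ?_⟩
  filter_upwards [hχ] with y hy
  change χ y • s y = s y
  rw [hy, one_smul]

theorem exists_sfun_eventuallyEq (f : M → ℝ) (x₀ : M)
    (hf : ∀ᶠ y in 𝓝 x₀, ContMDiffAt (𝓡 n) 𝓘(ℝ, ℝ) ∞ f y) :
    ∃ g : SFun n M, ∀ᶠ y in 𝓝 x₀, g y = f y := by
  obtain ⟨U, h, hU, hxU⟩ := eventually_nhds_iff.1 hf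
  obtain ⟨χ, hχ, hχU⟩ := exists_cutoff (n := n) x₀ (hU.mem_nhds hxU)
  refine ⟨⟨fun y => χ y * f y, contMDiff_of_tsupport fun y hy => ?_⟩, ?_⟩
  · have hy' : y ∈ U := hχU (tsupport_mul_subset_left hy)
    exact χ.contMDiff.contMDiffAt.mul (h y hy')
  · filter_upwards [hχ] with y hy
    change χ y * f y = f y
    rw [hy, one_mul]

theorem exists_section_eventuallyEq_extend {x : M} (v : V x) :
    ∃ S : Cₛ^∞⟮𝓡 n; F, V⟯, ∀ᶠ y in 𝓝 x, S y = extend F v y := by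
  obtain ⟨s, hs, h⟩ := exists_contMDiffOn_extend (k := ∞) (𝓡 n) F v
  refine exists_section_eventuallyEq _ x ?_
  filter_upwards [eventually_mem_nhds_iff.2 hs] with y hy
  exact h.contMDiffAt hy

theorem exists_section_eq {x : M} (v : V x) : ∃ S : Cₛ^∞⟮𝓡 n; F, V⟯, S x = v := by
  obtain ⟨S, hS⟩ := exists_section_eventuallyEq_extend (n := n) (F := F) v
  exact ⟨S, by rw [hS.self_of_nhds, extend_apply_self]⟩

theorem mvfderiv_congr {f g : M → ℝ} {x : M} (h : ∀ᶠ y in 𝓝 x, f y = g y) :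
    mvfderiv (𝓡 n) f x = mvfderiv (𝓡 n) g x := by
  have h1 : mfderiv (𝓡 n) 𝓘(ℝ, ℝ) f x = mfderiv (𝓡 n) 𝓘(ℝ, ℝ) g x := Filter.EventuallyEq.mfderiv_eq h
  ext v
  exact congrArg (fun φ : TangentSpace (𝓡 n) x →L[ℝ] ℝ => φ v) h1

theorem contMDiff_mvfderiv_apply (f : SFun n M) (X : VField n M) :
    ContMDiff (𝓡 n) 𝓘(ℝ, ℝ) ∞ (fun x => mvfderiv (𝓡 n) f x (X x)) := by
  have h1 : ContMDiff (𝓡 n).tangent 𝓘(ℝ, ℝ).tangent ∞ (tangentMap (𝓡 n) 𝓘(ℝ, ℝ) f) :=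
    f.contMDiff.contMDiff_tangentMap (by simp)
  have h2 := h1.comp X.contMDiff
  intro x
  exact ((contMDiffAt_totalSpace.1 (h2 x)).2).congr_of_eventuallyEq (by
    filter_upwards with y
    simp [tangentMap, mvfderiv]
    rfl)

theorem isSmoothForm_mvfderiv (f : SFun n M) : IsSmoothForm (fun x : M => mvfderiv (𝓡 n) f x) :=
  fun X => contMDiff_mvfderiv_apply f X

/-- The derivative of a smooth function along a vector field. -/
def dirDeriv (X : VField n M) (f : SFun n M) : SFun n M :=
  ⟨fun x => mvfderiv (𝓡 n) f x (X x), contMDiff_mvfderiv_apply f X⟩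

/-- Coordinates and dual vector fields near a point. -/
theorem exists_coordinates (x₀ : M) :
    ∃ (z : Fin n → SFun n M) (E : Fin n → VField n M),
      ∀ᶠ y in 𝓝 x₀, ∀ i j, mvfderiv (𝓡 n) (z i) y (E j y) = if i = j then 1 else 0 := by
  have hsrc : (chartAt (Mdl n) x₀).source ∈ 𝓝 x₀ := chart_source_mem_nhds _ _
  have hsrc' : ∀ᶠ y in 𝓝 x₀, y ∈ (chartAt (Mdl n) x₀).source := hsrc
  have hcoord : ∀ i : Fin n, ∃ z : SFun n M, ∀ᶠ y in 𝓝 x₀, z y = (extChartAt (𝓡 n) x₀ y) i := by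
    intro i
    refine exists_sfun_eventuallyEq (n := n) _ x₀ ?_
    filter_upwards [hsrc'] with y hy
    have h1 : ContMDiffAt (𝓡 n) 𝓘(ℝ, Mdl n) ∞ (extChartAt (𝓡 n) x₀) y := contMDiffAt_extChartAt' hy
    exact (EuclideanSpace.proj (𝕜 := ℝ) i).contMDiff.contMDiffAt.comp y h1
  choose z hz using hcoord
  -- The dual fields come from the standard frame in the trivialization at `x₀`, which on tangent
  -- vectors is the derivative of the chart. The pairing with the coordinate differentials is thus
  -- constant near `x₀`, not only at `x₀`.
  let e := trivializationAt (Mdl n) (TangentSpace (𝓡 n) : M → Type _) x₀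
  let b := (EuclideanSpace.basisFun (Fin n) ℝ).toBasis
  have hframe : ∀ j : Fin n, ∃ X : VField n M, ∀ᶠ y in 𝓝 x₀, X y = e.localFrame b j y := by
    intro j
    refine exists_section_eventuallyEq _ x₀ ?_
    filter_upwards [hsrc'] with y hy
    exact contMDiffAt_localFrame_of_mem ∞ e b j hy
  choose E hE using hframe
  refine ⟨z, E, ?_⟩
  filter_upwards [eventually_all.2 fun i => eventually_eventually_nhds.2 (hz i),
    eventually_all.2 hE, hsrc'] with y h1 h2 h3 i j
  rw [mvfderiv_congr (h1 i), h2 j]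
  have h4 : MDifferentiableAt (𝓡 n) 𝓘(ℝ, Mdl n) (extChartAt (𝓡 n) x₀) y :=
    mdifferentiableAt_extChartAt h3
  have h5 : MDifferentiableAt 𝓘(ℝ, Mdl n) 𝓘(ℝ, ℝ) (EuclideanSpace.proj (𝕜 := ℝ) i : Mdl n →L[ℝ] ℝ)
    (extChartAt (𝓡 n) x₀ y) := ContinuousLinearMap.mdifferentiableAt _
  have h6 := mfderiv_comp_apply y h5 h4 (e.localFrame b j y)
  have h3' : y ∈ e.baseSet := h3
  have h7a : e.continuousLinearMapAt ℝ y (e.localFrame b j y) = b j := by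
    rw [e.localFrame_apply_of_mem_baseSet b h3', Trivialization.basisAt, Module.Basis.map_apply,
      Trivialization.continuousLinearMapAt_apply, e.coe_linearMapAt_of_mem h3']
    exact congrArg Prod.snd (e.apply_mk_symm h3' (b j))
  have h7 : mfderiv (𝓡 n) 𝓘(ℝ, Mdl n) (extChartAt (𝓡 n) x₀) y (e.localFrame b j y) = b j :=
    (congrArg (fun φ : Tan n y →L[ℝ] Mdl n => φ (e.localFrame b j y))
      (TangentBundle.continuousLinearMapAt_trivializationAt h3)).symm.trans h7a
  rw [h7] at h6
  have h8 : mvfderiv (𝓡 n) (fun y => (extChartAt (𝓡 n) x₀ y) i) y (e.localFrame b j y) = b j i := by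
    refine h6.trans ?_
    rw [ContinuousLinearMap.mfderiv_eq]
    rfl
  rw [h8]
  simp [b]

end Localization

/-! ### Smooth dependence of solutions of linear equations. -/

section LinearSystems

open Topology Filter

theorem contDiffAt_det {ι E : Type*} [Fintype ι] [DecidableEq ι] [NormedAddCommGroup E]
    [NormedSpace ℝ E] {A : E → Matrix ι ι ℝ} {x : E} (hA : ∀ i j, ContDiffAt ℝ ∞ (fun y => A y i j) x) :
    ContDiffAt ℝ ∞ (fun y => (A y).det) x := by
  simp only [Matrix.det_apply']
  exact ContDiffAt.sum fun σ _ => contDiffAt_const.mul (contDiffAt_prod fun i _ => hA _ _)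

variable {n : ℕ} {M : Type*} [TopologicalSpace M] [ChartedSpace (EuclideanSpace ℝ (Fin n)) M]

/-- The solution of an injective smooth system of linear equations is smooth. -/
theorem contMDiffAt_of_linear_system {ι κ : Type*} [Fintype ι] [Fintype κ]
    (B : ι → κ → M → ℝ) (r : κ → M → ℝ) (a : ι → M → ℝ) {x : M}
    (hB : ∀ i j, ContMDiffAt (𝓡 n) 𝓘(ℝ, ℝ) ∞ (B i j) x)
    (hr : ∀ j, ContMDiffAt (𝓡 n) 𝓘(ℝ, ℝ) ∞ (r j) x)
    (hinj : ∀ c : ι → ℝ, (∀ j, ∑ i, c i * B i j x = 0) → c = 0)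
    (h : ∀ᶠ y in 𝓝 x, ∀ j, ∑ i, a i y * B i j y = r j y) (i : ι) :
    ContMDiffAt (𝓡 n) 𝓘(ℝ, ℝ) ∞ (a i) x := by
  classical
  -- The system may be overdetermined, so it is replaced by its normal equations. The Gram matrix is
  -- invertible at `x` exactly because the system is injective there, and Cramer's rule gives smooth
  -- solutions.
  let G : M → Matrix ι ι ℝ := fun y => Matrix.of fun i i' => ∑ j, B i j y * B i' j y
  let s : M → ι → ℝ := fun y i => ∑ j, r j y * B i j y
  have hG : ∀ i i', ContMDiffAt (𝓡 n) 𝓘(ℝ, ℝ) ∞ (fun y => G y i i') x := fun i i' =>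
    contMDiffAt_finsetSum fun j _ => (hB i j).mul (hB i' j)
  have hs : ∀ i, ContMDiffAt (𝓡 n) 𝓘(ℝ, ℝ) ∞ (fun y => s y i) x := fun i =>
    contMDiffAt_finsetSum fun j _ => (hr j).mul (hB i j)
  have hdet : (G x).det ≠ 0 := by
    intro h0
    obtain ⟨c, hc, hc0⟩ := Matrix.exists_mulVec_eq_zero_iff.2 h0
    refine hc (hinj c ?_)
    have h1 : ∑ j, (∑ i, c i * B i j x) * (∑ i, c i * B i j x) = 0 := by
      have h2 : c ⬝ᵥ (G x).mulVec c = 0 := by rw [hc0, dotProduct_zero]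
      rw [← h2]
      simp only [dotProduct, Matrix.mulVec, G, Matrix.of_apply, Finset.sum_mul, Finset.mul_sum]
      rw [Finset.sum_comm]
      refine Finset.sum_congr rfl fun i _ => ?_
      rw [Finset.sum_comm]
      refine Finset.sum_congr rfl fun i' _ => Finset.sum_congr rfl fun j _ => by ring
    intro j
    have h3 := (Finset.sum_eq_zero_iff_of_nonneg fun j _ => mul_self_nonneg _).1 h1 j (Finset.mem_univ j)
    exact mul_self_eq_zero.1 h3
  have hsol : ∀ᶠ y in 𝓝 x, (G y).mulVec (fun i => a i y) = s y := by
    filter_upwards [h] with y hy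
    funext i
    simp only [Matrix.mulVec, dotProduct, G, Matrix.of_apply, s, ← hy, Finset.sum_mul]
    rw [Finset.sum_comm]
    refine Finset.sum_congr rfl fun j _ => Finset.sum_congr rfl fun i' _ => by ring
  have hdc : ∀ A : M → Matrix ι ι ℝ, (∀ i i', ContMDiffAt (𝓡 n) 𝓘(ℝ, ℝ) ∞ (fun y => A y i i') x) →
      ContMDiffAt (𝓡 n) 𝓘(ℝ, ℝ) ∞ (fun y => (A y).det) x := by
    intro A hA
    have h1 : ContMDiffAt (𝓡 n) 𝓘(ℝ, ι × ι → ℝ) ∞ (fun y (p : ι × ι) => A y p.1 p.2) x :=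
      contMDiffAt_pi_space.2 fun p => hA p.1 p.2
    have h2 : ContDiffAt ℝ ∞ (fun p : ι × ι → ℝ => (Matrix.of fun i i' => p (i, i')).det)
        (fun p : ι × ι => A x p.1 p.2) := by
      refine contDiffAt_det fun i j => ?_
      exact (contDiff_apply ℝ ℝ (i, j)).contDiffAt
    exact h2.contMDiffAt.comp (f := fun y (p : ι × ι) => A y p.1 p.2) x h1
  have hdet' : ∀ᶠ y in 𝓝 x, (G y).det ≠ 0 := (hdc G hG).continuousAt.eventually_ne hdet
  have hcr : ContMDiffAt (𝓡 n) 𝓘(ℝ, ℝ) ∞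
      (fun y => ((G y).updateCol i (s y)).det * ((G y).det)⁻¹) x := by
    refine (hdc _ fun i' j' => ?_).mul ((hdc G hG).inv₀ hdet)
    by_cases hj : j' = i
    · subst hj
      simpa [Matrix.updateCol_apply] using hs i'
    · simpa [Matrix.updateCol_apply, hj] using hG i' j'
  refine hcr.congr_of_eventuallyEq ?_
  filter_upwards [hsol, hdet'] with y h1 h2
  have h3 := Matrix.cramer_eq_adjugate_mulVec (G y) (s y)
  rw [← h1, Matrix.mulVec_mulVec, Matrix.adjugate_mul, Matrix.smul_mulVec, Matrix.one_mulVec, h1] at h3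
  have h4 := congrFun h3 i
  rw [Matrix.cramer_apply] at h4
  simp only [Pi.smul_apply, smul_eq_mul] at h4
  rw [h4]
  field_simp

end LinearSystems

/-! ### Dual frames and smoothness tested on vector fields. -/

section Frames

open Topology Filter

variable {n : ℕ} {M : Type*} [TopologicalSpace M] [ChartedSpace (EuclideanSpace ℝ (Fin n)) M]

theorem finrank_tan (x : M) : Module.finrank ℝ (Tan n x) = n :=
  finrank_euclideanSpace_fin (𝕜 := ℝ) (n := n)

theorem eq_sum_smul_of_dual {x : M} {θ : Fin n → Cot n x} {e : Fin n → Tan n x}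
    (h : ∀ i j, θ i (e j) = if i = j then 1 else 0) (v : Tan n x) : v = ∑ i, θ i v • e i := by
  have hli : LinearIndependent ℝ e := by
    rw [Fintype.linearIndependent_iff]
    intro c hc i
    have := congrArg (θ i) hc
    simpa [h] using this
  have hsp : ⊤ ≤ Submodule.span ℝ (Set.range e) :=
    (hli.span_eq_top_of_card_eq_finrank' (by rw [finrank_tan, Fintype.card_fin])).ge
  have hv : v ∈ Submodule.span ℝ (Set.range e) := hsp trivial
  obtain ⟨c, rfl⟩ := (Submodule.mem_span_range_iff_exists_fun ℝ).1 hv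
  refine Finset.sum_congr rfl fun i _ => ?_
  congr 1
  simp [h]

theorem cot_eq_sum_smul_of_dual {x : M} {θ : Fin n → Cot n x} {e : Fin n → Tan n x}
    (h : ∀ i j, θ i (e j) = if i = j then 1 else 0) (φ : Cot n x) : φ = ∑ i, φ (e i) • θ i := by
  ext v
  conv_lhs => rw [eq_sum_smul_of_dual h v]
  simp [mul_comm]

theorem tcoord_tbasis (x : M) (i j : Fin n) :
    tcoord x i (tbasis x j) = if i = j then 1 else 0 := by
  change (tbasis x).coord i (tbasis x j) = _
  simp [Finsupp.single_apply, eq_comm]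

/-- The full contraction can be computed in any pair of dual bases. -/
theorem contract_eq_of_dual {x : M} {θ : Fin n → Cot n x} {e : Fin n → Tan n x}
    (h : ∀ i j, θ i (e j) = if i = j then 1 else 0) {j : ℕ} {W : Type*} [AddCommGroup W]
    [Module ℝ W] (σ : Contra n j x) (η : MultilinearMap ℝ (fun _ : Fin j => Tan n x) W) :
    contract σ η = ∑ J : Fin j → Fin n, σ (fun a => θ (J a)) • η (fun a => e (J a)) := by
  have h1 : ∀ I : Fin j → Fin n, σ (fun a => tcoord x (I a)) =
      ∑ J : Fin j → Fin n, (∏ a, tcoord x (I a) (e (J a))) * σ (fun a => θ (J a)) := by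
    intro I
    have : (fun a => tcoord x (I a)) = fun a => ∑ i, tcoord x (I a) (e i) • θ i := by
      funext a; exact cot_eq_sum_smul_of_dual h _
    rw [this, σ.map_sum]
    refine Finset.sum_congr rfl fun J _ => ?_
    rw [σ.map_smul_univ, smul_eq_mul]
  have h2 : ∀ J : Fin j → Fin n, η (fun a => e (J a)) =
      ∑ I : Fin j → Fin n, (∏ a, tcoord x (I a) (e (J a))) • η (fun a => tbasis x (I a)) := by
    intro J
    have : (fun a => e (J a)) = fun a => ∑ i, tcoord x i (e (J a)) • tbasis x i := by
      funext a; exact eq_sum_smul_of_dual (tcoord_tbasis x) _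
    rw [this, η.map_sum]
    refine Finset.sum_congr rfl fun I _ => ?_
    rw [η.map_smul_univ]
  unfold contract
  simp_rw [h1, h2, Finset.sum_smul, Finset.smul_sum]
  rw [Finset.sum_comm]
  refine Finset.sum_congr rfl fun J _ => Finset.sum_congr rfl fun I _ => ?_
  rw [smul_smul, mul_comm]

variable [IsManifold (𝓡 n) ∞ M] [T2Space M]

theorem mdifferentiableAt_mvfderiv_apply (f : SFun n M) {X : Π x : M, Tan n x} {x : M}
    (hX : MDifferentiableAt (𝓡 n) (𝓡 n).tangent (fun y => (⟨y, X y⟩ : TangentBundle (𝓡 n) M)) x) :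
    MDifferentiableAt (𝓡 n) 𝓘(ℝ, ℝ) (fun y => mvfderiv (𝓡 n) f y (X y)) x := by
  have h1 : ContMDiff (𝓡 n).tangent 𝓘(ℝ, ℝ).tangent ∞ (tangentMap (𝓡 n) 𝓘(ℝ, ℝ) f) :=
    f.contMDiff.contMDiff_tangentMap (by simp)
  have h2 := (h1.contMDiffAt.mdifferentiableAt (by simp)).comp x hX
  refine ((mdifferentiableAt_totalSpace _ _ |>.1 h2).2).congr_of_eventuallyEq (by
    filter_upwards with y
    simp [tangentMap, mvfderiv]
    rfl)

theorem contMDiffAt_mvfderiv_apply (f : SFun n M) {X : Π x : M, Tan n x} {x : M}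
    (hX : ContMDiffAt (𝓡 n) (𝓡 n).tangent ∞ (fun y => (⟨y, X y⟩ : TangentBundle (𝓡 n) M)) x) :
    ContMDiffAt (𝓡 n) 𝓘(ℝ, ℝ) ∞ (fun y => mvfderiv (𝓡 n) f y (X y)) x := by
  have h1 : ContMDiff (𝓡 n).tangent 𝓘(ℝ, ℝ).tangent ∞ (tangentMap (𝓡 n) 𝓘(ℝ, ℝ) f) :=
    f.contMDiff.contMDiff_tangentMap (by simp)
  have h2 := h1.contMDiffAt.comp x hX
  exact ((contMDiffAt_totalSpace.1 h2).2).congr_of_eventuallyEq (by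
    filter_upwards with y
    simp [tangentMap, mvfderiv]
    rfl)

/-- A covector is the differential of a smooth function. -/
theorem exists_mvfderiv_eq {x : M} (θ : Cot n x) : ∃ f : SFun n M, mvfderiv (𝓡 n) f x = θ := by
  obtain ⟨z, E, hzE⟩ := exists_coordinates (n := n) x
  refine ⟨∑ i, θ (E i x) • z i, ?_⟩
  have h1 : ∀ f g : SFun n M, mvfderiv (𝓡 n) (f + g : SFun n M) x =
      mvfderiv (𝓡 n) f x + mvfderiv (𝓡 n) g x := fun f g =>
    mvfderiv_add (f.contMDiff.contMDiffAt.mdifferentiableAt (by simp))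
      (g.contMDiff.contMDiffAt.mdifferentiableAt (by simp))
  have h2 : ∀ (c : ℝ) (g : SFun n M), mvfderiv (𝓡 n) (c • g : SFun n M) x =
      c • mvfderiv (𝓡 n) g x := by
    intro c g
    have h3 := mvfderiv_smul (I := 𝓡 n) (x := x) (a := fun _ : M => c) mdifferentiableAt_const
      (g.contMDiff.contMDiffAt.mdifferentiableAt (by simp))
    rw [mvfderiv_const] at h3
    refine (Eq.trans ?_ h3).trans (by simp)
    rfl
  let L : SFun n M →ₗ[ℝ] Cot n x :=
    { toFun := fun f => mvfderiv (𝓡 n) f x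
      map_add' := h1
      map_smul' := h2 }
  change L (∑ i, θ (E i x) • z i) = θ
  rw [map_sum]
  simp_rw [map_smul]
  exact (cot_eq_sum_smul_of_dual hzE.self_of_nhds θ).symm

/-- A smooth family of linear maps on tangent spaces is one with smooth values on vector fields. -/
theorem contMDiffAt_hom_of_apply {F : Type*} [NormedAddCommGroup F] [NormedSpace ℝ F]
    {V : M → Type*} [TopologicalSpace (TotalSpace F V)] [∀ x, AddCommGroup (V x)]
    [∀ x, Module ℝ (V x)] [∀ x, TopologicalSpace (V x)] [∀ x, IsTopologicalAddGroup (V x)]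
    [∀ x, ContinuousSMul ℝ (V x)] [FiberBundle F V] [VectorBundle ℝ F V]
    [ContMDiffVectorBundle ∞ F V (𝓡 n)] (φ : Π y : M, Tan n y →L[ℝ] V y) (x₀ : M)
    (h : ∀ X : VField n M, ContMDiffAt (𝓡 n) ((𝓡 n).prod 𝓘(ℝ, F)) ∞
      (fun y => (⟨y, φ y (X y)⟩ : TotalSpace F V)) x₀) :
    ContMDiffAt (𝓡 n) ((𝓡 n).prod 𝓘(ℝ, Mdl n →L[ℝ] F)) ∞
      (fun y => (⟨y, φ y⟩ : TotalSpace (Mdl n →L[ℝ] F) (fun y => Tan n y →L[ℝ] V y))) x₀ := by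
  rw [contMDiffAt_hom_bundle]
  refine ⟨contMDiffAt_id, ?_⟩
  let e := trivializationAt (Mdl n) (TangentSpace (𝓡 n) : M → Type _) x₀
  let e' := trivializationAt F V x₀
  let b := (EuclideanSpace.basisFun (Fin n) ℝ).toBasis
  have hsrc' : ∀ᶠ y in 𝓝 x₀, y ∈ e.baseSet :=
    e.open_baseSet.mem_nhds (FiberBundle.mem_baseSet_trivializationAt' x₀)
  have hsrc2 : ∀ᶠ y in 𝓝 x₀, y ∈ e'.baseSet :=
    e'.open_baseSet.mem_nhds (FiberBundle.mem_baseSet_trivializationAt' x₀)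
  have hframe : ∀ j : Fin n, ∃ X : VField n M, ∀ᶠ y in 𝓝 x₀, X y = e.localFrame b j y := by
    intro j
    refine exists_section_eventuallyEq _ x₀ ?_
    filter_upwards [hsrc'] with y hy
    exact contMDiffAt_localFrame_of_mem ∞ e b j hy
  choose X hX using hframe
  have h1 : ∀ j, ContMDiffAt (𝓡 n) 𝓘(ℝ, F) ∞ (fun y => (e' ⟨y, φ y (X j y)⟩).2) x₀ := fun j =>
    (contMDiffAt_section x₀).1 (h (X j))
  let L : (j : Fin n) → F →L[ℝ] (Mdl n →L[ℝ] F) := fun j =>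
    ContinuousLinearMap.smulRightL ℝ (Mdl n) F (EuclideanSpace.proj j)
  have h2 : ContMDiffAt (𝓡 n) 𝓘(ℝ, Mdl n →L[ℝ] F) ∞
      (fun y => ∑ j, L j (e' ⟨y, φ y (X j y)⟩).2) x₀ :=
    contMDiffAt_finsetSum fun j _ => (L j).contMDiff.contMDiffAt.comp x₀ (h1 j)
  refine h2.congr_of_eventuallyEq ?_
  filter_upwards [hsrc', hsrc2, eventually_all.2 hX] with y hy hy' hXy
  refine ContinuousLinearMap.ext fun w => ?_
  have hw : w = ∑ j, w j • b j := by
    have := (EuclideanSpace.basisFun (Fin n) ℝ).sum_repr w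
    simpa [b] using this.symm
  conv_lhs => rw [hw, map_sum]
  rw [sum_apply]
  refine Finset.sum_congr rfl fun j _ => ?_
  rw [map_smul]
  change _ = w j • (e' ⟨y, φ y (X j y)⟩).2
  congr 1
  rw [hXy j, e.localFrame_apply_of_mem_baseSet b hy, Trivialization.basisAt, Module.Basis.map_apply,
    ContinuousLinearMap.inCoordinates]
  simp only [ContinuousLinearMap.comp_apply]
  rw [Trivialization.continuousLinearMapAt_apply, e'.coe_linearMapAt_of_mem hy']
  have h3 : e.symmL ℝ y (b j) = (e.linearEquivAt ℝ y hy).symm (b j) := by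
    rw [Trivialization.symmL_apply, Trivialization.linearEquivAt_symm_apply]
    exact hy
  rw [← h3]

end Frames

/-! ### Local generators of a line bundle and coefficients of sections. -/

section LineBundles

open Topology Filter

variable {n : ℕ} {M : Type*} [TopologicalSpace M] [ChartedSpace (EuclideanSpace ℝ (Fin n)) M]
  [IsManifold (𝓡 n) ∞ M] [T2Space M]
  {ξ : M → Type*} [TopologicalSpace (TotalSpace ℝ ξ)]
  [∀ x, AddCommGroup (ξ x)] [∀ x, Module ℝ (ξ x)] [∀ x, TopologicalSpace (ξ x)]
  [FiberBundle ℝ ξ] [VectorBundle ℝ ℝ ξ] [ContMDiffVectorBundle ∞ ℝ ξ (𝓡 n)]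

theorem exists_linear_coeff {x : M} {u : ξ x} (hu : u ≠ 0) :
    ∃ c : ξ x →ₗ[ℝ] ℝ, c u = 1 ∧ ∀ v, c v • u = v := by
  let e := (trivializationAt ℝ ξ x).linearEquivAt ℝ x (FiberBundle.mem_baseSet_trivializationAt' x)
  have h0 : e u ≠ 0 := fun h => hu (e.map_eq_zero_iff.1 h)
  refine ⟨(e u)⁻¹ • (e : ξ x →ₗ[ℝ] ℝ), ?_, fun v => e.injective ?_⟩
  · simp [h0]
  · simp [mul_comm, h0]

theorem exists_section_ne_zero (x₀ : M) :
    ∃ s₀ : Sec n ξ, ∀ᶠ y in 𝓝 x₀, s₀ y ≠ 0 := by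
  let e := trivializationAt ℝ ξ x₀
  let u : ξ x₀ := e.symm x₀ 1
  obtain ⟨S, hS⟩ := exists_section_eventuallyEq_extend (n := n) (F := ℝ) u
  refine ⟨S, ?_⟩
  have hx₀ : x₀ ∈ e.baseSet := FiberBundle.mem_baseSet_trivializationAt' x₀
  have hb : ∀ᶠ y in 𝓝 x₀, y ∈ e.baseSet := e.open_baseSet.mem_nhds hx₀
  filter_upwards [hS, hb] with y hy hy' h0
  rw [hy] at h0
  have h1a := congrArg Prod.snd (e.apply_mk_symm hy' (e ⟨x₀, u⟩).2)
  have h1 : (e ⟨y, extend ℝ u y⟩).2 = (e ⟨x₀, u⟩).2 := h1a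
  have h2 : (e ⟨x₀, u⟩).2 = 1 := congrArg Prod.snd (e.apply_mk_symm hx₀ 1)
  have h3 : (e ⟨y, (0 : ξ y)⟩).2 = 0 := by
    have := (e.linearEquivAt ℝ y hy').map_zero
    exact this
  rw [h0, h3, h2] at h1
  exact zero_ne_one h1

theorem trivialization_smul_snd {x₀ y : M} (hy : y ∈ (trivializationAt ℝ ξ x₀).baseSet) (c : ℝ)
    (v : ξ y) : (trivializationAt ℝ ξ x₀ ⟨y, c • v⟩).2 = c * (trivializationAt ℝ ξ x₀ ⟨y, v⟩).2 :=
  ((trivializationAt ℝ ξ x₀).linearEquivAt ℝ y hy).map_smul c v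

theorem trivialization_snd_ne_zero {x₀ y : M} (hy : y ∈ (trivializationAt ℝ ξ x₀).baseSet)
    {v : ξ y} (hv : v ≠ 0) : (trivializationAt ℝ ξ x₀ ⟨y, v⟩).2 ≠ 0 := fun h =>
  hv (((trivializationAt ℝ ξ x₀).linearEquivAt ℝ y hy).map_eq_zero_iff.1 h)

theorem contMDiffAt_coeff {s t : Π x, ξ x} {f : M → ℝ} {x : M}
    (hs : ContMDiffAt (𝓡 n) ((𝓡 n).prod 𝓘(ℝ, ℝ)) ∞ (fun y => (⟨y, s y⟩ : TotalSpace ℝ ξ)) x)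
    (ht : ContMDiffAt (𝓡 n) ((𝓡 n).prod 𝓘(ℝ, ℝ)) ∞ (fun y => (⟨y, t y⟩ : TotalSpace ℝ ξ)) x)
    (ht0 : ∀ᶠ y in 𝓝 x, t y ≠ 0) (h : ∀ᶠ y in 𝓝 x, s y = f y • t y) :
    ContMDiffAt (𝓡 n) 𝓘(ℝ, ℝ) ∞ f x := by
  let e := trivializationAt ℝ ξ x
  have hx : x ∈ e.baseSet := FiberBundle.mem_baseSet_trivializationAt' x
  have hb : ∀ᶠ y in 𝓝 x, y ∈ e.baseSet := e.open_baseSet.mem_nhds hx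
  have h1 := (contMDiffAt_section x).1 hs
  have h2 := (contMDiffAt_section x).1 ht
  have h3 := h1.mul (h2.inv₀ (trivialization_snd_ne_zero hx ht0.self_of_nhds))
  refine h3.congr_of_eventuallyEq ?_
  filter_upwards [hb, ht0, h] with y hy hy0 hy1
  simp only [Pi.mul_apply, hy1]
  rw [trivialization_smul_snd hy]
  have := trivialization_snd_ne_zero hy hy0
  field_simp

theorem mdifferentiableAt_coeff {s t : Π x, ξ x} {f : M → ℝ} {x : M}
    (hs : MDifferentiableAt (𝓡 n) ((𝓡 n).prod 𝓘(ℝ, ℝ)) (fun y => (⟨y, s y⟩ : TotalSpace ℝ ξ)) x)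
    (ht : ContMDiffAt (𝓡 n) ((𝓡 n).prod 𝓘(ℝ, ℝ)) ∞ (fun y => (⟨y, t y⟩ : TotalSpace ℝ ξ)) x)
    (ht0 : ∀ᶠ y in 𝓝 x, t y ≠ 0) (h : ∀ᶠ y in 𝓝 x, s y = f y • t y) :
    MDifferentiableAt (𝓡 n) 𝓘(ℝ, ℝ) f x := by
  let e := trivializationAt ℝ ξ x
  have hx : x ∈ e.baseSet := FiberBundle.mem_baseSet_trivializationAt' x
  have hb : ∀ᶠ y in 𝓝 x, y ∈ e.baseSet := e.open_baseSet.mem_nhds hx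
  have h1 := (mdifferentiableAt_section _ s).1 hs
  have h2 := (contMDiffAt_section x).1 ht
  have h3 := h1.mul ((h2.inv₀ (trivialization_snd_ne_zero hx ht0.self_of_nhds)).mdifferentiableAt
    (by simp))
  refine h3.congr_of_eventuallyEq ?_
  filter_upwards [hb, ht0, h] with y hy hy0 hy1
  simp only [Pi.mul_apply, hy1]
  rw [trivialization_smul_snd hy]
  have := trivialization_snd_ne_zero hy hy0
  field_simp

end LineBundles

/-! ### Ideals of functions vanishing at a point. -/

section Symbols

open Topology Filter

variable {n : ℕ} {M : Type*} [TopologicalSpace M] [ChartedSpace (EuclideanSpace ℝ (Fin n)) M]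
  [IsManifold (𝓡 n) ∞ M] [T2Space M]

/-- The ideal of smooth functions vanishing at a point. -/
def vanishingIdeal (n : ℕ) {M : Type*} [TopologicalSpace M]
    [ChartedSpace (EuclideanSpace ℝ (Fin n)) M] (x : M) : Ideal (SFun n M) where
  carrier := {f | f x = 0}
  add_mem' := by
    intro f g hf hg
    change f x + g x = 0
    rw [show f x = 0 from hf, show g x = 0 from hg, add_zero]
  zero_mem' := rfl
  smul_mem' := by
    intro c f hf
    change c x * f x = 0
    rw [show f x = 0 from hf, mul_zero]

theorem mem_vanishingIdeal {x : M} {f : SFun n M} : f ∈ vanishingIdeal n x ↔ f x = 0 := Iff.rfl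

/-- The function minus its value at a point. -/
def centered (f : SFun n M) (x : M) : SFun n M := f - algebraMap ℝ (SFun n M) (f x)

theorem centered_apply (f : SFun n M) (x y : M) : centered f x y = f y - f x := rfl

theorem centered_mem (f : SFun n M) (x : M) : centered f x ∈ vanishingIdeal n x :=
  sub_self (f x)

theorem sfun_mdifferentiableAt (f : SFun n M) (x : M) :
    MDifferentiableAt (𝓡 n) 𝓘(ℝ, ℝ) f x := f.contMDiff.contMDiffAt.mdifferentiableAt (by simp)

theorem mvfderiv_sfun_add (f g : SFun n M) (x : M) :
    mvfderiv (𝓡 n) (f + g : SFun n M) x = mvfderiv (𝓡 n) f x + mvfderiv (𝓡 n) g x :=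
  mvfderiv_add (sfun_mdifferentiableAt f x) (sfun_mdifferentiableAt g x)

theorem mvfderiv_sfun_sub (f g : SFun n M) (x : M) :
    mvfderiv (𝓡 n) (f - g : SFun n M) x = mvfderiv (𝓡 n) f x - mvfderiv (𝓡 n) g x :=
  mvfderiv_sub (sfun_mdifferentiableAt f x) (sfun_mdifferentiableAt g x)

theorem mvfderiv_sfun_smul (c : ℝ) (g : SFun n M) (x : M) :
    mvfderiv (𝓡 n) (c • g : SFun n M) x = c • mvfderiv (𝓡 n) g x := by
  have h3 := mvfderiv_smul (I := 𝓡 n) (x := x) (a := fun _ : M => c) mdifferentiableAt_const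
    (sfun_mdifferentiableAt g x)
  rw [mvfderiv_const] at h3
  refine (Eq.trans ?_ h3).trans (by simp)
  rfl

/-- The differential at a point as a linear map on smooth functions. -/
def mvfderivₗ (x : M) : SFun n M →ₗ[ℝ] Cot n x where
  toFun f := mvfderiv (𝓡 n) f x
  map_add' f g := mvfderiv_sfun_add f g x
  map_smul' c f := mvfderiv_sfun_smul c f x

theorem mvfderiv_centered (f : SFun n M) (x y : M) :
    mvfderiv (𝓡 n) (centered f x) y = mvfderiv (𝓡 n) f y := by
  rw [centered, mvfderiv_sfun_sub]
  have : mvfderiv (𝓡 n) (algebraMap ℝ (SFun n M) (f x)) y = 0 := mvfderiv_const (I := 𝓡 n) (f x)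
  rw [this, sub_zero]

/-- A function vanishing near a point lies in the square of the vanishing ideal. -/
theorem mem_sq_of_eventually_eq_zero {x : M} {f : SFun n M} (h : ∀ᶠ y in 𝓝 x, f y = 0) :
    f ∈ (vanishingIdeal n x) ^ 2 := by
  obtain ⟨χ, hχ, hχU⟩ := exists_cutoff (n := n) x h
  have h1 : f = f * (1 - χ) := by
    ext y
    change f y = f y * (1 - χ y)
    by_cases hy : y ∈ tsupport χ
    · rw [show f y = 0 from hχU hy, zero_mul]
    · rw [image_eq_zero_of_notMem_tsupport hy, sub_zero, mul_one]
  rw [h1, sq]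
  refine Ideal.mul_mem_mul h.self_of_nhds ?_
  change 1 - χ x = 0
  rw [hχ.self_of_nhds, sub_self]

/-- Hadamard's lemma on a manifold. -/
theorem mem_sq_of_mvfderiv_eq_zero {x : M} {f : SFun n M} (h0 : f x = 0)
    (h1 : mvfderiv (𝓡 n) f x = 0) : f ∈ (vanishingIdeal n x) ^ 2 := by
  let φ := extChartAt (𝓡 n) x
  let z₀ : Mdl n := φ x
  have hsrc : ∀ᶠ y in 𝓝 x, y ∈ φ.source := extChartAt_source_mem_nhds x
  have hφt : φ.target ∈ 𝓝 z₀ := extChartAt_target_mem_nhds x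
  have hloc : ∀ z ∈ φ.target, ContDiffAt ℝ ∞ (fun z => f (φ.symm z)) z := by
    intro z hz
    have h2 : ContMDiffAt 𝓘(ℝ, Mdl n) (𝓡 n) ∞ φ.symm z :=
      (contMDiffOn_extChartAt_symm x).contMDiffAt ((isOpen_extChartAt_target x).mem_nhds hz)
    exact contMDiffAt_iff_contDiffAt.1 (f.contMDiff.contMDiffAt.comp z h2)
  obtain ⟨R, hR, hball⟩ := Metric.nhds_basis_closedBall.mem_iff.1 hφt
  -- The local representative of `f` is cut off inside the chart, since Hadamard's lemma above is
  -- for functions on the whole vector space.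
  let ρ : ContDiffBump z₀ := ⟨R / 2, R, by linarith, by linarith⟩
  have hρt : tsupport ρ ⊆ φ.target := by
    rw [ρ.tsupport_eq]
    exact hball
  have hF0 : ContDiff ℝ ∞ (fun z => ρ z * f (φ.symm z)) := by
    refine contDiff_iff_contDiffAt.2 fun z => ?_
    by_cases hz : z ∈ φ.target
    · exact ρ.contDiff.contDiffAt.mul (hloc z hz)
    · have h3 : (fun z => ρ z * f (φ.symm z)) =ᶠ[𝓝 z] fun _ => 0 := by
        have h4 : z ∉ tsupport ρ := fun h => hz (hρt h)
        filter_upwards [notMem_tsupport_iff_eventuallyEq.1 h4] with w hw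
        simp [hw]
      exact contDiffAt_const.congr_of_eventuallyEq h3
  let F : Mdl n → ℝ := fun w => ρ (z₀ + w) * f (φ.symm (z₀ + w))
  have hF : ContDiff ℝ ∞ F := hF0.comp (contDiff_const.add contDiff_id)
  obtain ⟨G, hG, hG0, hGF⟩ := exists_contDiff_eq_add_clm F hF
  have hsymm : ∀ y ∈ φ.source, φ.symm (z₀ + (φ y - z₀)) = y := by
    intro y hy
    rw [add_sub_cancel]
    exact φ.left_inv hy
  have hF00 : F 0 = 0 := by
    have := hsymm x (mem_extChartAt_source x)
    rw [sub_self] at this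
    change ρ (z₀ + 0) * f (φ.symm (z₀ + 0)) = 0
    rw [this, h0, mul_zero]
  -- This is where the vanishing differential enters: the Hadamard coefficients `W i` also vanish at
  -- `x`, so each product `U i * W i` lies in the square of the ideal.
  have hG00 : G 0 = 0 := by
    rw [hG0]
    have h2 : fderiv ℝ (fun z => f (φ.symm z)) z₀ = 0 := by
      have h3 := (sfun_mdifferentiableAt f x).mvfderiv
      rw [ModelWithCorners.range_eq_univ, fderivWithin_univ] at h3
      exact h3.symm.trans h1
    have h4 : (fun z => ρ z * f (φ.symm z)) =ᶠ[𝓝 z₀] fun z => f (φ.symm z) := by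
      filter_upwards [ρ.eventuallyEq_one] with z hz
      rw [hz, Pi.one_apply, one_mul]
    have h5 := h4.fderiv_eq (𝕜 := ℝ)
    rw [h2] at h5
    have h6 := fderiv_comp_add_left (𝕜 := ℝ) (f := fun z => ρ z * f (φ.symm z)) (x := 0) z₀
    rw [add_zero, h5] at h6
    exact h6
  have hφs : ∀ y ∈ φ.source, ContMDiffAt (𝓡 n) 𝓘(ℝ, Mdl n) ∞ (fun y => φ y - z₀) y := fun y hy =>
    (contMDiffAt_extChartAt' (by rwa [extChartAt_source] at hy)).sub contMDiffAt_const
  have hU : ∀ i : Fin n, ∃ U : SFun n M, ∀ᶠ y in 𝓝 x, U y = (φ y - z₀) i := by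
    intro i
    refine exists_sfun_eventuallyEq (n := n) _ x ?_
    filter_upwards [hsrc] with y hy
    exact (EuclideanSpace.proj (𝕜 := ℝ) i).contMDiff.contMDiffAt.comp y (hφs y hy)
  have hW : ∀ i : Fin n, ∃ W : SFun n M, ∀ᶠ y in 𝓝 x,
      W y = G (φ y - z₀) (EuclideanSpace.single i 1) := by
    intro i
    refine exists_sfun_eventuallyEq (n := n) _ x ?_
    filter_upwards [hsrc] with y hy
    have h2 : ContDiff ℝ ∞ (fun w => G w (EuclideanSpace.single i 1)) :=
      hG.clm_apply contDiff_const
    exact h2.contMDiff.contMDiffAt.comp y (hφs y hy)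
  choose U hU using hU
  choose W hW using hW
  have hUx : ∀ i, U i ∈ vanishingIdeal n x := by
    intro i
    have := (hU i).self_of_nhds
    rw [mem_vanishingIdeal, this]
    change (z₀ - z₀) i = 0
    simp
  have hWx : ∀ i, W i ∈ vanishingIdeal n x := by
    intro i
    have := (hW i).self_of_nhds
    rw [mem_vanishingIdeal, this]
    change G (z₀ - z₀) _ = 0
    rw [sub_self, hG00]
    rfl
  -- The decomposition holds only near `x`; the remainder vanishes near `x` and so lies in the
  -- square of the ideal as well.
  have h7 : f - ∑ i, U i * W i ∈ (vanishingIdeal n x) ^ 2 := by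
    refine mem_sq_of_eventually_eq_zero ?_
    have h8 : ∀ᶠ y in 𝓝 x, ρ (φ y) = 1 :=
      (continuousAt_extChartAt x).eventually (ρ.eventuallyEq_one)
    filter_upwards [hsrc, h8, eventually_all.2 hU, eventually_all.2 hW] with y hy hy1 hy2 hy3
    have h9 : (∑ i, U i * W i : SFun n M) y = ∑ i, U i y * W i y := by
      have := map_sum (ContMDiffMap.evalRingHom y : SFun n M →+* ℝ) (fun i => U i * W i) Finset.univ
      exact this
    change f y - (∑ i, U i * W i : SFun n M) y = 0
    rw [h9]
    have h10 := hGF (φ y - z₀)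
    have h11 : F (φ y - z₀) = f y := by
      change ρ (z₀ + (φ y - z₀)) * f (φ.symm (z₀ + (φ y - z₀))) = f y
      rw [hsymm y hy, add_sub_cancel, hy1, one_mul]
    rw [h11, hF00, zero_add] at h10
    have h12 : ∀ (w : Mdl n) (L : Mdl n →L[ℝ] ℝ), L w = ∑ i, w i * L (EuclideanSpace.single i 1) := by
      intro w L
      have := (EuclideanSpace.basisFun (Fin n) ℝ).sum_repr w
      conv_lhs => rw [← this, map_sum]
      simp
    rw [h10, h12, sub_eq_zero]
    exact Finset.sum_congr rfl fun i _ => by rw [hy2 i, hy3 i]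
  have h14 : f = (f - ∑ i, U i * W i) + ∑ i, U i * W i := by ring
  rw [h14]
  refine Ideal.add_mem _ h7 (Ideal.sum_mem _ fun i _ => ?_)
  rw [sq]
  exact Ideal.mul_mem_mul (hUx i) (hWx i)

end Symbols

/-! ### Existence and uniqueness of symbols. -/

section Symbols

open Topology Filter

variable {n : ℕ} {M : Type*} [TopologicalSpace M] [ChartedSpace (EuclideanSpace ℝ (Fin n)) M]
  [IsManifold (𝓡 n) ∞ M] [T2Space M]
  {ξ : M → Type*} [TopologicalSpace (TotalSpace ℝ ξ)]
  [∀ x, AddCommGroup (ξ x)] [∀ x, Module ℝ (ξ x)] [∀ x, TopologicalSpace (ξ x)]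
  [FiberBundle ℝ ξ] [VectorBundle ℝ ℝ ξ] [ContMDiffVectorBundle ∞ ℝ ξ (𝓡 n)]

theorem mulOp_one (s : Sec n ξ) : mulOp (1 : SFun n M) s = s := by
  ext y; exact one_smul ℝ (s y)

theorem mulOp_mul (f g : SFun n M) (s : Sec n ξ) : mulOp (f * g) s = mulOp f (mulOp g s) := by
  ext y; exact mul_smul (f y) (g y) (s y)

theorem mulOp_add (f g : SFun n M) (s : Sec n ξ) : mulOp (f + g) s = mulOp f s + mulOp g s := by
  ext y; exact add_smul (f y) (g y) (s y)

theorem mulOp_smul (c : ℝ) (f : SFun n M) (s : Sec n ξ) : mulOp (c • f) s = c • mulOp f s := by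
  ext y; exact mul_smul c (f y) (s y)

/-- Multiplication of a fixed section by functions. -/
def mulOpₗ (s : Sec n ξ) : SFun n M →ₗ[ℝ] Sec n ξ where
  toFun f := mulOp f s
  map_add' f g := mulOp_add f g s
  map_smul' c f := mulOp_smul c f s

theorem mulOp_centered (f : SFun n M) (x : M) (s : Sec n ξ) :
    mulOp (centered f x) s = mulOp f s - f x • s := by
  ext y; exact sub_smul (f y) (f x) (s y)

/-- At the point `x`, commuting with `f` amounts to precomposing with multiplication by `f - f x`.
Only the linear functional `s ↦ B s x` matters, so `B` need not have smooth values. -/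
theorem iterComm_eq_apply_mulOp {k : ℕ} {x : M} (B : Sec n ξ → Π x, ξ x) (β : Sec n ξ →ₗ[ℝ] ξ x)
    (hβ : ∀ s, B s x = β s) (f : Fin k → SFun n M) (s : Sec n ξ) :
    iterComm B f s x = β (mulOp (∏ i, centered (f i) x) s) := by
  induction k generalizing B β with
  | zero => simp [iterComm, hβ, mulOp_one]
  | succ k ih =>
    rw [iterComm]
    rw [ih _ (β ∘ₗ mulOp (centered (f 0) x)) (fun s => ?_)]
    · rw [Fin.prod_univ_succ, mulOp_mul]
      rfl
    · rw [LinearMap.comp_apply, mulOp_centered, map_sub, map_smul, hβ, hβ]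

theorem iterComm_sub {k : ℕ} (B B' : Sec n ξ → Π x, ξ x) (f : Fin k → SFun n M) (s : Sec n ξ)
    (x : M) : iterComm (fun s x => B s x - B' s x) f s x = iterComm B f s x - iterComm B' f s x := by
  induction k generalizing B B' with
  | zero => rfl
  | succ k ih =>
    simp only [iterComm]
    rw [← ih]
    congr 1
    funext s x
    rw [smul_sub]
    abel

theorem iterComm_smul {k : ℕ} (g : M → ℝ) (B : Sec n ξ → Π x, ξ x) (f : Fin k → SFun n M)
    (s : Sec n ξ) (x : M) : iterComm (fun s x => g x • B s x) f s x = g x • iterComm B f s x := by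
  induction k generalizing B with
  | zero => rfl
  | succ k ih =>
    simp only [iterComm]
    rw [← ih]
    congr 1
    funext s x
    rw [smul_sub, smul_comm]

/-- Powers of the ideal are spanned by products. The induction absorbs one factor at a time into
`β`. -/
theorem apply_mulOp_eq_zero_of_mem_pow {W : Type*} [AddCommGroup W] [Module ℝ W] {k : ℕ} {x : M}
    (β : Sec n ξ →ₗ[ℝ] W)
    (h : ∀ f : Fin k → SFun n M, (∀ i, f i ∈ vanishingIdeal n x) → ∀ s, β (mulOp (∏ i, f i) s) = 0)
    {g : SFun n M} (hg : g ∈ vanishingIdeal n x ^ k) (s : Sec n ξ) : β (mulOp g s) = 0 := by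
  induction k generalizing β g s with
  | zero =>
    have := h Fin.elim0 (fun i => i.elim0) (mulOp g s)
    simpa [mulOp_one] using this
  | succ k ih =>
    rw [pow_succ'] at hg
    induction hg using Submodule.mul_induction_on' with
    | mem_mul_mem a ha b hb =>
      rw [mulOp_mul]
      refine ih (β ∘ₗ mulOp a) (fun f hf s => ?_) hb s
      have := h (Fin.cons a f) (fun i => by refine Fin.cases ha hf i) s
      rwa [Fin.prod_univ_succ, mulOp_mul] at this
    | add a _ b _ ha hb => rw [mulOp_add, map_add, ha, hb, add_zero]

theorem prod_sub_prod_mem {R : Type*} [CommRing R] (I : Ideal R) {k : ℕ} (f g : Fin k → R)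
    (hf : ∀ i, f i ∈ I) (hg : ∀ i, g i ∈ I) (h : ∀ i, f i - g i ∈ I ^ 2) :
    ∏ i, f i - ∏ i, g i ∈ I ^ (k + 1) := by
  induction k with
  | zero => simp
  | succ k ih =>
    rw [Fin.prod_univ_succ, Fin.prod_univ_succ]
    have h1 : ∏ i : Fin k, f i.succ ∈ I ^ k := by
      have := Ideal.prod_mem_prod (I := fun _ : Fin k => I) (x := fun i => f i.succ)
        (s := Finset.univ) (fun i _ => hf i.succ)
      simpa using this
    have h2 := ih (fun i => f i.succ) (fun i => g i.succ) (fun i => hf _) (fun i => hg _)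
      (fun i => h _)
    have h3 : f 0 * ∏ i : Fin k, f i.succ - g 0 * ∏ i : Fin k, g i.succ =
        (f 0 - g 0) * ∏ i : Fin k, f i.succ +
          g 0 * (∏ i : Fin k, f i.succ - ∏ i : Fin k, g i.succ) := by ring
    rw [h3]
    refine Ideal.add_mem _ ?_ ?_
    · have := Ideal.mul_mem_mul (h 0) h1
      rwa [← pow_add, show 2 + k = k + 1 + 1 by ring] at this
    · have := Ideal.mul_mem_mul (hg 0) h2
      rwa [← pow_succ'] at this

theorem prod_mem_pow {R : Type*} [CommRing R] (I : Ideal R) {k : ℕ} (f : Fin k → R)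
    (hf : ∀ i, f i ∈ I) : ∏ i, f i ∈ I ^ k := by
  have := Ideal.prod_mem_prod (I := fun _ : Fin k => I) (x := f)
    (s := Finset.univ) (fun i _ => hf i)
  simpa using this

/-- A section vanishing at a point is a combination of sections with coefficients vanishing there. -/
theorem exists_eq_mulOp_of_apply_eq_zero {x : M} (s : Sec n ξ) (hs : s x = 0) :
    ∃ g ∈ vanishingIdeal n x, ∃ h ∈ vanishingIdeal n x, ∃ t : Sec n ξ,
      s = mulOp g t + mulOp h s := by
  obtain ⟨s₀, hs₀⟩ := exists_section_ne_zero (n := n) (ξ := ξ) x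
  have h1 : ∃ f : M → ℝ, ∀ᶠ y in 𝓝 x, s y = f y • s₀ y := by
    have h2 : ∀ y, ∃ c : ℝ, s₀ y ≠ 0 → s y = c • s₀ y := by
      intro y
      by_cases hy : s₀ y = 0
      · exact ⟨0, fun h => absurd hy h⟩
      · obtain ⟨c, -, hc⟩ := exists_linear_coeff hy
        exact ⟨c (s y), fun _ => (hc _).symm⟩
    choose f hf using h2
    exact ⟨f, hs₀.mono fun y hy => hf y hy⟩
  obtain ⟨f, hf⟩ := h1
  obtain ⟨g, hg⟩ := exists_sfun_eventuallyEq (n := n) f x (by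
    filter_upwards [eventually_eventually_nhds.2 hs₀, eventually_eventually_nhds.2 hf] with y h2 h3
    exact contMDiffAt_coeff s.contMDiff.contMDiffAt s₀.contMDiff.contMDiffAt h2 h3)
  have hgs : ∀ᶠ y in 𝓝 x, s y = g y • s₀ y := by
    filter_upwards [hf, hg] with y h2 h3
    rw [h2, h3]
  obtain ⟨χ, hχ, hχU⟩ := exists_cutoff (n := n) x hgs
  -- The equality `s = g s₀` holds only near `x`. On the support of `χ` it gives `s = (g χ) s₀ + (1
  -- - χ) s`; off the support this identity is trivial, and both coefficients vanish at `x`.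
  refine ⟨g * χ, ?_, 1 - χ, ?_, s₀, ?_⟩
  · refine Ideal.mul_mem_right _ _ ?_
    have := hgs.self_of_nhds
    rw [hs] at this
    exact (smul_eq_zero.1 this.symm).resolve_right hs₀.self_of_nhds
  · change 1 - χ x = 0
    rw [hχ.self_of_nhds, sub_self]
  · ext y
    change s y = (g y * χ y) • s₀ y + (1 - χ y) • s y
    by_cases hy : y ∈ tsupport χ
    · have h2 : s y = g y • s₀ y := hχU hy
      rw [mul_comm, mul_smul, ← h2]
      module
    · rw [image_eq_zero_of_notMem_tsupport hy]
      simp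

/-- Vanishing of the `(k + 1)`-fold commutators means that `β` kills multiples of `I ^ (k + 1)`,
where `I` is the ideal of `x`. By Hadamard's lemma a product of `k` centered functions depends
modulo `I ^ (k + 1)` only on their differentials, and the section enters only through its value at
`x`. The symbol is then read off from a linear lift `ℓ` of covectors to functions in `I` and a
section `s₀` that does not vanish at `x`. -/
theorem exists_isSymbolAt {k : ℕ} {x : M} (B : Sec n ξ → Π x, ξ x) (β : Sec n ξ →ₗ[ℝ] ξ x)
    (hβ : ∀ s, B s x = β s)
    (hB : ∀ (f : Fin (k + 1) → SFun n M) (s : Sec n ξ), iterComm B f s x = 0) :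
    ∃ τ, IsSymbolAt B k x τ := by
  have hkill : ∀ g ∈ vanishingIdeal n x ^ (k + 1), ∀ s, β (mulOp g s) = 0 := by
    intro g hg s
    refine apply_mulOp_eq_zero_of_mem_pow β (fun f hf s => ?_) hg s
    have h1 := hB f s
    rw [iterComm_eq_apply_mulOp B β hβ] at h1
    have h2 : ∀ i, centered (f i) x = f i := by
      intro i
      ext y
      rw [centered_apply, show f i x = 0 from hf i, sub_zero]
    simpa only [h2] using h1
  obtain ⟨z, E, hzE⟩ := exists_coordinates (n := n) x
  have hdual := hzE.self_of_nhds
  let ℓ : Cot n x →ₗ[ℝ] SFun n M :=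
    { toFun := fun θ => ∑ i, θ (E i x) • centered (z i) x
      map_add' := by
        intro θ θ'
        simp only [add_apply, add_smul, Finset.sum_add_distrib]
      map_smul' := by
        intro c θ
        simp only [smul_apply, smul_assoc, RingHom.id_apply, Finset.smul_sum] }
  have hℓI : ∀ θ, ℓ θ ∈ vanishingIdeal n x := by
    intro θ
    change (∑ i, θ (E i x) • centered (z i) x : SFun n M) ∈ vanishingIdeal n x
    refine Ideal.sum_mem _ fun i _ => ?_
    rw [mem_vanishingIdeal]
    change θ (E i x) * (centered (z i) x x) = 0
    rw [centered_apply, sub_self, mul_zero]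
  have hℓd : ∀ θ, mvfderiv (𝓡 n) (ℓ θ) x = θ := by
    intro θ
    change mvfderivₗ x (∑ i, θ (E i x) • centered (z i) x) = θ
    rw [map_sum]
    simp_rw [map_smul]
    conv_rhs => rw [cot_eq_sum_smul_of_dual hdual θ]
    refine Finset.sum_congr rfl fun i _ => ?_
    congr 1
    exact mvfderiv_centered _ _ _
  obtain ⟨s₀, hs₀⟩ := exists_section_ne_zero (n := n) (ξ := ξ) x
  obtain ⟨c, hc1, hc⟩ := exists_linear_coeff hs₀.self_of_nhds
  let τ : Contra n k x := ((k.factorial : ℝ)⁻¹ • (c ∘ₗ β ∘ₗ mulOpₗ s₀)).compMultilinearMap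
    ((MultilinearMap.mkPiAlgebra ℝ (Fin k) (SFun n M)).compLinearMap fun _ => ℓ)
  have hτ : ∀ v, τ v = (k.factorial : ℝ)⁻¹ * c (β (mulOp (∏ i, ℓ (v i)) s₀)) := by
    intro v
    simp [τ, mulOpₗ]
  refine ⟨τ, ?_, ?_⟩
  · intro e
    ext v
    rw [MultilinearMap.domDomCongr_apply, hτ, hτ]
    congr 5
    exact Equiv.prod_comp e (fun i => ℓ (v i))
  · intro f s
    rw [iterComm_eq_apply_mulOp B β hβ, hτ]
    have hfac : (k.factorial : ℝ) ≠ 0 := by exact_mod_cast k.factorial_ne_zero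
    rw [← mul_assoc, mul_inv_cancel₀ hfac, one_mul]
    have h1 : ∏ i, centered (f i) x - ∏ i, ℓ (mvfderiv (𝓡 n) (f i) x) ∈
        vanishingIdeal n x ^ (k + 1) := by
      refine prod_sub_prod_mem _ _ _ (fun i => centered_mem _ _) (fun i => hℓI _) fun i => ?_
      refine mem_sq_of_mvfderiv_eq_zero ?_ ?_
      · exact (vanishingIdeal n x).sub_mem (centered_mem _ _) (hℓI _)
      · rw [mvfderiv_sfun_sub, hℓd, mvfderiv_centered, sub_self]
    have h2 : ∀ s, β (mulOp (∏ i, centered (f i) x) s) =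
        β (mulOp (∏ i, ℓ (mvfderiv (𝓡 n) (f i) x)) s) := by
      intro s
      have := hkill _ h1 s
      rw [← sub_eq_zero, ← map_sub, ← this]
      congr 1
      ext y
      exact (sub_smul _ _ _).symm
    rw [h2]
    have hP := prod_mem_pow (vanishingIdeal n x) (fun i => ℓ (mvfderiv (𝓡 n) (f i) x))
      (fun i => hℓI _)
    set P : SFun n M := ∏ i, ℓ (mvfderiv (𝓡 n) (f i) x)
    obtain ⟨g, hg, h, hh, t, hst⟩ := exists_eq_mulOp_of_apply_eq_zero (x := x) (s - c (s x) • s₀) (by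
      change s x - c (s x) • s₀ x = 0
      rw [hc, sub_self])
    have h3 : ∀ g ∈ vanishingIdeal n x, ∀ t, β (mulOp P (mulOp g t)) = 0 := by
      intro g hg t
      rw [← mulOp_mul]
      refine hkill _ ?_ t
      rw [pow_succ]
      exact Ideal.mul_mem_mul hP hg
    have h4 : β (mulOp P (s - c (s x) • s₀)) = 0 := by
      rw [hst, map_add, map_add, h3 g hg, h3 h hh, add_zero]
    rw [map_sub, map_sub, sub_eq_zero, map_smul, map_smul] at h4
    rw [h4, ← hc (β (mulOp P s₀)), map_smul, hc1, smul_eq_mul, mul_one]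
    conv_rhs => rw [← hc (s x)]
    rw [smul_smul, smul_smul, mul_comm]

theorem IsSymbolAt.unique {B : Sec n ξ → Π x, ξ x} {k : ℕ} {x : M} {τ τ' : Contra n k x}
    (h : IsSymbolAt B k x τ) (h' : IsSymbolAt B k x τ') : τ = τ' := by
  ext v
  choose f hf using fun i => exists_mvfderiv_eq (n := n) (v i)
  obtain ⟨s₀, hs₀⟩ := exists_section_ne_zero (n := n) (ξ := ξ) x
  have h1 := (h.2 f s₀).symm.trans (h'.2 f s₀)
  simp only [hf] at h1
  have h2 := smul_left_injective ℝ hs₀.self_of_nhds h1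
  have hfac : (k.factorial : ℝ) ≠ 0 := by exact_mod_cast k.factorial_ne_zero
  exact mul_left_cancel₀ hfac h2

theorem smbl_isSymbolAt {B : Sec n ξ → Π x, ξ x} {k : ℕ} {x : M} {τ : Contra n k x}
    (h : IsSymbolAt B k x τ) : IsSymbolAt B k x (smbl B k x) := by
  have h' : ∃ τ, IsSymbolAt B k x τ := ⟨τ, h⟩
  rw [smbl, dif_pos h']
  exact h'.choose_spec

theorem IsSymbolAt.smbl_eq {B : Sec n ξ → Π x, ξ x} {k : ℕ} {x : M} {τ : Contra n k x}
    (h : IsSymbolAt B k x τ) : smbl B k x = τ := (smbl_isSymbolAt h).unique h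

theorem IsSymbolAt.sub {B B' : Sec n ξ → Π x, ξ x} {k : ℕ} {x : M} {τ τ' : Contra n k x}
    (h : IsSymbolAt B k x τ) (h' : IsSymbolAt B' k x τ') :
    IsSymbolAt (fun s x => B s x - B' s x) k x (τ - τ') := by
  refine ⟨Submodule.sub_mem _ h.1 h'.1, fun f s => ?_⟩
  rw [iterComm_sub, h.2, h'.2, ← sub_smul, sub_apply, mul_sub]

theorem IsSymbolAt.smul {B : Sec n ξ → Π x, ξ x} {k : ℕ} {x : M} {τ : Contra n k x}
    (h : IsSymbolAt B k x τ) (g : M → ℝ) :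
    IsSymbolAt (fun s x => g x • B s x) k x (g x • τ) := by
  refine ⟨Submodule.smul_mem _ _ h.1, fun f s => ?_⟩
  rw [iterComm_smul, h.2, smul_smul, smul_apply, smul_eq_mul]
  congr 1
  ring

/-- The value of a smooth operator at a point. -/
def valueAt (A : Sec n ξ →ₗ[ℝ] Sec n ξ) (x : M) : Sec n ξ →ₗ[ℝ] ξ x where
  toFun s := A s x
  map_add' s t := by rw [map_add]; rfl
  map_smul' c s := by rw [map_smul]; rfl

theorem isSymbolAt_principal {m : ℕ} {A : Sec n ξ →ₗ[ℝ] Sec n ξ} (hA : IsDiffOp (m + 1) A) (x : M) :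
    IsSymbolAt (fun s x => A s x) (m + 1) x (principal m A x) := by
  obtain ⟨τ, hτ⟩ := exists_isSymbolAt (k := m + 1) (x := x) (fun s x => A s x) (valueAt A x)
    (fun s => rfl) (fun f s => hA f s x)
  exact smbl_isSymbolAt hτ

end Symbols

/-! ### Covariant derivatives of sections and of 1-forms. -/

section CovariantDerivatives

open Topology Filter

variable {n : ℕ} {M : Type*} [TopologicalSpace M] [ChartedSpace (EuclideanSpace ℝ (Fin n)) M]

theorem mdifferentiableAt_finset_prod {ι : Type*} (S : Finset ι) (g : ι → M → ℝ) {x : M}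
    (hg : ∀ i, MDifferentiableAt (𝓡 n) 𝓘(ℝ, ℝ) (g i) x) :
    MDifferentiableAt (𝓡 n) 𝓘(ℝ, ℝ) (fun y => ∏ i ∈ S, g i y) x := by
  classical
  induction S using Finset.induction_on with
  | empty => simpa using mdifferentiableAt_const
  | insert i S hi ih =>
    simp only [Finset.prod_insert hi]
    exact (hg i).mul ih

theorem mdifferentiableAt_finset_sum {ι : Type*} (S : Finset ι) (g : ι → M → ℝ) {x : M}
    (hg : ∀ i ∈ S, MDifferentiableAt (𝓡 n) 𝓘(ℝ, ℝ) (g i) x) :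
    MDifferentiableAt (𝓡 n) 𝓘(ℝ, ℝ) (fun y => ∑ i ∈ S, g i y) x := by
  classical
  induction S using Finset.induction_on with
  | empty => simpa using mdifferentiableAt_const
  | insert i S hi ih =>
    simp only [Finset.sum_insert hi]
    exact (hg i (Finset.mem_insert_self _ _)).add (ih fun j hj => hg j (Finset.mem_insert_of_mem hj))

theorem mvfderiv_finset_sum {ι : Type*} (S : Finset ι) (g : ι → M → ℝ) {x : M}
    (hg : ∀ i ∈ S, MDifferentiableAt (𝓡 n) 𝓘(ℝ, ℝ) (g i) x) :
    mvfderiv (𝓡 n) (fun y => ∑ i ∈ S, g i y) x = ∑ i ∈ S, mvfderiv (𝓡 n) (g i) x := by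
  classical
  induction S using Finset.induction_on with
  | empty => simpa using mvfderiv_const (I := 𝓡 n) (0 : ℝ)
  | insert i S hi ih =>
    simp only [Finset.sum_insert hi]
    have hS : ∀ j ∈ S, MDifferentiableAt (𝓡 n) 𝓘(ℝ, ℝ) (g j) x :=
      fun j hj => hg j (Finset.mem_insert_of_mem hj)
    rw [← ih hS]
    exact mvfderiv_add (hg i (Finset.mem_insert_self _ _)) (mdifferentiableAt_finset_sum S g hS)

variable [IsManifold (𝓡 n) ∞ M] [T2Space M]

/-- The product rule. -/
theorem mvfderiv_prod_apply {j : ℕ} (g : Fin j → M → ℝ) {x : M}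
    (hg : ∀ a, MDifferentiableAt (𝓡 n) 𝓘(ℝ, ℝ) (g a) x) (u : Tan n x) :
    mvfderiv (𝓡 n) (fun y => ∏ a, g a y) x u =
      ∑ a, ∏ b, Function.update (fun b => g b x) a (mvfderiv (𝓡 n) (g a) x u) b := by
  induction j with
  | zero =>
    have : mvfderiv (𝓡 n) (fun _ : M => (1 : ℝ)) x = 0 := mvfderiv_const (I := 𝓡 n) (1 : ℝ)
    simp [this]
  | succ j ih =>
    have h1 : mvfderiv (𝓡 n) (fun y => ∏ a, g a y) x =
        mvfderiv (𝓡 n) (fun y => g 0 y * ∏ a : Fin j, g a.succ y) x :=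
      mvfderiv_congr (Eventually.of_forall fun y => Fin.prod_univ_succ _)
    have h2 := mvfderiv_mul (hg 0)
      (mdifferentiableAt_finset_prod Finset.univ (fun a : Fin j => g a.succ) fun a => hg a.succ)
    have h3 : mvfderiv (𝓡 n) (fun y => g 0 y * ∏ a : Fin j, g a.succ y) x =
      g 0 x • mvfderiv (𝓡 n) (fun y => ∏ a : Fin j, g a.succ y) x +
        (∏ a : Fin j, g a.succ x) • mvfderiv (𝓡 n) (g 0) x := h2
    rw [h1, h3, Fin.sum_univ_succ]
    simp only [add_apply, smul_apply, smul_eq_mul]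
    rw [ih (fun a => g a.succ) (fun a => hg a.succ), add_comm, Finset.mul_sum]
    congr 1
    · rw [Fin.prod_univ_succ, Function.update_self, mul_comm]
      congr 1
    · refine Finset.sum_congr rfl fun a _ => ?_
      rw [Fin.prod_univ_succ, Function.update_of_ne (Fin.succ_ne_zero a).symm]
      congr 1
      refine Finset.prod_congr rfl fun b _ => ?_
      by_cases hb : b = a
      · subst hb; simp
      · rw [Function.update_of_ne hb, Function.update_of_ne (by simpa using hb)]

section General

variable {F : Type*} [NormedAddCommGroup F] [NormedSpace ℝ F]
  {V : M → Type*} [TopologicalSpace (TotalSpace F V)] [∀ x, AddCommGroup (V x)]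
  [∀ x, Module ℝ (V x)] [∀ x, TopologicalSpace (V x)] [∀ x, IsTopologicalAddGroup (V x)]
  [∀ x, ContinuousSMul ℝ (V x)] [FiberBundle F V] [VectorBundle ℝ F V]
  [ContMDiffVectorBundle ∞ F V (𝓡 n)]

theorem section_mdifferentiableAt (s : Cₛ^∞⟮𝓡 n; F, V⟯) (x : M) :
    MDifferentiableAt (𝓡 n) ((𝓡 n).prod 𝓘(ℝ, F)) (fun y => (⟨y, s y⟩ : TotalSpace F V)) x :=
  s.contMDiff.contMDiffAt.mdifferentiableAt (by simp)

theorem mdifferentiableAt_congr_section {s t : Π x, V x} {x : M} (h : ∀ᶠ y in 𝓝 x, s y = t y)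
    (ht : MDifferentiableAt (𝓡 n) ((𝓡 n).prod 𝓘(ℝ, F)) (fun y => (⟨y, t y⟩ : TotalSpace F V)) x) :
    MDifferentiableAt (𝓡 n) ((𝓡 n).prod 𝓘(ℝ, F)) (fun y => (⟨y, s y⟩ : TotalSpace F V)) x :=
  ht.congr_of_eventuallyEq (h.mono fun y hy => by simp only [hy])

theorem contMDiffAt_congr_section {s t : Π x, V x} {x : M} (h : ∀ᶠ y in 𝓝 x, s y = t y)
    (ht : ContMDiffAt (𝓡 n) ((𝓡 n).prod 𝓘(ℝ, F)) ∞ (fun y => (⟨y, t y⟩ : TotalSpace F V)) x) :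
    ContMDiffAt (𝓡 n) ((𝓡 n).prod 𝓘(ℝ, F)) ∞ (fun y => (⟨y, s y⟩ : TotalSpace F V)) x :=
  ht.congr_of_eventuallyEq (h.mono fun y hy => by simp only [hy])

theorem cov_congr (N : CovariantDerivative (𝓡 n) F V) {s t : Π x, V x} {x : M}
    (ht : MDifferentiableAt (𝓡 n) ((𝓡 n).prod 𝓘(ℝ, F)) (fun y => (⟨y, t y⟩ : TotalSpace F V)) x)
    (h : ∀ᶠ y in 𝓝 x, s y = t y) : N s x = N t x :=
  N.isCovariantDerivativeOnUniv.congr_of_eventuallyEq (mdifferentiableAt_congr_section h ht) ht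
    univ_mem h

theorem cov_sum_smul (N : CovariantDerivative (𝓡 n) F V) {ι : Type*} (S : Finset ι)
    (f : ι → M → ℝ) (c : ι → Π x, V x) {x : M}
    (hf : ∀ i, MDifferentiableAt (𝓡 n) 𝓘(ℝ, ℝ) (f i) x)
    (hc : ∀ i, MDifferentiableAt (𝓡 n) ((𝓡 n).prod 𝓘(ℝ, F))
      (fun y => (⟨y, c i y⟩ : TotalSpace F V)) x) (u : Tan n x) :
    N (fun y => ∑ i ∈ S, f i y • c i y) x u =
      ∑ i ∈ S, (f i x • N (c i) x u + mvfderiv (𝓡 n) (f i) x u • c i x) := by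
  classical
  induction S using Finset.induction_on with
  | empty =>
    have h0 : N (fun y => ∑ i ∈ (∅ : Finset ι), f i y • c i y) = 0 := by
      rw [← N.zero]
      congr 1
    rw [h0]
    rfl
  | insert i S hi ih =>
    have h1 := N.isCovariantDerivativeOnUniv.add (x := x) (σ := f i • c i)
      (σ' := fun y => ∑ i ∈ S, f i y • c i y) ((hf i).smul_section (hc i))
      (MDifferentiableAt.sum_section fun i _ => (hf i).smul_section (hc i))
    have h2 : (fun y => ∑ i ∈ insert i S, f i y • c i y) =
        f i • c i + fun y => ∑ i ∈ S, f i y • c i y := by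
      funext y
      rw [Finset.sum_insert hi]
      rfl
    rw [h2, h1, N.isCovariantDerivativeOnUniv.leibniz (hc i) (hf i), Finset.sum_insert hi, ← ih]
    rfl

/-- A smooth connection applied to smooth sections and vector fields gives smooth sections. -/
theorem contMDiff_cov_apply {N : CovariantDerivative (𝓡 n) F V}
    (hN : CovariantDerivative.ContMDiffCovariantDerivative N ∞) (s : Cₛ^∞⟮𝓡 n; F, V⟯)
    (X : VField n M) :
    ContMDiff (𝓡 n) ((𝓡 n).prod 𝓘(ℝ, F)) ∞ (fun y => (⟨y, N s y (X y)⟩ : TotalSpace F V)) := by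
  have h1 := contMDiffOn_univ.1 (hN.contMDiff.contMDiff (σ := s) (by
    rw [contMDiffOn_univ]
    exact s.contMDiff))
  exact ContMDiff.clm_bundle_apply h1 X.contMDiff

end General

theorem IsSmoothForm.eventually_eq_sum {θ : Π x : M, Cot n x} {x₀ : M}
    {z : Fin n → SFun n M} {E : Fin n → VField n M}
    (h : ∀ᶠ y in 𝓝 x₀, ∀ i j, mvfderiv (𝓡 n) (z i) y (E j y) = if i = j then 1 else 0) :
    ∀ᶠ y in 𝓝 x₀, θ y = ∑ i, θ y (E i y) • mvfderiv (𝓡 n) (z i) y :=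
  h.mono fun y hy => cot_eq_sum_smul_of_dual hy (θ y)

theorem IsSmoothForm.mdifferentiableAt_apply {θ : Π x : M, Cot n x} (hθ : IsSmoothForm θ)
    {X : Π x : M, Tan n x} {x : M}
    (hX : MDifferentiableAt (𝓡 n) (𝓡 n).tangent (fun y => (⟨y, X y⟩ : TangentBundle (𝓡 n) M)) x) :
    MDifferentiableAt (𝓡 n) 𝓘(ℝ, ℝ) (fun y => θ y (X y)) x := by
  obtain ⟨z, E, hzE⟩ := exists_coordinates (n := n) x
  have h1 := mdifferentiableAt_finset_sum Finset.univ
    (fun i y => θ y (E i y) * mvfderiv (𝓡 n) (z i) y (X y)) (x := x) (fun i _ =>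
      ((hθ (E i)).contMDiffAt.mdifferentiableAt (by simp)).mul
        (mdifferentiableAt_mvfderiv_apply (z i) hX))
  refine h1.congr_of_eventuallyEq ?_
  filter_upwards [IsSmoothForm.eventually_eq_sum (θ := θ) hzE] with y hy
  conv_lhs => rw [hy]
  simp

/-- `dualCov` is defined through the canonical extensions of a basis. The expression on the right is
tensorial in `X`, so any differentiable field with the same value at `x` gives the same result. -/
theorem dualCov_apply (D : AffConn n M) {θ : Π x : M, Cot n x} (hθ : IsSmoothForm θ)
    {X : Π x : M, Tan n x} {x : M}
    (hX : MDifferentiableAt (𝓡 n) (𝓡 n).tangent (fun y => (⟨y, X y⟩ : TangentBundle (𝓡 n) M)) x)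
    (v : Tan n x) :
    dualCov D θ x v (X x) = mvfderiv (𝓡 n) (fun y => θ y (X y)) x v - θ x (D X x v) := by
  let Φ : (Π x : M, Tan n x) → ℝ := fun X =>
    mvfderiv (𝓡 n) (fun y => θ y (X y)) x v - θ x (D X x v)
  have hΦ : TensorialAt (𝓡 n) (Mdl n) Φ x :=
    { smul := by
        intro f X hf hX
        have h1 := mvfderiv_mul hf (hθ.mdifferentiableAt_apply hX)
        have h2 : mvfderiv (𝓡 n) (fun y => θ y ((f • X) y)) x =
            mvfderiv (𝓡 n) (f * fun y => θ y (X y)) x :=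
          mvfderiv_congr (Eventually.of_forall fun y => by
            change θ y (f y • X y) = f y * θ y (X y)
            rw [map_smul, smul_eq_mul])
        simp only [Φ]
        rw [h2, h1, D.isCovariantDerivativeOnUniv.leibniz hX hf]
        simp only [add_apply, smul_apply, smul_eq_mul, ContinuousLinearMap.smulRight_apply,
          map_add, map_smul]
        ring
      add := by
        intro X X' hX hX'
        have h1 := mvfderiv_add (hθ.mdifferentiableAt_apply hX) (hθ.mdifferentiableAt_apply hX')
        have h2 : mvfderiv (𝓡 n) (fun y => θ y ((X + X') y)) x =
            mvfderiv (𝓡 n) ((fun y => θ y (X y)) + fun y => θ y (X' y)) x :=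
          mvfderiv_congr (Eventually.of_forall fun y => map_add (θ y) _ _)
        simp only [Φ]
        rw [h2, h1, D.isCovariantDerivativeOnUniv.add hX hX']
        simp only [add_apply, map_add]
        ring }
  have h1 := TensorialAt.mkHom_apply hΦ hX
  refine Eq.trans ?_ h1
  conv_rhs => rw [eq_sum_smul_of_dual (tcoord_tbasis x) (X x)]
  rw [map_sum, dualCov]
  simp only [sum_apply, smul_apply, smul_eq_mul, map_smul]
  refine Finset.sum_congr rfl fun a _ => ?_
  rw [TensorialAt.mkHom_apply_eq_extend, mul_comm]

/-- The covariant derivative of a form as a linear function of the direction. -/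
def dualCovL (D : AffConn n M) (θ : Π x : M, Cot n x) (x : M) : Tan n x →ₗ[ℝ] Cot n x where
  toFun v := dualCov D θ x v
  map_add' u v := by
    simp only [dualCov, map_add, ← Finset.sum_add_distrib, ← add_smul]
    refine Finset.sum_congr rfl fun a _ => ?_
    congr 1
    ring
  map_smul' c v := by
    simp only [dualCov, map_smul, Finset.smul_sum, smul_smul, smul_eq_mul, RingHom.id_apply]
    refine Finset.sum_congr rfl fun a _ => ?_
    congr 1
    ring

end CovariantDerivatives

/-! ### Tensor fields with values in the line bundle and the derivation `d^s`. -/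

section SmoothTensors

open Topology Filter

variable {n : ℕ} {M : Type*} [TopologicalSpace M] [ChartedSpace (EuclideanSpace ℝ (Fin n)) M]
  [IsManifold (𝓡 n) ∞ M]
  {ξ : M → Type*} [TopologicalSpace (TotalSpace ℝ ξ)]
  [∀ x, AddCommGroup (ξ x)] [∀ x, Module ℝ (ξ x)] [∀ x, TopologicalSpace (ξ x)]
  [FiberBundle ℝ ξ] [VectorBundle ℝ ℝ ξ] [ContMDiffVectorBundle ∞ ℝ ξ (𝓡 n)]

/-- Smooth multilinear forms on the tangent spaces with values in `ξ`. -/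
structure IsSmoothTensor {j : ℕ} (η : Π x : M, (Fin j → Tan n x) → ξ x) : Prop where
  multilinear : ∀ x, ∃ μ : MultilinearMap ℝ (fun _ : Fin j => Tan n x) (ξ x), ∀ v, η x v = μ v
  smooth : ∀ V : Fin j → VField n M, ContMDiff (𝓡 n) ((𝓡 n).prod 𝓘(ℝ, ℝ)) ∞
    (fun y => (⟨y, η y (fun a => V a y)⟩ : TotalSpace ℝ ξ))

namespace IsSmoothTensor

variable {j : ℕ} {η η' : Π x : M, (Fin j → Tan n x) → ξ x}

/-- The value on vector fields, as a section. -/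
def eval (hη : IsSmoothTensor η) (V : Fin j → VField n M) : Sec n ξ :=
  ⟨fun y => η y (fun a => V a y), hη.smooth V⟩

theorem expand (hη : IsSmoothTensor η) {y : M} {θ : Fin n → Cot n y} {E : Fin n → VField n M}
    (h : ∀ i j, θ i (E j y) = if i = j then 1 else 0) (v : Fin j → Tan n y) :
    η y v = ∑ J : Fin j → Fin n, (∏ a, θ (J a) (v a)) • hη.eval (fun a => E (J a)) y := by
  obtain ⟨μ, hμ⟩ := hη.multilinear y
  have h1 : v = fun a => ∑ i, θ i (v a) • E i y := by
    funext a; exact eq_sum_smul_of_dual h (v a)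
  conv_lhs => rw [hμ, h1, μ.map_sum]
  refine Finset.sum_congr rfl fun J _ => ?_
  rw [μ.map_smul_univ]
  congr 1
  exact (hμ _).symm

theorem sub (hη : IsSmoothTensor η) (hη' : IsSmoothTensor η') :
    IsSmoothTensor (fun x v => η x v - η' x v) where
  multilinear x := by
    obtain ⟨μ, hμ⟩ := hη.multilinear x
    obtain ⟨μ', hμ'⟩ := hη'.multilinear x
    exact ⟨μ - μ', fun v => by rw [hμ, hμ']; rfl⟩
  smooth V := (hη.smooth V).sub_section (hη'.smooth V)

theorem smul (hη : IsSmoothTensor η) (F : SFun n M) :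
    IsSmoothTensor (fun x v => F x • η x v) where
  multilinear x := by
    obtain ⟨μ, hμ⟩ := hη.multilinear x
    exact ⟨F x • μ, fun v => by rw [hμ]; rfl⟩
  smooth V := F.contMDiff.smul_section (hη.smooth V)

theorem of_section (s : Sec n ξ) : IsSmoothTensor (fun (x : M) (_ : Fin 0 → Tan n x) => s x) where
  multilinear x := ⟨MultilinearMap.constOfIsEmpty ℝ _ (s x), fun _ => rfl⟩
  smooth _ := s.contMDiff

theorem update_apply_linear (hη : IsSmoothTensor η) (x : M) (w : Fin j → Tan n x) (a : Fin j) :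
    ∃ L : Tan n x →ₗ[ℝ] ξ x, ∀ u, η x (Function.update w a u) = L u := by
  obtain ⟨μ, hμ⟩ := hη.multilinear x
  exact ⟨μ.toLinearMap w a, fun u => hμ _⟩

end IsSmoothTensor

/-- A product of covectors times a vector is multilinear. -/
theorem exists_multilinear_prod_smul {x : M} {j : ℕ} (θ : Fin j → Cot n x) (s : ξ x) :
    ∃ μ : MultilinearMap ℝ (fun _ : Fin j => Tan n x) (ξ x), ∀ v, (∏ b, θ b (v b)) • s = μ v :=
  ⟨((MultilinearMap.mkPiAlgebra ℝ (Fin j) ℝ).compLinearMap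
    fun b => (θ b : Tan n x →ₗ[ℝ] ℝ)).smulRight s, fun v => by simp⟩

theorem exists_multilinear_sum {ι : Type*} {x : M} {j : ℕ} (S : Finset ι)
    (g : ι → (Fin j → Tan n x) → ξ x)
    (h : ∀ i, ∃ μ : MultilinearMap ℝ (fun _ : Fin j => Tan n x) (ξ x), ∀ v, g i v = μ v) :
    ∃ μ : MultilinearMap ℝ (fun _ : Fin j => Tan n x) (ξ x), ∀ v, ∑ i ∈ S, g i v = μ v := by
  choose μ hμ using h
  exact ⟨∑ i ∈ S, μ i, fun v => by simp [hμ]⟩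

variable [T2Space M] [∀ x, IsTopologicalAddGroup (ξ x)] [∀ x, ContinuousSMul ℝ (ξ x)]

section Derivative

variable {j : ℕ} {η η' : Π x : M, (Fin j → Tan n x) → ξ x}

theorem IsSmoothTensor.mdifferentiableAt (hη : IsSmoothTensor η) {x : M}
    {X : Fin j → Π x : M, Tan n x}
    (hX : ∀ a, MDifferentiableAt (𝓡 n) (𝓡 n).tangent
      (fun y => (⟨y, X a y⟩ : TangentBundle (𝓡 n) M)) x) :
    MDifferentiableAt (𝓡 n) ((𝓡 n).prod 𝓘(ℝ, ℝ))
      (fun y => (⟨y, η y (fun a => X a y)⟩ : TotalSpace ℝ ξ)) x := by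
  obtain ⟨z, E, hzE⟩ := exists_coordinates (n := n) x
  refine mdifferentiableAt_congr_section (t := fun y => ∑ J : Fin j → Fin n,
      (∏ a, mvfderiv (𝓡 n) (z (J a)) y (X a y)) • hη.eval (fun a => E (J a)) y) ?_ ?_
  · filter_upwards [hzE] with y hy
    exact hη.expand hy _
  · exact MDifferentiableAt.sum_section fun J _ => MDifferentiableAt.smul_section
      (mdifferentiableAt_finset_prod Finset.univ _ fun a => mdifferentiableAt_mvfderiv_apply _ (hX a))
      (section_mdifferentiableAt _ x)

theorem mdifferentiableAt_extend_tan {x : M} (v : Tan n x) :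
    MDifferentiableAt (𝓡 n) (𝓡 n).tangent
      (fun y => (⟨y, extend (Mdl n) v y⟩ : TangentBundle (𝓡 n) M)) x :=
  mdifferentiableAt_extend (𝓡 n) (Mdl n) v

/-- The covariant derivative of a tensor, computed with arbitrary extensions of vectors. -/
theorem IsSmoothTensor.cov_eq (hη : IsSmoothTensor η) (D : AffConn n M) (N : LinConn n ξ) {x : M}
    {z : Fin n → SFun n M} {E : Fin n → VField n M}
    (hzE : ∀ᶠ y in 𝓝 x, ∀ i j, mvfderiv (𝓡 n) (z i) y (E j y) = if i = j then 1 else 0)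
    {X : Fin j → Π x : M, Tan n x}
    (hX : ∀ a, MDifferentiableAt (𝓡 n) (𝓡 n).tangent
      (fun y => (⟨y, X a y⟩ : TangentBundle (𝓡 n) M)) x) (u : Tan n x) :
    N (fun y => η y (fun a => X a y)) x u
      - ∑ a, η x (Function.update (fun b => X b x) a (D (X a) x u)) =
    ∑ J : Fin j → Fin n, ((∏ a, mvfderiv (𝓡 n) (z (J a)) x (X a x)) •
        N (hη.eval fun a => E (J a)) x u +
      ∑ a, (∏ b, (Function.update (fun b => mvfderiv (𝓡 n) (z (J b)) x) a
        (dualCov D (fun y => mvfderiv (𝓡 n) (z (J a)) y) x u) : Fin j → Cot n x) b (X b x)) •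
          hη.eval (fun a => E (J a)) x) := by
  have h1 : ∀ᶠ y in 𝓝 x, η y (fun a => X a y) = ∑ J : Fin j → Fin n,
      (∏ a, mvfderiv (𝓡 n) (z (J a)) y (X a y)) • hη.eval (fun a => E (J a)) y := by
    filter_upwards [hzE] with y hy
    exact hη.expand hy _
  have hd : ∀ i a, MDifferentiableAt (𝓡 n) 𝓘(ℝ, ℝ) (fun y => mvfderiv (𝓡 n) (z i) y (X a y)) x :=
    fun i a => mdifferentiableAt_mvfderiv_apply _ (hX a)
  have h0 : MDifferentiableAt (𝓡 n) ((𝓡 n).prod 𝓘(ℝ, ℝ)) (fun y => (⟨y, ∑ J : Fin j → Fin n,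
      (∏ a, mvfderiv (𝓡 n) (z (J a)) y (X a y)) • hη.eval (fun a => E (J a)) y⟩ :
        TotalSpace ℝ ξ)) x :=
    MDifferentiableAt.sum_section fun J _ => MDifferentiableAt.smul_section
      (mdifferentiableAt_finset_prod Finset.univ _ fun a => hd (J a) a)
      (section_mdifferentiableAt _ x)
  rw [cov_congr N h0 h1,
    cov_sum_smul N Finset.univ (fun (J : Fin j → Fin n) y => ∏ a, mvfderiv (𝓡 n) (z (J a)) y (X a y))
      (fun J => hη.eval fun a => E (J a))
      (fun J => mdifferentiableAt_finset_prod Finset.univ _ fun a => hd (J a) a)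
      (fun J => section_mdifferentiableAt _ x)]
  simp_rw [hη.expand hzE.self_of_nhds]
  rw [Finset.sum_comm, ← Finset.sum_sub_distrib]
  refine Finset.sum_congr rfl fun J _ => ?_
  rw [add_sub_assoc]
  congr 1
  rw [mvfderiv_prod_apply (fun a y => mvfderiv (𝓡 n) (z (J a)) y (X a y)) (fun a => hd (J a) a),
    Finset.sum_smul, ← Finset.sum_sub_distrib]
  refine Finset.sum_congr rfl fun a _ => ?_
  rw [← sub_smul]
  congr 1
  have e1 : ∀ b, mvfderiv (𝓡 n) (z (J b)) x (Function.update (fun b => X b x) a (D (X a) x u) b) =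
      Function.update (fun b => mvfderiv (𝓡 n) (z (J b)) x (X b x)) a
        (mvfderiv (𝓡 n) (z (J a)) x (D (X a) x u)) b := by
    intro b
    by_cases hb : b = a
    · subst hb; simp
    · simp [Function.update_of_ne hb]
  have e2 : ∀ b, (Function.update (fun b => mvfderiv (𝓡 n) (z (J b)) x) a
        (dualCov D (fun y => mvfderiv (𝓡 n) (z (J a)) y) x u) : Fin j → Cot n x) b (X b x) =
      Function.update (fun b => mvfderiv (𝓡 n) (z (J b)) x (X b x)) a
        (dualCov D (fun y => mvfderiv (𝓡 n) (z (J a)) y) x u (X a x)) b := by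
    intro b
    by_cases hb : b = a
    · subst hb; simp
    · simp [Function.update_of_ne hb]
  simp_rw [e1, e2]
  rw [Finset.prod_update_of_mem (Finset.mem_univ a), Finset.prod_update_of_mem (Finset.mem_univ a),
    Finset.prod_update_of_mem (Finset.mem_univ a), ← sub_mul,
    dualCov_apply D (isSmoothForm_mvfderiv _) (hX a)]

/-- The formula of `IsSmoothTensor.cov_eq` involves only the values of the fields at `x`. This
allows `dSym`, defined with `extend`, to be computed on global smooth fields. -/
theorem IsSmoothTensor.cov_eq_extend (hη : IsSmoothTensor η) (D : AffConn n M) (N : LinConn n ξ)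
    {x : M} {X : Fin j → Π x : M, Tan n x}
    (hX : ∀ a, MDifferentiableAt (𝓡 n) (𝓡 n).tangent
      (fun y => (⟨y, X a y⟩ : TangentBundle (𝓡 n) M)) x) (u : Tan n x) :
    N (fun y => η y (fun a => extend (Mdl n) (X a x) y)) x u
      - ∑ a, η x (Function.update (fun b => X b x) a (D (extend (Mdl n) (X a x)) x u)) =
    N (fun y => η y (fun a => X a y)) x u
      - ∑ a, η x (Function.update (fun b => X b x) a (D (X a) x u)) := by
  obtain ⟨z, E, hzE⟩ := exists_coordinates (n := n) x
  rw [hη.cov_eq D N hzE hX]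
  have h1 := hη.cov_eq D N hzE (X := fun a => extend (Mdl n) (X a x))
    (fun a => mdifferentiableAt_extend_tan (X a x)) u
  simp only [extend_apply_self] at h1
  exact h1

theorem isSmoothTensor_dSym (hη : IsSmoothTensor η) {D : AffConn n M} {N : LinConn n ξ}
    (hD : CovariantDerivative.ContMDiffCovariantDerivative D ∞)
    (hN : CovariantDerivative.ContMDiffCovariantDerivative N ∞) : IsSmoothTensor (dSym D N η) where
  multilinear x := by
    obtain ⟨z, E, hzE⟩ := exists_coordinates (n := n) x
    let T : Tan n x → (Fin j → Tan n x) → ξ x := fun u w =>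
      N (fun y => η y (fun a => extend (Mdl n) (w a) y)) x u
        - ∑ a, η x (Function.update w a (D (extend (Mdl n) (w a)) x u))
    have hT : ∀ u, ∃ μ : MultilinearMap ℝ (fun _ : Fin j => Tan n x) (ξ x), ∀ w, T u w = μ w := by
      intro u
      have h1 : ∀ w, T u w = _ := fun w => by
        have h2 := hη.cov_eq D N hzE (X := fun a => extend (Mdl n) (w a))
          (fun a => mdifferentiableAt_extend_tan (w a)) u
        simp only [extend_apply_self] at h2
        exact h2
      obtain ⟨μ, hμ⟩ := exists_multilinear_sum Finset.univ _ fun J : Fin j → Fin n => by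
        obtain ⟨μ₁, hμ₁⟩ := exists_multilinear_prod_smul
          (fun a => mvfderiv (𝓡 n) (z (J a)) x) (N (hη.eval fun a => E (J a)) x u)
        obtain ⟨μ₂, hμ₂⟩ := exists_multilinear_sum Finset.univ _ fun a : Fin j =>
          exists_multilinear_prod_smul (Function.update (fun b => mvfderiv (𝓡 n) (z (J b)) x) a
            (dualCov D (fun y => mvfderiv (𝓡 n) (z (J a)) y) x u)) (hη.eval (fun a => E (J a)) x)
        exact ⟨μ₁ + μ₂, fun v => (congrArg₂ (· + ·) (hμ₁ v) (hμ₂ v) : _ + _ = _)⟩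
      exact ⟨μ, fun w => (h1 w).trans (hμ w)⟩
    choose μ hμ using hT
    have hadd : ∀ u u' w, T (u + u') w = T u w + T u' w := by
      intro u u' w
      simp only [T, map_add]
      have h1 : ∀ a, η x (Function.update w a (D (extend (Mdl n) (w a)) x u +
          D (extend (Mdl n) (w a)) x u')) = η x (Function.update w a (D (extend (Mdl n) (w a)) x u)) +
          η x (Function.update w a (D (extend (Mdl n) (w a)) x u')) := by
        intro a
        obtain ⟨L, hL⟩ := hη.update_apply_linear x w a
        rw [hL, hL, hL, map_add]
      simp only [h1, Finset.sum_add_distrib]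
      abel
    have hsmul : ∀ (c : ℝ) u w, T (c • u) w = c • T u w := by
      intro c u w
      simp only [T, map_smul]
      have h1 : ∀ a, η x (Function.update w a (c • D (extend (Mdl n) (w a)) x u)) =
          c • η x (Function.update w a (D (extend (Mdl n) (w a)) x u)) := by
        intro a
        obtain ⟨L, hL⟩ := hη.update_apply_linear x w a
        rw [hL, hL, map_smul]
      simp only [h1, ← Finset.smul_sum, smul_sub]
    -- Linearity in the direction `u` and multilinearity in the remaining arguments are proved
    -- separately and combined by uncurrying in the `i`-th slot.
    let G : Tan n x →ₗ[ℝ] MultilinearMap ℝ (fun _ : Fin j => Tan n x) (ξ x) :=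
      { toFun := μ
        map_add' := fun u u' => by
          ext w
          rw [← hμ, hadd, hμ, hμ]
          rfl
        map_smul' := fun c u => by
          ext w
          rw [← hμ, hsmul, hμ]
          rfl }
    obtain ⟨ν, hν⟩ := exists_multilinear_sum Finset.univ
      (fun (i : Fin (j + 1)) (v : Fin (j + 1) → Tan n x) => T (v i) (fun a => v (i.succAbove a)))
      fun i => ⟨LinearMap.uncurryMid (M := fun _ => Tan n x) i G, fun v => by
        rw [LinearMap.uncurryMid_apply, hμ]
        rfl⟩
    exact ⟨(1 / ((j : ℝ) + 1)) • ν, fun v => congrArg (fun t => (1 / ((j : ℝ) + 1)) • t) (hν v)⟩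
  smooth V := by
    have h1 : ∀ y, dSym D N η y (fun a => V a y) = (1 / ((j : ℝ) + 1)) • ∑ i : Fin (j + 1),
        (N (hη.eval fun a => V (i.succAbove a)) y (V i y)
          - ∑ a : Fin j, η y (Function.update (fun b => V (i.succAbove b) y) a
              (D (V (i.succAbove a)) y (V i y)))) := by
      intro y
      rw [dSym]
      congr 1
      refine Finset.sum_congr rfl fun i _ => ?_
      exact hη.cov_eq_extend D N (X := fun a => V (i.succAbove a))
        (fun a => section_mdifferentiableAt _ y) (V i y)
    simp only [h1]
    refine ContMDiff.const_smul_section (ContMDiff.sum_section fun i _ => ContMDiff.sub_section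
      (contMDiff_cov_apply hN _ _) (ContMDiff.sum_section fun a _ => ?_))
    let W : VField n M := ⟨fun y => D (V (i.succAbove a)) y (V i y), contMDiff_cov_apply hD _ _⟩
    have h2 : ∀ y, (Function.update (fun b => V (i.succAbove b) y) a
        (D (V (i.succAbove a)) y (V i y)) : Fin j → Tan n y) =
        fun b => (Function.update (fun b => V (i.succAbove b)) a W : Fin j → VField n M) b y := by
      intro y
      funext b
      by_cases hb : b = a
      · subst hb; simp [W]
      · simp [Function.update_of_ne hb]
    simp only [h2]
    exact hη.smooth _

end Derivative

end SmoothTensors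

/-! ### Full contraction and symmetric products of covectors. -/

section Contraction

variable {n : ℕ} {M : Type*} [TopologicalSpace M] [ChartedSpace (EuclideanSpace ℝ (Fin n)) M]

theorem contract_prod_smul {x : M} {j : ℕ} {W : Type*} [AddCommGroup W] [Module ℝ W]
    (σ : Contra n j x) (θ : Fin j → Cot n x) (s : W) :
    contract σ (fun v => (∏ b, θ b (v b)) • s) = σ θ • s := by
  have h1 : θ = fun b => ∑ i, θ b (tbasis x i) • tcoord x i := by
    funext b
    exact cot_eq_sum_smul_of_dual (tcoord_tbasis x) (θ b)
  conv_rhs => rw [h1, σ.map_sum, Finset.sum_smul]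
  refine Finset.sum_congr rfl fun I _ => ?_
  rw [σ.map_smul_univ, smul_smul, smul_eq_mul, mul_comm]

theorem contract_sub {x : M} {j : ℕ} {W : Type*} [AddCommGroup W] [Module ℝ W]
    (σ : Contra n j x) (η η' : (Fin j → Tan n x) → W) :
    contract σ (fun v => η v - η' v) = contract σ η - contract σ η' := by
  simp only [contract, smul_sub, Finset.sum_sub_distrib]

theorem contract_add {x : M} {j : ℕ} {W : Type*} [AddCommGroup W] [Module ℝ W]
    (σ : Contra n j x) (η η' : (Fin j → Tan n x) → W) :
    contract σ (fun v => η v + η' v) = contract σ η + contract σ η' := by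
  simp only [contract, smul_add, Finset.sum_add_distrib]

theorem contract_smul {x : M} {j : ℕ} {W : Type*} [AddCommGroup W] [Module ℝ W]
    (σ : Contra n j x) (c : ℝ) (η : (Fin j → Tan n x) → W) :
    contract σ (fun v => c • η v) = c • contract σ η := by
  simp only [contract, Finset.smul_sum]
  exact Finset.sum_congr rfl fun I _ => smul_comm _ _ _

theorem contract_sum {ι : Type*} (S : Finset ι) {x : M} {j : ℕ} {W : Type*} [AddCommGroup W]
    [Module ℝ W] (σ : Contra n j x) (η : ι → (Fin j → Tan n x) → W) :
    contract σ (fun v => ∑ i ∈ S, η i v) = ∑ i ∈ S, contract σ (η i) := by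
  simp only [contract, Finset.smul_sum]
  exact Finset.sum_comm

/-- The sum over `l` of the products with the `l`-th factor `β` replaced by `a`. -/
def symProd {x : M} {j : ℕ} (a β : Cot n x) (v : Fin j → Tan n x) : ℝ :=
  ∑ l, ∏ b, Function.update (fun b => β (v b)) l (a (v l)) b

theorem symProd_eq {x : M} {j : ℕ} (a β : Cot n x) (v : Fin (j + 1) → Tan n x) :
    symProd a β v = ∑ l, a (v l) * ∏ b, β (v (l.succAbove b)) := by
  refine Finset.sum_congr rfl fun l _ => ?_
  rw [Fin.prod_univ_succAbove _ l, Function.update_self]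
  congr 1
  refine Finset.prod_congr rfl fun b _ => ?_
  rw [Function.update_of_ne (Fin.succAbove_ne l b)]

/-- Let `P l` be the product with `a` in slot `l`. The term of index `i` is the sum of the `P l`
with `l ≠ i`, so each `P l` is counted `j` times. -/
theorem sum_mul_symProd {x : M} {j : ℕ} (a β : Cot n x) (v : Fin (j + 1) → Tan n x) :
    ∑ i, β (v i) * symProd a β (fun b => v (i.succAbove b)) = j * symProd a β v := by
  let P : Fin (j + 1) → ℝ := fun l => ∏ b, Function.update (fun b => β (v b)) l (a (v l)) b
  have h1 : ∀ i, β (v i) * symProd a β (fun b => v (i.succAbove b)) = ∑ l, P l - P i := by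
    intro i
    rw [Fin.sum_univ_succAbove P i, add_sub_cancel_left, symProd, Finset.mul_sum]
    refine Finset.sum_congr rfl fun l _ => ?_
    simp only [P]
    rw [Fin.prod_univ_succAbove _ i, Function.update_of_ne (Fin.succAbove_ne i l).symm]
    congr 1
    refine Finset.prod_congr rfl fun b _ => ?_
    by_cases hb : b = l
    · subst hb; simp
    · rw [Function.update_of_ne hb, Function.update_of_ne]
      exact fun h => hb (Fin.succAbove_right_injective h)
  simp only [h1, Finset.sum_sub_distrib, Finset.sum_const, Finset.card_univ, Fintype.card_fin]
  change (j + 1) • symProd a β v - symProd a β v = _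
  rw [nsmul_eq_mul]
  push_cast
  ring

theorem symPow_apply_perm {x : M} {j : ℕ} {σ : Contra n j x} (hσ : σ ∈ symPow j x)
    (e : Equiv.Perm (Fin j)) (v : Fin j → Cot n x) : σ (fun i => v (e i)) = σ v :=
  congrArg (fun γ : Contra n j x => γ v) (hσ e)

theorem symPow_apply_update {x : M} {m : ℕ} {σ : Contra n (m + 1) x} (hσ : σ ∈ symPow (m + 1) x)
    (a β : Cot n x) (l : Fin (m + 1)) :
    σ (Function.update (fun _ => β) l a) = σ (Fin.cons a fun _ => β) := by
  rw [← symPow_apply_perm hσ (Equiv.swap 0 l)]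
  congr 1
  funext i
  refine Fin.cases ?_ (fun i => ?_) i
  · simp
  · rw [Fin.cons_succ]
    by_cases h : i.succ = l
    · subst h
      rw [Equiv.swap_apply_right, Function.update_of_ne (Fin.succ_ne_zero i).symm]
    · rw [Equiv.swap_apply_of_ne_of_ne (Fin.succ_ne_zero i) h, Function.update_of_ne h]

theorem contract_symProd_smul {x : M} {m : ℕ} {W : Type*} [AddCommGroup W] [Module ℝ W]
    {σ : Contra n (m + 1) x} (hσ : σ ∈ symPow (m + 1) x) (a β : Cot n x) (s : W) :
    contract σ (fun v => symProd a β v • s) =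
      (((m : ℝ) + 1) * σ (Fin.cons a fun _ => β)) • s := by
  have h1 : (fun v : Fin (m + 1) → Tan n x => symProd a β v • s) = fun v =>
      ∑ l, (∏ b, (Function.update (fun _ => β) l a : Fin (m + 1) → Cot n x) b (v b)) • s := by
    funext v
    rw [symProd, Finset.sum_smul]
    refine Finset.sum_congr rfl fun l _ => ?_
    congr 1
    refine Finset.prod_congr rfl fun b _ => ?_
    by_cases hb : b = l
    · subst hb; simp
    · simp [Function.update_of_ne hb]
  rw [h1, contract_sum]
  simp only [contract_prod_smul, symPow_apply_update hσ]
  rw [Finset.sum_const, Finset.card_univ, Fintype.card_fin, ← Nat.cast_smul_eq_nsmul ℝ, smul_smul]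
  push_cast
  rfl

theorem curryLeft_mem_symPow {x : M} {m : ℕ} {σ : Contra n (m + 1) x} (hσ : σ ∈ symPow (m + 1) x)
    (a : Cot n x) : σ.curryLeft a ∈ symPow m x := by
  intro e
  ext v
  rw [MultilinearMap.domDomCongr_apply, MultilinearMap.curryLeft_apply,
    MultilinearMap.curryLeft_apply]
  rw [← symPow_apply_perm hσ (Equiv.Perm.decomposeFin.symm (0, e)) (Fin.cons a v)]
  congr 1
  funext i
  refine Fin.cases ?_ (fun i => ?_) i
  · simp
  · simp

end Contraction

/-! ### Commutators of powers of `d^s` with functions. -/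

section Commutators

open Topology Filter

variable {n : ℕ} {M : Type*} [TopologicalSpace M] [ChartedSpace (EuclideanSpace ℝ (Fin n)) M]
  [IsManifold (𝓡 n) ∞ M]
  {ξ : M → Type*} [TopologicalSpace (TotalSpace ℝ ξ)]
  [∀ x, AddCommGroup (ξ x)] [∀ x, Module ℝ (ξ x)] [∀ x, TopologicalSpace (ξ x)]
  [FiberBundle ℝ ξ] [VectorBundle ℝ ℝ ξ] [ContMDiffVectorBundle ∞ ℝ ξ (𝓡 n)]

/-- Maps from sections to `ξ`-valued forms. -/
abbrev TensorOp (n : ℕ) {M : Type*} [TopologicalSpace M] [ChartedSpace (Mdl n) M]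
    (ξ : M → Type*) [TopologicalSpace (TotalSpace ℝ ξ)]
    [∀ x, AddCommGroup (ξ x)] [∀ x, Module ℝ (ξ x)] [∀ x, TopologicalSpace (ξ x)]
    [FiberBundle ℝ ξ] [VectorBundle ℝ ℝ ξ] (j : ℕ) :=
  Sec n ξ → Π x : M, (Fin j → Tan n x) → ξ x

variable {j : ℕ}

/-- The commutator with the multiplication by a function. -/
def adT (F : SFun n M) (P : TensorOp n ξ j) : TensorOp n ξ j :=
  fun s x v => P (mulOp F s) x v - F x • P s x v

/-- The `p`-fold commutator with the multiplication by a function. -/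
def adIter (F : SFun n M) : ℕ → TensorOp n ξ j → TensorOp n ξ j
  | 0, P => P
  | p + 1, P => adIter F p (adT F P)

/-- The symmetric product of a 1-form and a `ξ`-valued form. -/
def formMul (β : Π x : M, Cot n x) (η : Π x : M, (Fin j → Tan n x) → ξ x) :
    Π x : M, (Fin (j + 1) → Tan n x) → ξ x :=
  fun x v => (1 / ((j : ℝ) + 1)) • ∑ i : Fin (j + 1), β x (v i) • η x (fun a => v (i.succAbove a))

theorem adT_formMul (F : SFun n M) (β : Π x : M, Cot n x) (P : TensorOp n ξ j) :
    adT F (fun s => formMul β (P s)) = fun s => formMul β (adT F P s) := by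
  funext s x v
  simp only [adT, formMul, smul_sub, Finset.sum_sub_distrib, Finset.smul_sum]
  congr 1
  refine Finset.sum_congr rfl fun i _ => ?_
  rw [smul_comm (F x), smul_comm (F x)]

theorem adIter_formMul (F : SFun n M) (p : ℕ) (β : Π x : M, Cot n x) (P : TensorOp n ξ j) :
    adIter F p (fun s => formMul β (P s)) = fun s => formMul β (adIter F p P s) := by
  induction p generalizing P with
  | zero => rfl
  | succ p ih => rw [adIter, adT_formMul, ih]; rfl

theorem adIter_add (F : SFun n M) (p : ℕ) (P Q : TensorOp n ξ j) :
    adIter F p (fun s x v => P s x v + Q s x v) =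
      fun s x v => adIter F p P s x v + adIter F p Q s x v := by
  induction p generalizing P Q with
  | zero => rfl
  | succ p ih =>
    simp only [adIter]
    rw [← ih]
    congr 1
    funext s x v
    simp only [adT, smul_add]
    abel

theorem adIter_zero (F : SFun n M) (p : ℕ) :
    adIter F p (fun _ _ _ => 0 : TensorOp n ξ j) = fun _ _ _ => 0 := by
  induction p with
  | zero => rfl
  | succ p ih =>
    rw [adIter]
    have : adT F (fun _ _ _ => 0 : TensorOp n ξ j) = fun _ _ _ => 0 := by
      funext s x v
      simp [adT]
    rw [this, ih]

theorem isSmoothTensor_adIter (F : SFun n M) (p : ℕ) {P : TensorOp n ξ j}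
    (hP : ∀ s, IsSmoothTensor (P s)) (s : Sec n ξ) : IsSmoothTensor (adIter F p P s) := by
  induction p generalizing P with
  | zero => exact hP s
  | succ p ih => exact ih fun s => (hP _).sub ((hP s).smul F)

/-- Contraction with `σ` is pointwise linear, so commutators with functions pass through it to the
tensor-valued operator. -/
theorem iterComm_contract {k : ℕ} (σ : Π x : M, Contra n j x) (P : TensorOp n ξ j) (F : SFun n M)
    (s : Sec n ξ) (x : M) :
    iterComm (fun s x => contract (σ x) (P s x)) (fun _ : Fin k => F) s x =
      contract (σ x) (adIter F k P s x) := by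
  induction k generalizing P with
  | zero => rfl
  | succ k ih =>
    rw [iterComm, adIter, ← ih]
    have h1 : (fun (s : Sec n ξ) x => contract (σ x) (P (mulOp F s) x) -
        F x • contract (σ x) (P s x)) = fun s x => contract (σ x) (adT F P s x) := by
      funext s x
      rw [← contract_smul, ← contract_sub]
      rfl
    rw [h1]
    rfl

variable [T2Space M] [∀ x, IsTopologicalAddGroup (ξ x)] [∀ x, ContinuousSMul ℝ (ξ x)]

theorem IsSmoothTensor.mdifferentiableAt_extend {η : Π x : M, (Fin j → Tan n x) → ξ x}
    (hη : IsSmoothTensor η) {x : M} (w : Fin j → Tan n x) :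
    MDifferentiableAt (𝓡 n) ((𝓡 n).prod 𝓘(ℝ, ℝ))
      (fun y => (⟨y, η y (fun a => extend (Mdl n) (w a) y)⟩ : TotalSpace ℝ ξ)) x :=
  hη.mdifferentiableAt fun a => mdifferentiableAt_extend_tan (w a)

theorem dSym_add (D : AffConn n M) (N : LinConn n ξ) {η η' : Π x : M, (Fin j → Tan n x) → ξ x}
    (hη : IsSmoothTensor η) (hη' : IsSmoothTensor η') (x : M) (v : Fin (j + 1) → Tan n x) :
    dSym D N (fun x v => η x v + η' x v) x v = dSym D N η x v + dSym D N η' x v := by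
  simp only [dSym]
  rw [← smul_add, ← Finset.sum_add_distrib]
  congr 1
  refine Finset.sum_congr rfl fun i _ => ?_
  have h1 := N.isCovariantDerivativeOnUniv.add
    (hη.mdifferentiableAt_extend fun a => v (i.succAbove a))
    (hη'.mdifferentiableAt_extend fun a => v (i.succAbove a))
  have h2 := congrArg (fun L : Tan n x →L[ℝ] ξ x => L (v i)) h1
  simp only [add_apply] at h2
  have h3 : N (fun y => η y (fun a => extend (Mdl n) (v (i.succAbove a)) y) +
      η' y (fun a => extend (Mdl n) (v (i.succAbove a)) y)) x (v i) = _ := h2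
  rw [h3, Finset.sum_add_distrib]
  abel

theorem dSym_smul (D : AffConn n M) (N : LinConn n ξ) (F : SFun n M)
    {η : Π x : M, (Fin j → Tan n x) → ξ x} (hη : IsSmoothTensor η) (x : M)
    (v : Fin (j + 1) → Tan n x) :
    dSym D N (fun x v => F x • η x v) x v =
      F x • dSym D N η x v + formMul (fun x => mvfderiv (𝓡 n) F x) η x v := by
  simp only [dSym, formMul]
  rw [smul_comm (F x), ← smul_add]
  congr 1
  rw [Finset.smul_sum, ← Finset.sum_add_distrib]
  refine Finset.sum_congr rfl fun i _ => ?_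
  have h1 := N.isCovariantDerivativeOnUniv.leibniz
    (hη.mdifferentiableAt_extend fun a => v (i.succAbove a)) (sfun_mdifferentiableAt F x)
  have h2 := congrArg (fun L : Tan n x →L[ℝ] ξ x => L (v i)) h1
  simp only [add_apply, smul_apply, ContinuousLinearMap.smulRight_apply, extend_apply_self] at h2
  have h3 : N (fun y => F y • η y (fun a => extend (Mdl n) (v (i.succAbove a)) y)) x (v i) = _ := h2
  rw [h3, smul_sub, ← Finset.smul_sum]
  abel

theorem dSym_zero (D : AffConn n M) (N : LinConn n ξ) :
    dSym D N (fun (x : M) (_ : Fin j → Tan n x) => (0 : ξ x)) = fun _ _ => 0 := by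
  funext x v
  have h1 : N (fun y => (0 : ξ y)) = 0 := N.zero
  simp [dSym, h1]

theorem adT_dSym (D : AffConn n M) (N : LinConn n ξ) (F : SFun n M) {P : TensorOp n ξ j}
    (hP : ∀ s, IsSmoothTensor (P s)) :
    adT F (fun s => dSym D N (P s)) = fun s x v => dSym D N (adT F P s) x v +
      formMul (fun x => mvfderiv (𝓡 n) F x) (P s) x v := by
  funext s x v
  have h1 : P (mulOp F s) = fun x v => adT F P s x v + F x • P s x v := by
    funext x v
    simp [adT]
  have h2 : IsSmoothTensor (adT F P s) := (hP _).sub ((hP s).smul F)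
  rw [adT]
  conv_lhs => rw [h1, dSym_add D N h2 ((hP s).smul F), dSym_smul D N F (hP s)]
  abel

/-- The commutator of `d^s` with `F` is the symmetric product with `dF`, and this product commutes
with multiplication by functions. Hence `d^s` is differentiated exactly once in each of the `p`
Leibniz terms. For `p = 0` the truncated `p - 1` is harmless, as its term has coefficient `0`. -/
theorem adIter_dSym (D : AffConn n M) (N : LinConn n ξ) (F : SFun n M) (p : ℕ)
    {P : TensorOp n ξ j} (hP : ∀ s, IsSmoothTensor (P s)) :
    adIter F p (fun s => dSym D N (P s)) = fun s x v => dSym D N (adIter F p P s) x v +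
      (p : ℝ) • formMul (fun x => mvfderiv (𝓡 n) F x) (adIter F (p - 1) P s) x v := by
  induction p generalizing P with
  | zero => simp [adIter]
  | succ p ih =>
    have hP' : ∀ s, IsSmoothTensor (adT F P s) := fun s => (hP _).sub ((hP s).smul F)
    rw [adIter, adT_dSym D N F hP,
      adIter_add F p (fun s => dSym D N (adT F P s)), adIter_formMul, ih hP']
    funext s x v
    rw [add_assoc]
    congr 1
    cases p with
    | zero => simp
    | succ p =>
      simp only [Nat.add_sub_cancel]
      push_cast
      rw [add_smul ((p : ℝ) + 1) 1, one_smul]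
      rfl

variable {D : AffConn n M} {N : LinConn n ξ}

theorem isSmoothTensor_dSymPow (hD : CovariantDerivative.ContMDiffCovariantDerivative D ∞)
    (hN : CovariantDerivative.ContMDiffCovariantDerivative N ∞) (j : ℕ) (s : Sec n ξ) :
    IsSmoothTensor (dSymPow D N s j) := by
  induction j with
  | zero => exact IsSmoothTensor.of_section s
  | succ j ih => exact isSmoothTensor_dSym ih hD hN

theorem adIter_dSymPow_zero (F : SFun n M) (p : ℕ) :
    adIter F (p + 1) (fun s => dSymPow D N s 0) = fun _ _ _ => 0 := by
  rw [adIter]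
  have : adT F (fun s => dSymPow D N s 0) = fun _ _ _ => 0 := by
    funext s x v
    exact sub_self _
  rw [this, adIter_zero]

theorem adIter_dSymPow_of_lt (hD : CovariantDerivative.ContMDiffCovariantDerivative D ∞)
    (hN : CovariantDerivative.ContMDiffCovariantDerivative N ∞) (F : SFun n M) {p : ℕ}
    (h : j < p) : adIter F p (fun s => dSymPow D N s j) = fun _ _ _ => 0 := by
  induction j generalizing p with
  | zero =>
    obtain ⟨p, rfl⟩ := Nat.exists_eq_succ_of_ne_zero (by omega : p ≠ 0)
    exact adIter_dSymPow_zero F p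
  | succ j ih =>
    have h1 := adIter_dSym D N F p (isSmoothTensor_dSymPow hD hN j)
    refine h1.trans ?_
    rw [ih (by omega : j < p), ih (by omega : j < p - 1)]
    funext s x v
    rw [dSym_zero]
    simp [formMul]

/-- In the formula of `adIter_dSym` the term `d^s (ad^(j+1))` vanishes because `(d^s)^j` has order
at most `j`. Each step contributes a factor `j + 1` and one more factor `dF`. -/
theorem adIter_dSymPow_self (hD : CovariantDerivative.ContMDiffCovariantDerivative D ∞)
    (hN : CovariantDerivative.ContMDiffCovariantDerivative N ∞) (F : SFun n M) (j : ℕ)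
    (s : Sec n ξ) (x : M) (v : Fin j → Tan n x) :
    adIter F j (fun s => dSymPow D N s j) s x v =
      ((j.factorial : ℝ) * ∏ a, mvfderiv (𝓡 n) F x (v a)) • s x := by
  induction j with
  | zero => simp [adIter, dSymPow]
  | succ j ih =>
    have h1 := congrFun (congrFun (congrFun
      (adIter_dSym D N F (j + 1) (isSmoothTensor_dSymPow hD hN j)) s) x) v
    refine h1.trans ?_
    rw [adIter_dSymPow_of_lt hD hN F (Nat.lt_succ_self j), dSym_zero, zero_add,
      Nat.add_sub_cancel]
    simp only [formMul, ih]
    have h2 : ∀ i : Fin (j + 1), mvfderiv (𝓡 n) F x (v i) • ((j.factorial : ℝ) *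
        ∏ a : Fin j, mvfderiv (𝓡 n) F x (v (i.succAbove a))) • s x =
        ((j.factorial : ℝ) * ∏ a, mvfderiv (𝓡 n) F x (v a)) • s x := by
      intro i
      rw [smul_smul, Fin.prod_univ_succAbove _ i]
      congr 1
      ring
    simp only [h2]
    rw [Finset.sum_const, Finset.card_univ, Fintype.card_fin, ← Nat.cast_smul_eq_nsmul ℝ, smul_smul,
      smul_smul, smul_smul, Nat.factorial_succ]
    congr 1
    push_cast
    have : (j : ℝ) + 1 ≠ 0 := by positivity
    field_simp

variable {N' : LinConn n ξ} {a : Π x : M, Cot n x}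

theorem dSym_of_add (D : AffConn n M)
    (hNN : ∀ (s : Π x, ξ x) (x : M), MDifferentiableAt (𝓡 n) ((𝓡 n).prod 𝓘(ℝ, ℝ))
      (fun y => (⟨y, s y⟩ : TotalSpace ℝ ξ)) x → ∀ u, N' s x u = N s x u + a x u • s x)
    {η : Π x : M, (Fin j → Tan n x) → ξ x} (hη : IsSmoothTensor η) (x : M)
    (v : Fin (j + 1) → Tan n x) : dSym D N' η x v = dSym D N η x v + formMul a η x v := by
  simp only [dSym, formMul]
  rw [← smul_add, ← Finset.sum_add_distrib]
  congr 1
  refine Finset.sum_congr rfl fun i _ => ?_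
  rw [hNN _ _ (hη.mdifferentiableAt_extend fun a => v (i.succAbove a))]
  simp only [extend_apply_self]
  abel

/-- This computes, at order one below the top, the effect of the change `a` of the connection on
`(d^s)^(j+1)`. The functions are taken equal, which suffices by polarization. -/
theorem adIter_dSymPow_of_add (hD : CovariantDerivative.ContMDiffCovariantDerivative D ∞)
    (hN : CovariantDerivative.ContMDiffCovariantDerivative N ∞)
    (hN' : CovariantDerivative.ContMDiffCovariantDerivative N' ∞)
    (hNN : ∀ (s : Π x, ξ x) (x : M), MDifferentiableAt (𝓡 n) ((𝓡 n).prod 𝓘(ℝ, ℝ))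
      (fun y => (⟨y, s y⟩ : TotalSpace ℝ ξ)) x → ∀ u, N' s x u = N s x u + a x u • s x)
    (F : SFun n M) (j : ℕ) (s : Sec n ξ) (x : M) (v : Fin (j + 1) → Tan n x) :
    adIter F j (fun s => dSymPow D N' s (j + 1)) s x v =
      adIter F j (fun s => dSymPow D N s (j + 1)) s x v +
        ((j.factorial : ℝ) * symProd (a x) (mvfderiv (𝓡 n) F x) v) • s x := by
  induction j with
  | zero =>
    have h1 := dSym_of_add D hNN (IsSmoothTensor.of_section s) x v
    refine h1.trans ?_
    congr 1
    simp [formMul, symProd]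
  | succ j ih =>
    have h1 := congrFun (congrFun (congrFun
      (adIter_dSym D N' F (j + 1) (isSmoothTensor_dSymPow hD hN' (j + 1))) s) x) v
    have h2 := congrFun (congrFun (congrFun
      (adIter_dSym D N F (j + 1) (isSmoothTensor_dSymPow hD hN (j + 1))) s) x) v
    refine h1.trans ?_
    refine Eq.trans ?_ (congrArg (· + (((j + 1).factorial : ℝ) *
      symProd (a x) (mvfderiv (𝓡 n) F x) v) • s x) h2).symm
    have h3 : adIter F (j + 1) (fun s => dSymPow D N' s (j + 1)) s =
        adIter F (j + 1) (fun s => dSymPow D N s (j + 1)) s := by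
      funext x v
      rw [adIter_dSymPow_self hD hN' F, adIter_dSymPow_self hD hN F]
    rw [h3, dSym_of_add D hNN (isSmoothTensor_adIter F (j + 1)
      (isSmoothTensor_dSymPow hD hN (j + 1)) s), Nat.add_sub_cancel]
    -- The change has two sources: `dF` times the inductive change (`h4`) and `a` times the leading
    -- part `dF^(j+1)` (`h5`). Here `1 / (j + 2)` normalizes the product of a 1-form and a `(j +
    -- 1)`-form, and the weights `(j + 1)²` and `j + 1` add up to `(j + 1) (j + 2)` in `h6`, leaving
    -- `(j + 1)!`.
    have h4 : formMul (fun x => mvfderiv (𝓡 n) F x)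
        (adIter F j (fun s => dSymPow D N' s (j + 1)) s) x v =
        formMul (fun x => mvfderiv (𝓡 n) F x)
          (adIter F j (fun s => dSymPow D N s (j + 1)) s) x v +
        ((1 / ((j : ℝ) + 2)) * ((j.factorial : ℝ) * (((j : ℝ) + 1) *
          symProd (a x) (mvfderiv (𝓡 n) F x) v))) • s x := by
      have e1 : ((j : ℝ) + 1) * symProd (a x) (mvfderiv (𝓡 n) F x) v =
          ∑ i, mvfderiv (𝓡 n) F x (v i) *
            symProd (a x) (mvfderiv (𝓡 n) F x) (fun b => v (i.succAbove b)) := by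
        rw [sum_mul_symProd]
        push_cast
        ring
      rw [e1]
      simp only [formMul, ih, smul_add, Finset.sum_add_distrib]
      congr 1
      rw [Finset.mul_sum, mul_smul, Finset.sum_smul]
      congr 1
      · push_cast
        ring
      · refine Finset.sum_congr rfl fun i _ => ?_
        rw [smul_smul]
        congr 1
        ring
    have h5 : formMul a (adIter F (j + 1) (fun s => dSymPow D N s (j + 1)) s) x v =
        ((1 / ((j : ℝ) + 2)) * (((j + 1).factorial : ℝ) *
          symProd (a x) (mvfderiv (𝓡 n) F x) v)) • s x := by
      simp only [formMul, adIter_dSymPow_self hD hN F]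
      rw [symProd_eq, Finset.mul_sum, mul_smul, Finset.sum_smul]
      congr 1
      · push_cast
        ring
      · refine Finset.sum_congr rfl fun i _ => ?_
        rw [smul_smul]
        congr 1
        ring
    rw [h4, h5, smul_add]
    have h6 : ((j + 1 : ℕ) : ℝ) • ((1 / ((j : ℝ) + 2)) * ((j.factorial : ℝ) * (((j : ℝ) + 1) *
          symProd (a x) (mvfderiv (𝓡 n) F x) v))) • s x + ((1 / ((j : ℝ) + 2)) *
          (((j + 1).factorial : ℝ) * symProd (a x) (mvfderiv (𝓡 n) F x) v)) • s x =
        (((j + 1).factorial : ℝ) * symProd (a x) (mvfderiv (𝓡 n) F x) v) • s x := by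
      rw [smul_smul, ← add_smul, Nat.factorial_succ]
      congr 1
      push_cast
      have : (j : ℝ) + 2 ≠ 0 := by positivity
      field_simp
      ring
    rw [← h6]
    abel

end Commutators

/-! ### Symbols of quantizations and the behaviour of the subsymbol. -/

section Quantization

open Topology Filter

variable {n : ℕ} {M : Type*} [TopologicalSpace M] [ChartedSpace (EuclideanSpace ℝ (Fin n)) M]
  [IsManifold (𝓡 n) ∞ M] [T2Space M]
  {ξ : M → Type*} [TopologicalSpace (TotalSpace ℝ ξ)]
  [∀ x, AddCommGroup (ξ x)] [∀ x, Module ℝ (ξ x)] [∀ x, TopologicalSpace (ξ x)]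
  [FiberBundle ℝ ξ] [VectorBundle ℝ ℝ ξ] [ContMDiffVectorBundle ∞ ℝ ξ (𝓡 n)]

/-- Subtraction of the value at a point. -/
def centeredₗ (x : M) : SFun n M →ₗ[ℝ] SFun n M where
  toFun f := centered f x
  map_add' f g := by
    ext y
    change f y + g y - (f x + g x) = f y - f x + (g y - g x)
    ring
  map_smul' c f := by
    ext y
    change c * f y - c * f x = c * (f y - f x)
    ring

/-- A symbol is determined by the iterated commutators with a single function. -/
theorem isSymbolAt_of_diagonal {k : ℕ} {x : M} {B : Sec n ξ → Π x, ξ x} (β : Sec n ξ →ₗ[ℝ] ξ x)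
    (hβ : ∀ s, B s x = β s) {τ : Contra n k x} (hτ : τ ∈ symPow k x)
    (h : ∀ (F : SFun n M) (s : Sec n ξ), iterComm B (fun _ : Fin k => F) s x =
      ((k.factorial : ℝ) * τ (fun _ => mvfderiv (𝓡 n) F x)) • s x) : IsSymbolAt B k x τ := by
  refine ⟨hτ, fun f s => ?_⟩
  -- Both sides of the symbol identity are symmetric multilinear in the functions, so polarization
  -- reduces the identity to equal functions.
  let P : MultilinearMap ℝ (fun _ : Fin k => SFun n M) (ξ x) :=
    (β ∘ₗ mulOpₗ s).compMultilinearMap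
      ((MultilinearMap.mkPiAlgebra ℝ (Fin k) (SFun n M)).compLinearMap fun _ => centeredₗ x)
  let Q : MultilinearMap ℝ (fun _ : Fin k => SFun n M) (ξ x) :=
    ((k.factorial : ℝ) • τ.compLinearMap fun _ => mvfderivₗ x).smulRight (s x)
  have hP : ∀ f, P f = iterComm B f s x := fun f => by
    rw [iterComm_eq_apply_mulOp B β hβ]
    rfl
  have hQ : ∀ f, Q f = ((k.factorial : ℝ) * τ (fun i => mvfderiv (𝓡 n) (f i) x)) • s x :=
    fun f => rfl
  have h1 : P - Q = 0 := by
    refine eq_zero_of_diagonal_eq_zero _ (fun e v => ?_) fun F => ?_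
    · rw [sub_apply, sub_apply]
      congr 1
      · change β (mulOp (∏ i, centered (v (e i)) x) s) = β (mulOp (∏ i, centered (v i) x) s)
        rw [Equiv.prod_comp e (fun i => centered (v i) x)]
      · rw [hQ, hQ, symPow_apply_perm hτ e (fun i => mvfderiv (𝓡 n) (v i) x)]
    · rw [sub_apply, hP, hQ, h, sub_self]
  rw [← hP, ← hQ, sub_eq_zero.1 h1]

variable [∀ x, IsTopologicalAddGroup (ξ x)] [∀ x, ContinuousSMul ℝ (ξ x)]
  {D : AffConn n M} {N N' : LinConn n ξ}

theorem dSymPow_add (hD : CovariantDerivative.ContMDiffCovariantDerivative D ∞)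
    (hN : CovariantDerivative.ContMDiffCovariantDerivative N ∞) (s t : Sec n ξ) (j : ℕ) :
    dSymPow D N (s + t) j = fun x v => dSymPow D N s j x v + dSymPow D N t j x v := by
  induction j with
  | zero => rfl
  | succ j ih =>
    funext x v
    rw [dSymPow, ih]
    exact dSym_add D N (isSmoothTensor_dSymPow hD hN j s) (isSmoothTensor_dSymPow hD hN j t) x v

theorem dSymPow_smul (hD : CovariantDerivative.ContMDiffCovariantDerivative D ∞)
    (hN : CovariantDerivative.ContMDiffCovariantDerivative N ∞) (c : ℝ) (s : Sec n ξ) (j : ℕ) :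
    dSymPow D N (c • s) j = fun x v => c • dSymPow D N s j x v := by
  induction j with
  | zero => rfl
  | succ j ih =>
    funext x v
    rw [dSymPow, ih]
    have h1 := dSym_smul D N (algebraMap ℝ (SFun n M) c) (isSmoothTensor_dSymPow hD hN j s) x v
    have h2 : mvfderiv (𝓡 n) (algebraMap ℝ (SFun n M) c) = fun x : M => 0 := by
      funext y
      exact mvfderiv_const (I := 𝓡 n) c
    rw [h2] at h1
    refine h1.trans ?_
    simp only [formMul, zero_apply, zero_smul, Finset.sum_const_zero, smul_zero, add_zero]
    rfl

/-- The value of a quantization at a point. -/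
def quantizeAt (hD : CovariantDerivative.ContMDiffCovariantDerivative D ∞)
    (hN : CovariantDerivative.ContMDiffCovariantDerivative N ∞) {k : ℕ}
    (σ : Π x : M, Contra n k x) (x : M) : Sec n ξ →ₗ[ℝ] ξ x where
  toFun s := quantize D N σ s x
  map_add' s t := by rw [quantize, dSymPow_add hD hN, contract_add]; rfl
  map_smul' c s := by rw [quantize, dSymPow_smul hD hN, contract_smul]; rfl

theorem isSymbolAt_quantize (hD : CovariantDerivative.ContMDiffCovariantDerivative D ∞)
    (hN : CovariantDerivative.ContMDiffCovariantDerivative N ∞) {k : ℕ}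
    (σ : Π x : M, Contra n k x) {x : M} (hσ : σ x ∈ symPow k x) :
    IsSymbolAt (quantize D N σ) k x (σ x) := by
  refine isSymbolAt_of_diagonal (quantizeAt hD hN σ x) (fun s => rfl) hσ fun F s => ?_
  refine (iterComm_contract σ (fun s => dSymPow D N s k) F s x).trans ?_
  have h1 : adIter F k (fun s => dSymPow D N s k) s x = fun v =>
      (k.factorial : ℝ) • ((∏ a, mvfderiv (𝓡 n) F x (v a)) • s x) := by
    funext v
    rw [adIter_dSymPow_self hD hN, mul_smul]
  rw [h1, contract_smul, contract_prod_smul, mul_smul]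

/-- `A` and the quantization have the same symbol in degree `m + 1`, so the `(m + 1)`-fold
commutators of the difference vanish and a symbol of degree `m` exists. This keeps `smbl` away from
its default value. -/
theorem isSymbolAt_subsymbol {m : ℕ} {A : Sec n ξ →ₗ[ℝ] Sec n ξ} (hA : IsDiffOp (m + 1) A)
    (hD : CovariantDerivative.ContMDiffCovariantDerivative D ∞)
    (hN : CovariantDerivative.ContMDiffCovariantDerivative N ∞) (x : M) :
    IsSymbolAt (fun s x => A s x - quantize D N (principal m A) s x) m x (subsymbol m A D N x) := by
  obtain ⟨τ, hτ⟩ := exists_isSymbolAt (k := m) (x := x)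
    (fun s x => A s x - quantize D N (principal m A) s x)
    (valueAt A x - quantizeAt hD hN (principal m A) x) (fun s => rfl) (fun f s => by
      have h1 := isSymbolAt_principal hA x
      have h2 := isSymbolAt_quantize hD hN (principal m A) h1.1
      rw [iterComm_sub, h1.2, h2.2, sub_self])
  exact smbl_isSymbolAt hτ

/-- The change of the subsymbol when the connection in the line bundle changes. -/
theorem subsymbol_of_add {m : ℕ} {A : Sec n ξ →ₗ[ℝ] Sec n ξ} (hA : IsDiffOp (m + 1) A)
    (hD : CovariantDerivative.ContMDiffCovariantDerivative D ∞)
    (hN : CovariantDerivative.ContMDiffCovariantDerivative N ∞)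
    (hN' : CovariantDerivative.ContMDiffCovariantDerivative N' ∞) {a : Π x : M, Cot n x}
    (hNN : ∀ (s : Π x, ξ x) (x : M), MDifferentiableAt (𝓡 n) ((𝓡 n).prod 𝓘(ℝ, ℝ))
      (fun y => (⟨y, s y⟩ : TotalSpace ℝ ξ)) x → ∀ u, N' s x u = N s x u + a x u • s x)
    (x : M) :
    subsymbol m A D N' x = subsymbol m A D N x -
      ((m : ℝ) + 1) • (principal m A x).curryLeft (a x) := by
  have hσ := (isSymbolAt_principal hA x).1
  -- The factor `m!` of the commutators is the one in the definition of a symbol. The factor `m + 1`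
  -- counts the slots of `σ` into which `a` can be inserted.
  have h1 : IsSymbolAt (fun s x => quantize D N' (principal m A) s x -
      quantize D N (principal m A) s x) m x (((m : ℝ) + 1) • (principal m A x).curryLeft (a x)) := by
    refine isSymbolAt_of_diagonal
      (quantizeAt hD hN' (principal m A) x - quantizeAt hD hN (principal m A) x) (fun s => rfl)
      (Submodule.smul_mem _ _ (curryLeft_mem_symPow hσ (a x))) fun F s => ?_
    rw [iterComm_sub]
    have h2 := iterComm_contract (k := m) (principal m A) (fun s => dSymPow D N s (m + 1)) F s x
    have h3 := iterComm_contract (k := m) (principal m A) (fun s => dSymPow D N' s (m + 1)) F s x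
    refine (congrArg₂ (· - ·) h3 h2).trans ?_
    have h4 : adIter F m (fun s => dSymPow D N' s (m + 1)) s x = fun v =>
        adIter F m (fun s => dSymPow D N s (m + 1)) s x v +
          (m.factorial : ℝ) • (symProd (a x) (mvfderiv (𝓡 n) F x) v • s x) := by
      funext v
      rw [adIter_dSymPow_of_add hD hN hN' hNN, mul_smul]
    rw [h4, contract_add, contract_smul, contract_symProd_smul hσ]
    simp only [add_sub_cancel_left]
    rw [smul_smul]
    rfl
  have h5 := (isSymbolAt_subsymbol hA hD hN x).sub h1
  have h6 : (fun (s : Sec n ξ) x => A s x - quantize D N (principal m A) s x -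
      (quantize D N' (principal m A) s x - quantize D N (principal m A) s x)) =
      fun s x => A s x - quantize D N' (principal m A) s x := by
    funext s x
    abel
  rw [h6] at h5
  exact h5.smbl_eq

/-- `dSym` uses the affine connection only on fields of the form `extend`. Agreement there is
enough, whatever the two connections do on sections that are not differentiable. -/
theorem subsymbol_congr_aff {m : ℕ} (A : Sec n ξ →ₗ[ℝ] Sec n ξ) {D' : AffConn n M}
    (h : ∀ (x : M) (v : Tan n x), D (extend (Mdl n) v) x = D' (extend (Mdl n) v) x)
    (N : LinConn n ξ) : subsymbol m A D N = subsymbol m A D' N := by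
  have h1 : ∀ j (s : Sec n ξ), dSymPow D N s j = dSymPow D' N s j := by
    intro j s
    induction j with
    | zero => rfl
    | succ j ih =>
      rw [dSymPow, dSymPow, ih]
      funext x v
      simp only [dSym, h]
  simp only [subsymbol]
  unfold quantize
  simp only [h1]

theorem isDiffOp_mulOp_comp {k : ℕ} {A : Sec n ξ →ₗ[ℝ] Sec n ξ} (hA : IsDiffOp k A) (f : SFun n M) :
    IsDiffOp k (mulOp f ∘ₗ A) := by
  intro g s x
  refine (iterComm_smul f (fun s x => A s x) g s x).trans ?_
  rw [hA, smul_zero]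

theorem principal_mulOp_comp {m : ℕ} {A : Sec n ξ →ₗ[ℝ] Sec n ξ} (hA : IsDiffOp (m + 1) A)
    (f : SFun n M) (x : M) : principal m (mulOp f ∘ₗ A) x = f x • principal m A x :=
  ((isSymbolAt_principal hA x).smul f).smbl_eq

theorem quantize_smul {k : ℕ} (f : M → ℝ) (σ : Π x : M, Contra n k x) (s : Sec n ξ) (x : M) :
    quantize D N (fun x => f x • σ x) s x = f x • quantize D N σ s x := by
  simp only [quantize, contract, Finset.smul_sum, smul_apply, smul_assoc]

theorem subsymbol_mulOp_comp {m : ℕ} {A : Sec n ξ →ₗ[ℝ] Sec n ξ} (hA : IsDiffOp (m + 1) A)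
    (hD : CovariantDerivative.ContMDiffCovariantDerivative D ∞)
    (hN : CovariantDerivative.ContMDiffCovariantDerivative N ∞) (f : SFun n M) (x : M) :
    subsymbol m (mulOp f ∘ₗ A) D N x = f x • subsymbol m A D N x := by
  have h1 := (isSymbolAt_subsymbol hA hD hN x).smul f
  have h2 : (fun (s : Sec n ξ) x => f x • (A s x - quantize D N (principal m A) s x)) =
      fun s x => (mulOp f ∘ₗ A) s x - quantize D N (principal m (mulOp f ∘ₗ A)) s x := by
    funext s x
    rw [show principal m (mulOp f ∘ₗ A) = fun x => f x • principal m A x from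
      funext (principal_mulOp_comp hA f), quantize_smul, smul_sub]
    rfl
  rw [h2] at h1
  exact h1.smbl_eq

end Quantization

/-! ### Smoothness of the symbol. -/

section SmoothSymbol

open Topology Filter

variable {n : ℕ} {M : Type*} [TopologicalSpace M] [ChartedSpace (EuclideanSpace ℝ (Fin n)) M]
  [IsManifold (𝓡 n) ∞ M] [T2Space M]
  {ξ : M → Type*} [TopologicalSpace (TotalSpace ℝ ξ)]
  [∀ x, AddCommGroup (ξ x)] [∀ x, Module ℝ (ξ x)] [∀ x, TopologicalSpace (ξ x)]
  [FiberBundle ℝ ξ] [VectorBundle ℝ ℝ ξ] [ContMDiffVectorBundle ∞ ℝ ξ (𝓡 n)]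

theorem exists_sec_eq_iterComm {k : ℕ} (A : Sec n ξ →ₗ[ℝ] Sec n ξ) (f : Fin k → SFun n M)
    (s : Sec n ξ) : ∃ t : Sec n ξ, ∀ x, iterComm (fun s x => A s x) f s x = t x := by
  induction k generalizing A with
  | zero => exact ⟨A s, fun x => rfl⟩
  | succ k ih => exact ih (A ∘ₗ mulOp (f 0) - mulOp (f 0) ∘ₗ A) (Fin.tail f)

/-- A field of contravariant tensors is smooth if its values on differentials of functions are smooth. -/
def IsSmoothContra {k : ℕ} (σ : Π x : M, Contra n k x) : Prop :=
  ∀ f : Fin k → SFun n M, ContMDiff (𝓡 n) 𝓘(ℝ, ℝ) ∞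
    (fun y => σ y (fun i => mvfderiv (𝓡 n) (f i) y))

theorem isSmoothContra_of_isSymbolAt {k : ℕ} {A : Sec n ξ →ₗ[ℝ] Sec n ξ} {τ : Π x : M, Contra n k x}
    (h : ∀ x, IsSymbolAt (fun s x => A s x) k x (τ x)) : IsSmoothContra τ := by
  intro f x₀
  obtain ⟨s₀, hs₀⟩ := exists_section_ne_zero (n := n) (ξ := ξ) x₀
  obtain ⟨t, ht⟩ := exists_sec_eq_iterComm A f s₀
  have h1 : ∀ y, t y = ((k.factorial : ℝ) *
      τ y (fun i => mvfderiv (𝓡 n) (f i) y)) • s₀ y := fun y =>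
    (ht y).symm.trans ((h y).2 f s₀)
  have h2 := contMDiffAt_coeff t.contMDiff.contMDiffAt s₀.contMDiff.contMDiffAt hs₀
    (Eventually.of_forall h1)
  have h3 := (contMDiffAt_const (c := ((k.factorial : ℝ))⁻¹)).mul h2
  refine h3.congr_of_eventuallyEq (Eventually.of_forall fun y => ?_)
  have hfac : (k.factorial : ℝ) ≠ 0 := by exact_mod_cast k.factorial_ne_zero
  exact (inv_mul_cancel_left₀ hfac _).symm

theorem isSmoothContra_principal {m : ℕ} {A : Sec n ξ →ₗ[ℝ] Sec n ξ} (hA : IsDiffOp (m + 1) A) :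
    IsSmoothContra (principal m A) :=
  isSmoothContra_of_isSymbolAt (isSymbolAt_principal hA)

end SmoothSymbol

/-! ### Symbols of constant type expressed in frames. -/

section Orbits

open Topology Filter

variable {n k : ℕ}

/-- The multilinear form on `ℝⁿ` with given coefficients. -/
def frameTensor (c : (Fin k → Fin n) → ℝ) : (Fin n → ℝ) [×k]→L[ℝ] ℝ :=
  ∑ J : Fin k → Fin n, c J • (ContinuousMultilinearMap.mkPiAlgebra ℝ (Fin k) ℝ).compContinuousLinearMap
    (fun a => (ContinuousLinearMap.proj (J a) : (Fin n → ℝ) →L[ℝ] ℝ))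

theorem frameTensor_apply (c : (Fin k → Fin n) → ℝ) (w : Fin k → Fin n → ℝ) :
    frameTensor c w = ∑ J : Fin k → Fin n, c J * ∏ a, w a (J a) := by
  simp [frameTensor]

theorem hasDerivAt_frameTensor {c : (Fin k → Fin n) → ℝ → ℝ} {c' : (Fin k → Fin n) → ℝ} {t : ℝ}
    (h : ∀ J, HasDerivAt (c J) (c' J) t) :
    HasDerivAt (fun t => frameTensor fun J => c J t) (frameTensor c') t := by
  refine HasDerivAt.fun_sum (A := fun J t => c J t • _) fun J _ => ?_
  exact HasDerivAt.smul_const (F := (Fin n → ℝ) [×k]→L[ℝ] ℝ) (h J) _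

theorem contDiffAt_frameTensor {c : (Fin k → Fin n) → ℝ → ℝ} {t : ℝ} {r : WithTop ℕ∞}
    (h : ∀ J, ContDiffAt ℝ r (c J) t) : ContDiffAt ℝ r (fun t => frameTensor fun J => c J t) t :=
  ContDiffAt.sum fun J _ => (h J).smul contDiffAt_const

variable {M : Type*} [TopologicalSpace M] [ChartedSpace (EuclideanSpace ℝ (Fin n)) M]

theorem frameTensor_contra {x : M} (τ : Contra n k x) (θ : Fin n → Cot n x)
    (w : Fin k → Fin n → ℝ) : frameTensor (fun J => τ (fun a => θ (J a))) w =
      τ (fun a => Fintype.linearCombination ℝ θ (w a)) := by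
  rw [frameTensor_apply]
  simp only [Fintype.linearCombination_apply]
  rw [τ.map_sum]
  refine Finset.sum_congr rfl fun J _ => ?_
  rw [τ.map_smul_univ, smul_eq_mul, mul_comm]

/-- The isomorphism with `ℝⁿ` given by a dual pair of bases. -/
def frameEquiv {x : M} {θ : Fin n → Cot n x} {e : Fin n → Tan n x}
    (h : ∀ i j, θ i (e j) = if i = j then 1 else 0) : Tan n x ≃L[ℝ] (Fin n → ℝ) :=
  LinearEquiv.toContinuousLinearEquiv
    { toFun := fun v i => θ i v
      map_add' := fun u v => by funext i; exact map_add _ _ _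
      map_smul' := fun c v => by funext i; exact map_smul _ _ _
      invFun := fun w => ∑ i, w i • e i
      left_inv := fun v => (eq_sum_smul_of_dual h v).symm
      right_inv := fun w => by funext i; simp [h] }

/-- Constant type compares homogeneous polynomials; polarization lifts this to symmetric tensors.
The model tensor `f₀`, whose polynomial is `h`, is the tensor of `σ` at `x₀` with the transformation
`g₀` undone. -/
theorem exists_orbit_tensor [IsManifold (𝓡 n) ∞ M] (hk : 0 < k) {σ : Π x : M, Contra n k x}
    (hσ : IsRegularConstantType σ) (hsym : ∀ x, σ x ∈ symPow k x) (x₀ : M) :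
    ∃ f₀ : (Fin n → ℝ) [×k]→L[ℝ] ℝ, (∀ a, infAct f₀ a = 0 → a = 0) ∧
      ∀ (y : M) (θ : Fin n → Cot n y) (e : Fin n → Tan n y),
        (∀ i j, θ i (e j) = if i = j then 1 else 0) →
        ∃ g g' : (Fin n → ℝ) →L[ℝ] (Fin n → ℝ), (∀ w, g' (g w) = w) ∧ (∀ w, g (g' w) = w) ∧
          frameTensor (fun J => σ y (fun a => θ (J a))) = substTensor g f₀ := by
  obtain ⟨h, hh, horb⟩ := hσ
  have hdiag : ∀ (y : M) (θ : Fin n → Cot n y) (e : Fin n → Tan n y),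
      (∀ i j, θ i (e j) = if i = j then 1 else 0) →
      ∃ g g' : (Fin n → ℝ) →L[ℝ] (Fin n → ℝ), (∀ w, g' (g w) = w) ∧ (∀ w, g (g' w) = w) ∧
        ∀ w, frameTensor (fun J => σ y (fun a => θ (J a))) (fun _ => w) = eval (g w) h := by
    intro y θ e he
    obtain ⟨g, hg⟩ := horb y (frameEquiv he)
    refine ⟨LinearMap.toContinuousLinearMap (Matrix.toLin' g.1),
      LinearMap.toContinuousLinearMap (Matrix.toLin' g⁻¹.1), fun w => ?_, fun w => ?_, fun w => ?_⟩
    · simp [Matrix.mulVec_mulVec]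
    · simp [Matrix.mulVec_mulVec]
    · rw [frameTensor_contra, LinearMap.coe_toContinuousLinearMap', Matrix.toLin'_apply,
        ← eval_substForm, ← hg w]
      rfl
  have hperm : ∀ (y : M) (θ : Fin n → Cot n y) (e : Equiv.Perm (Fin k)) (v : Fin k → Fin n → ℝ),
      frameTensor (fun J => σ y (fun a => θ (J a))) (fun i => v (e i)) =
        frameTensor (fun J => σ y (fun a => θ (J a))) v := by
    intro y θ e v
    rw [frameTensor_contra, frameTensor_contra,
      ← symPow_apply_perm (hsym y) e (fun a => Fintype.linearCombination ℝ θ (v a))]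
  obtain ⟨g₀, g₀', h1, h2, h3⟩ := hdiag x₀ (tcoord x₀) (tbasis x₀) (tcoord_tbasis x₀)
  refine ⟨substTensor g₀' (frameTensor fun J => σ x₀ (fun a => tcoord x₀ (J a))), ?_, ?_⟩
  · refine infAct_eq_zero_of_isRegularForm hk h hh _ fun w => ?_
    rw [substTensor_apply, h3, h2]
  · intro y θ e he
    obtain ⟨g, g', h1', h2', h3'⟩ := hdiag y θ e he
    refine ⟨g, g', h1', h2', ?_⟩
    have h4 := eq_zero_of_diagonal_eq_zero
      ((frameTensor (fun J => σ y (fun a => θ (J a)))).toMultilinearMap -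
        (substTensor g (substTensor g₀'
          (frameTensor fun J => σ x₀ (fun a => tcoord x₀ (J a))))).toMultilinearMap)
      (fun e v => congrArg₂ (· - ·) (hperm y θ e v)
        (hperm x₀ (tcoord x₀) e (fun i => g₀' (g (v i)))))
      (fun w => by
        change frameTensor (fun J => σ y (fun a => θ (J a))) (fun _ => w) -
          frameTensor (fun J => σ x₀ (fun a => tcoord x₀ (J a))) (fun _ => g₀' (g w)) = 0
        rw [h3', h3, h2, sub_self])
    ext v
    exact sub_eq_zero.1 (congrArg (fun f : MultilinearMap ℝ (fun _ : Fin k => Fin n → ℝ) ℝ => f v) h4)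

theorem linearCombination_update {x : M} (θ : Fin n → Cot n x) (v : Fin k → Fin n → ℝ) (i : Fin k)
    (u : Fin n → ℝ) : (fun b => Fintype.linearCombination ℝ θ (Function.update v i u b)) =
      Function.update (fun b => Fintype.linearCombination ℝ θ (v b)) i
        (Fintype.linearCombination ℝ θ u) := by
  funext b
  by_cases hb : b = i
  · subst hb; simp
  · simp [Function.update_of_ne hb]

/-- The symbol of constant regular type has a trivial infinitesimal stabilizer. -/
theorem eq_zero_of_sum_update_eq_zero [IsManifold (𝓡 n) ∞ M] (hk : 0 < k)
    {σ : Π x : M, Contra n k x} (hσ : IsRegularConstantType σ) (hsym : ∀ x, σ x ∈ symPow k x)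
    {x : M} (B : Cot n x →ₗ[ℝ] Cot n x)
    (hB : ∀ θ : Fin k → Cot n x, ∑ i, σ x (Function.update θ i (B (θ i))) = 0) : B = 0 := by
  obtain ⟨f₀, hf₀, horb⟩ := exists_orbit_tensor hk hσ hsym x
  obtain ⟨g, g', h1, h2, h3⟩ := horb x (tcoord x) (tbasis x) (tcoord_tbasis x)
  let T := Fintype.linearCombination ℝ (tcoord (n := n) x)
  -- `a` is `B` written in the coordinate coframe. The hypothesis on `B` becomes `infAct _ a = 0`
  -- for the coordinate tensor, which lies in the orbit of `f₀`.
  let a : (Fin n → ℝ) →L[ℝ] (Fin n → ℝ) := LinearMap.toContinuousLinearMap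
    { toFun := fun w l => B (T w) (tbasis x l)
      map_add' := fun v w => by funext l; simp
      map_smul' := fun c w => by funext l; simp }
  have hT : ∀ φ : Cot n x, T (fun i => φ (tbasis x i)) = φ := fun φ => by
    rw [cot_eq_sum_smul_of_dual (tcoord_tbasis x) φ]
    simp [T, Fintype.linearCombination_apply, tcoord_tbasis]
  have ha : ∀ w, T (a w) = B (T w) := fun w => hT (B (T w))
  have h4 : a = 0 := by
    refine infAct_injective_of_substTensor f₀ g g' h1 h2 hf₀ a ?_
    rw [← h3]
    ext v
    rw [infAct_apply]
    simp only [frameTensor_contra, linearCombination_update]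
    change ∑ i, σ x (Function.update (fun b => T (v b)) i (T (a (v i)))) = 0
    simp only [ha]
    exact hB (fun b => T (v b))
  refine LinearMap.ext fun φ => ?_
  rw [← hT φ, ← ha, h4]
  simp

end Orbits

/-! ### The derivative of the symbol is tangent to its orbit. -/

section Curves

open Topology Filter

variable {n k : ℕ} {M : Type*} [TopologicalSpace M] [ChartedSpace (EuclideanSpace ℝ (Fin n)) M]
  [IsManifold (𝓡 n) ∞ M]

theorem exists_curve (x : M) (v : Tan n x) :
    ∃ γ : ℝ → M, γ 0 = x ∧ (∀ᶠ t in 𝓝 0, ContMDiffAt 𝓘(ℝ, ℝ) (𝓡 n) ∞ γ t) ∧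
      ∀ f : M → ℝ, MDifferentiableAt (𝓡 n) 𝓘(ℝ, ℝ) f x →
        HasDerivAt (fun t => f (γ t)) (mvfderiv (𝓡 n) f x v) 0 := by
  let φ := extChartAt (𝓡 n) x
  let u : Mdl n := mfderiv (𝓡 n) 𝓘(ℝ, Mdl n) φ x v
  have hl : ContDiff ℝ ∞ (fun t : ℝ => φ x + t • u) := by fun_prop
  have h0 : φ x + (0 : ℝ) • u = φ x := by simp
  have hs : ContMDiffAt 𝓘(ℝ, Mdl n) (𝓡 n) ∞ φ.symm (φ x) :=
    (contMDiffOn_extChartAt_symm x).contMDiffAt (extChartAt_target_mem_nhds x)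
  have hγ : ContMDiffAt 𝓘(ℝ, ℝ) (𝓡 n) ∞ (fun t : ℝ => φ.symm (φ x + t • u)) 0 :=
    ContMDiffAt.comp (0 : ℝ) (by rw [h0]; exact hs) hl.contMDiff.contMDiffAt
  refine ⟨fun t => φ.symm (φ x + t • u), ?_, ?_, fun f hf => ?_⟩
  · simp only [h0]
    exact extChartAt_to_inv x
  · have h1 : ∀ᶠ t : ℝ in 𝓝 0, φ x + t • u ∈ φ.target := by
      refine hl.continuous.continuousAt.eventually_mem ?_
      rw [h0]
      exact extChartAt_target_mem_nhds x
    filter_upwards [eventually_eventually_nhds.2 h1] with t ht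
    have h2 : ContMDiffAt 𝓘(ℝ, Mdl n) (𝓡 n) ∞ φ.symm (φ x + t • u) :=
      (contMDiffOn_extChartAt_symm x).contMDiffAt
        ((isOpen_extChartAt_target x).mem_nhds ht.self_of_nhds)
    exact ContMDiffAt.comp t h2 hl.contMDiff.contMDiffAt
  · have hx : φ.symm (φ x) = x := extChartAt_to_inv x
    have h1 : MDifferentiableAt 𝓘(ℝ, Mdl n) 𝓘(ℝ, ℝ) (f ∘ φ.symm) (φ x) :=
      MDifferentiableAt.comp (φ x) (by rw [hx]; exact hf) (hs.mdifferentiableAt (by simp))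
    have h2 := mdifferentiableAt_iff_differentiableAt.1 h1
    have h3 : HasDerivAt (fun t : ℝ => φ x + t • u) u 0 := by
      simpa using ((hasDerivAt_id (0 : ℝ)).smul_const u).const_add (φ x)
    have h4 := HasFDerivAt.comp_hasDerivAt_of_eq (0 : ℝ) h2.hasFDerivAt h3 h0.symm
    have h5 : f =ᶠ[𝓝 x] (f ∘ φ.symm) ∘ φ := by
      filter_upwards [extChartAt_source_mem_nhds (I := 𝓡 n) x] with y hy
      exact congrArg f (φ.left_inv hy).symm
    have h6 : mfderiv (𝓡 n) 𝓘(ℝ, ℝ) f x v = fderiv ℝ (f ∘ φ.symm) (φ x) u := by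
      rw [h5.mfderiv_eq, mfderiv_comp x h1 (mdifferentiableAt_extChartAt (mem_chart_source _ x)),
        mfderiv_eq_fderiv]
      rfl
    refine HasDerivAt.congr_deriv h4 h6.symm

/-- The derivative of the symbol is the infinitesimal action of an endomorphism of the cotangent
space. -/
theorem exists_mvfderiv_eq_sum_update [T2Space M] (hk : 0 < k) {σ : Π x : M, Contra n k x}
    (hσ : IsRegularConstantType σ) (hsym : ∀ x, σ x ∈ symPow k x) (hsm : IsSmoothContra σ) {x : M}
    {z : Fin n → SFun n M} {E : Fin n → VField n M}
    (hzE : ∀ᶠ y in 𝓝 x, ∀ i j, mvfderiv (𝓡 n) (z i) y (E j y) = if i = j then 1 else 0)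
    (v : Tan n x) : ∃ B : Cot n x →ₗ[ℝ] Cot n x, ∀ J : Fin k → Fin n,
      mvfderiv (𝓡 n) (fun y => σ y (fun p => mvfderiv (𝓡 n) (z (J p)) y)) x v =
        ∑ i, σ x (Function.update (fun p => mvfderiv (𝓡 n) (z (J p)) x) i
          (B (mvfderiv (𝓡 n) (z (J i)) x))) := by
  obtain ⟨γ, hγ0, hγ, hγd⟩ := exists_curve x v
  obtain ⟨f₀, hf₀, horb⟩ := exists_orbit_tensor hk hσ hsym x
  let c : (Fin k → Fin n) → M → ℝ := fun J y => σ y (fun p => mvfderiv (𝓡 n) (z (J p)) y)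
  have hc : ∀ J, ContMDiff (𝓡 n) 𝓘(ℝ, ℝ) ∞ (c J) := fun J => hsm fun p => z (J p)
  have hcd : ∀ J, HasDerivAt (fun t => c J (γ t)) (mvfderiv (𝓡 n) (c J) x v) 0 :=
    fun J => hγd _ ((hc J).contMDiffAt.mdifferentiableAt (by simp))
  have hγc : ContinuousAt γ 0 := hγ.self_of_nhds.continuousAt
  -- Along the curve, the components of `σ` in the moving coframe `dz` form a curve of tensors on
  -- `ℝⁿ` that stays in the orbit of `f₀`.
  obtain ⟨a, ha⟩ := deriv_mem_range_infAct (fun t => frameTensor fun J => c J (γ t)) f₀ hf₀ 0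
    (by
      filter_upwards [hγ] with t ht
      refine contDiffAt_frameTensor fun J => ?_
      exact (((hc J).contMDiffAt.comp t ht).contDiffAt).of_le (by norm_cast))
    (by
      have h1 : ∀ᶠ y in 𝓝 (γ 0), ∀ i j, mvfderiv (𝓡 n) (z i) y (E j y) = if i = j then 1 else 0 := by
        rw [hγ0]; exact hzE
      filter_upwards [hγc.eventually h1] with t ht
      exact horb (γ t) (fun i => mvfderiv (𝓡 n) (z i) (γ t)) (fun i => E i (γ t)) ht)
  rw [(hasDerivAt_frameTensor hcd).deriv] at ha
  simp only [hγ0] at ha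
  let θ : Fin n → Cot n x := fun i => mvfderiv (𝓡 n) (z i) x
  let T := Fintype.linearCombination ℝ θ
  have hdual : ∀ i j, θ i (E j x) = if i = j then 1 else 0 := hzE.self_of_nhds
  let B : Cot n x →ₗ[ℝ] Cot n x :=
    { toFun := fun φ => T (a fun i => φ (E i x))
      map_add' := fun φ ψ => by
        rw [← map_add, ← map_add]
        rfl
      map_smul' := fun r φ => by
        rw [RingHom.id_apply, ← map_smul, ← map_smul]
        rfl }
  have hB : ∀ j, B (θ j) = T (a (Pi.single j 1)) := fun j => by
    change T (a fun i => θ j (E i x)) = _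
    congr 2
    funext i
    rw [hdual, Pi.single_apply]
    simp only [eq_comm]
  have hTs : ∀ j, T (Pi.single j 1) = θ j := fun j => by
    simp [T, Fintype.linearCombination_apply_single]
  refine ⟨B, fun J => ?_⟩
  have h1 := congrArg (fun f : (Fin n → ℝ) [×k]→L[ℝ] ℝ => f fun p => Pi.single (J p) 1) ha
  simp only [infAct_apply] at h1
  have h2 : frameTensor (fun J => mvfderiv (𝓡 n) (c J) x v) (fun p => Pi.single (J p) 1) =
      mvfderiv (𝓡 n) (c J) x v := by
    rw [frameTensor_apply, Finset.sum_eq_single J]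
    · simp
    · intro I _ hI
      obtain ⟨p, hp⟩ := Function.ne_iff.1 hI
      rw [Finset.prod_eq_zero (Finset.mem_univ p) (Pi.single_eq_of_ne hp _), mul_zero]
    · simp
  rw [h2] at h1
  refine h1.trans (Finset.sum_congr rfl fun i _ => ?_)
  have h3 := frameTensor_contra (σ x) θ (Function.update (fun p => (Pi.single (J p) 1 : Fin n → ℝ)) i
    (a (Pi.single (J i) 1)))
  refine h3.trans ?_
  rw [linearCombination_update]
  change σ x (Function.update (fun b => T (Pi.single (J b) 1)) i (T (a (Pi.single (J i) 1)))) = _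
  simp only [hTs, ← hB]
  rfl

end Curves

/-! ### Multilinear forms on linear combinations of vectors. -/

section Multilinear

variable {R C ι : Type*} [Field R] [AddCommGroup C] [Module R C] [Fintype ι] {k : ℕ}

theorem update_fun_apply {A : Type*} (θ : ι → A) (J : Fin k → ι) (p : Fin k) (l : ι) :
    (fun q => θ (Function.update J p l q)) = Function.update (fun q => θ (J q)) p (θ l) := by
  funext q
  by_cases hq : q = p
  · subst hq; simp
  · simp [Function.update_of_ne hq]

/-- The product rule for a multilinear form on linear combinations. -/
theorem map_update_sum_smul (τ : MultilinearMap R (fun _ : Fin k => C) R) (f : Fin k → ι → R)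
    (θ G : ι → C) (d : ι → R) (p : Fin k) :
    τ (Function.update (fun q => ∑ i, f q i • θ i) p (∑ i, (d i • θ i + f p i • G i))) =
      ∑ J : Fin k → ι, ((∏ q, Function.update (fun q => f q (J q)) p (d (J p)) q) *
          τ (fun q => θ (J q)) +
        (∏ q, f q (J q)) * τ (Function.update (fun q => θ (J q)) p (G (J p)))) := by
  classical
  have h1 : Function.update (fun q => ∑ i, f q i • θ i) p (∑ i, (d i • θ i + f p i • G i)) =
      fun q => ∑ i, Function.update (fun q i => f q i • θ i) p
        (fun i => d i • θ i + f p i • G i) q i := by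
    funext q
    by_cases hq : q = p
    · subst hq; simp
    · simp [Function.update_of_ne hq]
  rw [h1, τ.map_sum]
  refine Finset.sum_congr rfl fun J _ => ?_
  have h2 : (fun q => Function.update (fun q i => f q i • θ i) p
      (fun i => d i • θ i + f p i • G i) q (J q)) =
      Function.update (fun q => f q (J q) • θ (J q)) p
        (d (J p) • θ (J p) + f p (J p) • G (J p)) := by
    funext q
    by_cases hq : q = p
    · subst hq; simp
    · simp [Function.update_of_ne hq]
  have h3 : Function.update (fun q => f q (J q) • θ (J q)) p (d (J p) • θ (J p)) =
      fun q => Function.update (fun q => f q (J q)) p (d (J p)) q • θ (J q) := by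
    funext q
    by_cases hq : q = p
    · subst hq; simp
    · simp [Function.update_of_ne hq]
  have h4 : Function.update (fun q => f q (J q) • θ (J q)) p (f p (J p) • G (J p)) =
      fun q => f q (J q) • Function.update (fun q => θ (J q)) p (G (J p)) q := by
    funext q
    by_cases hq : q = p
    · subst hq; simp
    · simp [Function.update_of_ne hq]
  rw [h2, τ.map_update_add, h3, h4, τ.map_smul_univ, τ.map_smul_univ]
  rfl

theorem sum_update_linear_eq_zero (τ : MultilinearMap R (fun _ : Fin k => C) R) (θ : ι → C)
    (B : C →ₗ[R] C)
    (h : ∀ J : Fin k → ι, ∑ p, τ (Function.update (fun q => θ (J q)) p (B (θ (J p)))) = 0)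
    (f : Fin k → ι → R) :
    ∑ p, τ (Function.update (fun q => ∑ i, f q i • θ i) p (B (∑ i, f p i • θ i))) = 0 := by
  classical
  have h1 : ∀ p, τ (Function.update (fun q => ∑ i, f q i • θ i) p (B (∑ i, f p i • θ i))) =
      ∑ J : Fin k → ι, (∏ q, f q (J q)) * τ (Function.update (fun q => θ (J q)) p (B (θ (J p)))) := by
    intro p
    have h2 := map_update_sum_smul τ f θ (fun i => B (θ i)) 0 p
    simp only [Pi.zero_apply, zero_smul, zero_add, ← map_smul, ← map_sum] at h2
    rw [h2]
    refine Finset.sum_congr rfl fun J _ => ?_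
    rw [Finset.prod_update_of_mem (Finset.mem_univ p), zero_mul, zero_mul, zero_add]
  simp only [h1]
  rw [Finset.sum_comm]
  simp only [← Finset.mul_sum, h, mul_zero, Finset.sum_const_zero]

end Multilinear

/-! ### Existence, smoothness and uniqueness of the Wagner connection. -/

section Wagner

open Topology Filter

variable {n k : ℕ} {M : Type*} [TopologicalSpace M] [ChartedSpace (EuclideanSpace ℝ (Fin n)) M]
  [IsManifold (𝓡 n) ∞ M]

/-- A regular symbol has no kernel. -/
theorem eq_zero_of_curryLeft_eq_zero {m : ℕ} (hn : 0 < n) {σ : Π x : M, Contra n (m + 1) x}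
    (hσ : IsRegularConstantType σ) (hsym : ∀ x, σ x ∈ symPow (m + 1) x) {x : M} {φ : Cot n x}
    (h : (σ x).curryLeft φ = 0) : φ = 0 := by
  let i₀ : Fin n := ⟨0, hn⟩
  -- A rank-one endomorphism with image spanned by `φ`. Inserting `φ` in any slot of `σ` gives zero,
  -- so `B` stabilizes `σ` infinitesimally and must vanish.
  let B : Cot n x →ₗ[ℝ] Cot n x :=
    { toFun := fun ψ => ψ (tbasis x i₀) • φ
      map_add' := fun ψ ψ' => by rw [add_apply, add_smul]
      map_smul' := fun c ψ => by rw [smul_apply, smul_assoc]; rfl }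
  have hB : B = 0 := by
    refine eq_zero_of_sum_update_eq_zero (Nat.succ_pos m) hσ hsym B fun θ => ?_
    refine Finset.sum_eq_zero fun p _ => ?_
    change σ x (Function.update θ p (θ p (tbasis x i₀) • φ)) = 0
    rw [(σ x).map_update_smul]
    have h1 : σ x (Function.update θ p φ) = 0 := by
      rw [← symPow_apply_perm (hsym x) (Equiv.swap 0 p)]
      have h2 : (fun i => Function.update θ p φ (Equiv.swap 0 p i)) =
          Fin.cons φ (fun i : Fin m => Function.update θ p φ (Equiv.swap 0 p i.succ)) := by
        funext i
        refine Fin.cases ?_ (fun i => ?_) i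
        · simp
        · simp
      rw [h2]
      exact congrArg (fun γ : Contra n m x => γ _) h
    rw [h1, smul_zero]
  have h3 := congrArg (fun L : Cot n x →ₗ[ℝ] Cot n x => L (tcoord x i₀)) hB
  simpa [B, tcoord_tbasis] using h3

variable [T2Space M]

/-- A covariant derivative is smooth if it maps smooth sections to smooth sections. -/
theorem contMDiffCovariantDerivative_of_apply {F : Type*} [NormedAddCommGroup F] [NormedSpace ℝ F]
    {V : M → Type*} [TopologicalSpace (TotalSpace F V)] [∀ x, AddCommGroup (V x)]
    [∀ x, Module ℝ (V x)] [∀ x, TopologicalSpace (V x)] [∀ x, IsTopologicalAddGroup (V x)]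
    [∀ x, ContinuousSMul ℝ (V x)] [FiberBundle F V] [VectorBundle ℝ F V]
    [ContMDiffVectorBundle ∞ F V (𝓡 n)] (N : CovariantDerivative (𝓡 n) F V)
    (h : ∀ (s : Cₛ^∞⟮𝓡 n; F, V⟯) (X : VField n M), ContMDiff (𝓡 n) ((𝓡 n).prod 𝓘(ℝ, F)) ∞
      (fun y => (⟨y, N s y (X y)⟩ : TotalSpace F V))) :
    CovariantDerivative.ContMDiffCovariantDerivative N ∞ where
  contMDiff :=
    { contMDiff := fun {s} hs => by
        rw [contMDiffOn_univ] at hs ⊢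
        intro x₀
        exact contMDiffAt_hom_of_apply (fun y => N s y) x₀
          fun X => h ⟨s, hs.of_le (by norm_cast)⟩ X x₀ }

/-- The covariant derivative of vector fields at a point, from covariant derivatives of the
differentials of coordinates. -/
def covOfForms {x : M} (z : Fin n → SFun n M) (e : Fin n → Tan n x)
    (G : Fin n → Tan n x →ₗ[ℝ] Cot n x) (V : Π y : M, Tan n y) : Tan n x →L[ℝ] Tan n x :=
  LinearMap.toContinuousLinearMap
    { toFun := fun v => ∑ i, (mvfderiv (𝓡 n) (fun y => mvfderiv (𝓡 n) (z i) y (V y)) x v -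
        G i v (V x)) • e i
      map_add' := fun u v => by
        rw [← Finset.sum_add_distrib]
        refine Finset.sum_congr rfl fun i _ => ?_
        rw [← add_smul, map_add, map_add, add_apply]
        congr 1
        ring
      map_smul' := fun c v => by
        rw [RingHom.id_apply, Finset.smul_sum]
        refine Finset.sum_congr rfl fun i _ => ?_
        rw [smul_smul, map_smul, map_smul, smul_apply]
        congr 1
        rw [smul_eq_mul, smul_eq_mul]
        ring }

theorem covOfForms_apply {x : M} (z : Fin n → SFun n M) (e : Fin n → Tan n x)
    (G : Fin n → Tan n x →ₗ[ℝ] Cot n x) (V : Π y : M, Tan n y) (v : Tan n x) :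
    covOfForms z e G V v = ∑ i, (mvfderiv (𝓡 n) (fun y => mvfderiv (𝓡 n) (z i) y (V y)) x v -
        G i v (V x)) • e i := rfl

/-- The endomorphism attached to a direction is obtained by a choice. Choosing it only for the frame
vectors `E b` and extending linearly makes it linear in `v`. -/
theorem exists_covariant_forms (hk : 0 < k) {σ : Π x : M, Contra n k x}
    (hσ : IsRegularConstantType σ) (hsym : ∀ x, σ x ∈ symPow k x) (hsm : IsSmoothContra σ) {x : M}
    {z : Fin n → SFun n M} {E : Fin n → VField n M}
    (hzE : ∀ᶠ y in 𝓝 x, ∀ i j, mvfderiv (𝓡 n) (z i) y (E j y) = if i = j then 1 else 0) :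
    ∃ G : Fin n → Tan n x →ₗ[ℝ] Cot n x, ∀ (J : Fin k → Fin n) (v : Tan n x),
      mvfderiv (𝓡 n) (fun y => σ y (fun p => mvfderiv (𝓡 n) (z (J p)) y)) x v =
        ∑ p, σ x (Function.update (fun p => mvfderiv (𝓡 n) (z (J p)) x) p (G (J p) v)) := by
  choose B hB using fun b => exists_mvfderiv_eq_sum_update hk hσ hsym hsm hzE (E b x)
  let G : Fin n → Tan n x →ₗ[ℝ] Cot n x := fun i => ∑ b,
    (mvfderiv (𝓡 n) (z b) x : Tan n x →ₗ[ℝ] ℝ).smulRight (B b (mvfderiv (𝓡 n) (z i) x))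
  refine ⟨G, fun J v => ?_⟩
  conv_lhs => rw [eq_sum_smul_of_dual hzE.self_of_nhds v, map_sum]
  have h1 : ∀ i, G i v = ∑ b, mvfderiv (𝓡 n) (z b) x v • B b (mvfderiv (𝓡 n) (z i) x) := by
    intro i
    simp [G]
  simp only [map_smul, hB, h1, MultilinearMap.map_update_sum, MultilinearMap.map_update_smul,
    Finset.smul_sum]
  exact Finset.sum_comm

/-- The axioms of a covariant derivative are conditions at each single point, so the coordinates `z
x` and the prescribed derivatives `G x` may vary with `x` without any continuity. For the Wagner
connection, smoothness follows afterwards from `contMDiff_of_wagner`. -/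
theorem exists_aff_conn (z : M → Fin n → SFun n M) (e : Π x : M, Fin n → Tan n x)
    (hze : ∀ x i j, mvfderiv (𝓡 n) (z x i) x (e x j) = if i = j then 1 else 0)
    (G : Π x : M, Fin n → Tan n x →ₗ[ℝ] Cot n x) :
    ∃ D : AffConn n M, ∀ x i v, dualCov D (fun y => mvfderiv (𝓡 n) (z x i) y) x v = G x i v := by
  let D : AffConn n M :=
    { toFun := fun V x => covOfForms (z x) (e x) (G x) V
      isCovariantDerivativeOnUniv :=
        { add := by
            intro V V' x hV hV' _
            ext1 v
            rw [add_apply, covOfForms_apply, covOfForms_apply, covOfForms_apply,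
              ← Finset.sum_add_distrib]
            refine Finset.sum_congr rfl fun i _ => ?_
            rw [← add_smul]
            congr 1
            have h1 := mvfderiv_add (mdifferentiableAt_mvfderiv_apply (z x i) hV)
              (mdifferentiableAt_mvfderiv_apply (z x i) hV')
            have h2 : (fun y => mvfderiv (𝓡 n) (z x i) y ((V + V') y)) =
                (fun y => mvfderiv (𝓡 n) (z x i) y (V y)) +
                  fun y => mvfderiv (𝓡 n) (z x i) y (V' y) := by
              funext y
              exact map_add _ _ _
            rw [h2, h1, add_apply, Pi.add_apply, map_add]
            ring
          leibniz := by
            intro V g x hV hg _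
            ext1 v
            rw [add_apply, smul_apply, covOfForms_apply, covOfForms_apply,
              ContinuousLinearMap.smulRight_apply]
            have h0 : mvfderiv (𝓡 n) g x v • V x = ∑ i,
                (mvfderiv (𝓡 n) g x v * mvfderiv (𝓡 n) (z x i) x (V x)) • e x i := by
              conv_lhs => rw [eq_sum_smul_of_dual (hze x) (V x), Finset.smul_sum]
              simp only [smul_smul]
            rw [h0, Finset.smul_sum, ← Finset.sum_add_distrib]
            refine Finset.sum_congr rfl fun i _ => ?_
            rw [smul_smul, ← add_smul]
            congr 1
            have h1 := mvfderiv_mul hg (mdifferentiableAt_mvfderiv_apply (z x i) hV)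
            have h2 : (fun y => mvfderiv (𝓡 n) (z x i) y ((g • V) y)) =
                g * fun y => mvfderiv (𝓡 n) (z x i) y (V y) := by
              funext y
              exact (mvfderiv (𝓡 n) (z x i) y).map_smul (g y) (V y)
            rw [h2, h1]
            simp only [add_apply, smul_apply, Pi.smul_apply', map_smul, smul_eq_mul]
            ring } }
  refine ⟨D, fun x i v => ?_⟩
  obtain ⟨E, hE⟩ : ∃ E : Fin n → VField n M, ∀ j, E j x = e x j := by
    choose E hE using fun j => exists_section_eq (n := n) (F := Mdl n) (V := fun y : M => Tan n y) (e x j)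
    exact ⟨E, hE⟩
  have hd : ∀ j, dualCov D (fun y => mvfderiv (𝓡 n) (z x i) y) x v (e x j) = G x i v (e x j) := by
    intro j
    have h1 := dualCov_apply D (isSmoothForm_mvfderiv (z x i))
      (section_mdifferentiableAt (E j) x) v
    rw [hE] at h1
    rw [h1]
    have h2 : D (E j) x v = covOfForms (z x) (e x) (G x) (E j) v := rfl
    rw [h2, covOfForms_apply, map_sum]
    simp [hze, hE]
  rw [cot_eq_sum_smul_of_dual (hze x) (dualCov D _ x v), cot_eq_sum_smul_of_dual (hze x) (G x i v)]
  simp only [hd]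

/-- The Wagner equation, from its special case for the differentials of coordinates. -/
theorem mvfderiv_contra_eq {σ : Π x : M, Contra n k x} (hsm : IsSmoothContra σ) (D : AffConn n M)
    {x : M} {z : Fin n → SFun n M} {E : Fin n → VField n M}
    (hzE : ∀ᶠ y in 𝓝 x, ∀ i j, mvfderiv (𝓡 n) (z i) y (E j y) = if i = j then 1 else 0)
    (v : Tan n x)
    (h : ∀ J : Fin k → Fin n,
      mvfderiv (𝓡 n) (fun y => σ y (fun p => mvfderiv (𝓡 n) (z (J p)) y)) x v =
        ∑ p, σ x (Function.update (fun p => mvfderiv (𝓡 n) (z (J p)) x) p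
          (dualCov D (fun y => mvfderiv (𝓡 n) (z (J p)) y) x v)))
    {θ : Fin k → Π x : M, Cot n x} (hθ : ∀ i, IsSmoothForm (θ i)) :
    mvfderiv (𝓡 n) (fun y => σ y (fun i => θ i y)) x v =
      ∑ i, σ x (Function.update (fun i => θ i x) i (dualCov D (θ i) x v)) := by
  let dz : Fin n → Π y : M, Cot n y := fun i y => mvfderiv (𝓡 n) (z i) y
  let f : Fin k → Fin n → M → ℝ := fun p i y => θ p y (E i y)
  have hf : ∀ p i, MDifferentiableAt (𝓡 n) 𝓘(ℝ, ℝ) (f p i) x := fun p i =>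
    (hθ p (E i)).contMDiffAt.mdifferentiableAt (by simp)
  have hθy : ∀ᶠ y in 𝓝 x, ∀ p, θ p y = ∑ i, f p i y • dz i y := by
    filter_upwards [hzE] with y hy p
    exact cot_eq_sum_smul_of_dual hy (θ p y)
  have hθx : ∀ p, θ p x = ∑ i, f p i x • dz i x := hθy.self_of_nhds
  have hcov : ∀ p, dualCov D (θ p) x v =
      ∑ i, (mvfderiv (𝓡 n) (f p i) x v • dz i x + f p i x • dualCov D (dz i) x v) := by
    intro p
    rw [cot_eq_sum_smul_of_dual hzE.self_of_nhds (dualCov D (θ p) x v), Finset.sum_add_distrib,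
      ← add_sub_cancel_left (∑ i, mvfderiv (𝓡 n) (f p i) x v • dz i x)
        (∑ i, f p i x • dualCov D (dz i) x v)]
    rw [add_sub_cancel_left]
    have h1 : ∀ j, dualCov D (θ p) x v (E j x) = mvfderiv (𝓡 n) (f p j) x v +
        ∑ i, f p i x * dualCov D (dz i) x v (E j x) := by
      intro j
      rw [dualCov_apply D (hθ p) (section_mdifferentiableAt (E j) x), sub_eq_add_neg]
      congr 1
      rw [hθx p, sum_apply, ← Finset.sum_neg_distrib]
      refine Finset.sum_congr rfl fun i _ => ?_
      rw [dualCov_apply D (isSmoothForm_mvfderiv (z i)) (section_mdifferentiableAt (E j) x)]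
      have h2 : mvfderiv (𝓡 n) (fun y => mvfderiv (𝓡 n) (z i) y (E j y)) x = 0 := by
        rw [mvfderiv_congr (g := fun _ => if i = j then (1 : ℝ) else 0)
          (hzE.mono fun y hy => hy i j)]
        exact mvfderiv_const (I := 𝓡 n) _
      rw [h2, zero_apply, zero_sub, mul_neg]
      rfl
    simp only [h1, add_smul, Finset.sum_add_distrib]
    congr 1
    simp only [Finset.sum_smul, mul_smul]
    rw [Finset.sum_comm]
    refine Finset.sum_congr rfl fun i _ => ?_
    rw [← Finset.smul_sum, ← cot_eq_sum_smul_of_dual hzE.self_of_nhds]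
  have hσy : ∀ᶠ y in 𝓝 x, σ y (fun p => θ p y) =
      ∑ J : Fin k → Fin n, (∏ p, f p (J p) y) * σ y (fun p => dz (J p) y) := by
    filter_upwards [hθy] with y hy
    have h1 : (fun p => θ p y) = fun p => ∑ i, f p i y • dz i y := funext hy
    rw [h1, (σ y).map_sum]
    exact Finset.sum_congr rfl fun J _ => (σ y).map_smul_univ _ _
  rw [mvfderiv_congr hσy]
  have hc : ∀ J : Fin k → Fin n, MDifferentiableAt (𝓡 n) 𝓘(ℝ, ℝ)
      (fun y => σ y (fun p => dz (J p) y)) x := fun J =>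
    (hsm fun p => z (J p)).contMDiffAt.mdifferentiableAt (by simp)
  have hp : ∀ J : Fin k → Fin n, MDifferentiableAt (𝓡 n) 𝓘(ℝ, ℝ) (fun y => ∏ p, f p (J p) y) x :=
    fun J => mdifferentiableAt_finset_prod Finset.univ _ fun p => hf p (J p)
  rw [mvfderiv_finset_sum Finset.univ
    (fun (J : Fin k → Fin n) y => (∏ p, f p (J p) y) * σ y (fun p => dz (J p) y))
    (fun J _ => (hp J).mul (hc J)), sum_apply]
  have hθx' : (fun p => θ p x) = fun p => ∑ i, f p i x • dz i x := funext hθx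
  simp only [hθx', hcov]
  have hR : ∀ p, σ x (Function.update (fun q => ∑ i, f q i x • dz i x) p
      (∑ i, (mvfderiv (𝓡 n) (f p i) x v • dz i x + f p i x • dualCov D (dz i) x v))) = _ := fun p =>
    map_update_sum_smul (σ x) (fun q i => f q i x) (fun i => dz i x)
      (fun i => dualCov D (dz i) x v) (fun i => mvfderiv (𝓡 n) (f p i) x v) p
  simp only [hR]
  rw [Finset.sum_comm]
  refine Finset.sum_congr rfl fun J _ => ?_
  have h1 := mvfderiv_mul (hp J) (hc J)
  have h2 : mvfderiv (𝓡 n) (fun y => (∏ p, f p (J p) y) * σ y (fun p => dz (J p) y)) x v =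
      (∏ p, f p (J p) x) * mvfderiv (𝓡 n) (fun y => σ y (fun p => dz (J p) y)) x v +
      σ x (fun p => dz (J p) x) * mvfderiv (𝓡 n) (fun y => ∏ p, f p (J p) y) x v :=
    congrArg (fun L : Tan n x →L[ℝ] ℝ => L v) h1
  rw [h2, h J, mvfderiv_prod_apply (fun p y => f p (J p) y) (fun p => hf p (J p)),
    Finset.sum_add_distrib, ← Finset.mul_sum, ← Finset.sum_mul, mul_comm (σ x _), add_comm]

/-- The coefficients of a linear combination of tensors `τ (…, dz_l, …)`. -/
theorem sum_mul_sum_ite {x : M} (τ : Contra n k x) (θ : Fin n → Cot n x) (J : Fin k → Fin n)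
    (c : Fin n × Fin n → ℝ) :
    ∑ il, c il * ∑ p, (if J p = il.1 then τ (Function.update (fun q => θ (J q)) p (θ il.2)) else 0) =
      ∑ p, τ (Function.update (fun q => θ (J q)) p (∑ l, c (J p, l) • θ l)) := by
  simp only [Finset.mul_sum]
  rw [Finset.sum_comm]
  refine Finset.sum_congr rfl fun p _ => ?_
  rw [Fintype.sum_prod_type, Finset.sum_eq_single (J p)]
  · simp only [if_true]
    rw [τ.map_update_sum]
    refine Finset.sum_congr rfl fun l _ => ?_
    rw [τ.map_update_smul, smul_eq_mul]
  · intro i _ hi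
    simp [Ne.symm hi]
  · simp

/-- The numbers `c` are the matrix of an endomorphism of the cotangent space that stabilizes `σ`
infinitesimally. This is the injectivity needed for `contMDiffAt_of_linear_system`. -/
theorem eq_zero_of_sum_mul_eq_zero (hk : 0 < k) {σ : Π x : M, Contra n k x}
    (hσ : IsRegularConstantType σ) (hsym : ∀ x, σ x ∈ symPow k x) {x : M} {θ : Fin n → Cot n x}
    {e : Fin n → Tan n x} (h : ∀ i j, θ i (e j) = if i = j then 1 else 0)
    (c : Fin n × Fin n → ℝ) (hc : ∀ J : Fin k → Fin n, ∑ il, c il * ∑ p,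
      (if J p = il.1 then σ x (Function.update (fun q => θ (J q)) p (θ il.2)) else 0) = 0) :
    c = 0 := by
  let B : Cot n x →ₗ[ℝ] Cot n x :=
    { toFun := fun φ => ∑ i, φ (e i) • ∑ l, c (i, l) • θ l
      map_add' := fun φ ψ => by simp only [add_apply, add_smul, Finset.sum_add_distrib]
      map_smul' := fun r φ => by
        simp only [smul_apply, smul_assoc, RingHom.id_apply, Finset.smul_sum] }
  have hBz : ∀ i, B (θ i) = ∑ l, c (i, l) • θ l := by
    intro i
    change ∑ j, θ i (e j) • ∑ l, c (j, l) • θ l = _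
    simp [h]
  have hB0 : B = 0 := by
    refine eq_zero_of_sum_update_eq_zero hk hσ hsym B fun φ => ?_
    have h1 := sum_update_linear_eq_zero (σ x) θ B (fun J => by
      simp only [hBz]
      rw [← sum_mul_sum_ite, hc]) (fun p i => φ p (e i))
    have h2 : ∀ p, ∑ i, φ p (e i) • θ i = φ p := fun p => (cot_eq_sum_smul_of_dual h (φ p)).symm
    simpa only [h2] using h1
  funext il
  have h3 := congrArg (fun L : Cot n x →ₗ[ℝ] Cot n x => L (θ il.1) (e il.2)) hB0
  simp only [hBz] at h3
  simpa [h] using h3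

/-- The covariant derivative of vector fields in terms of that of coordinate forms. -/
theorem cov_eq_of_dual (D : AffConn n M) {y : M} {z : Fin n → SFun n M} {E : Fin n → Tan n y}
    (hy : ∀ i j, mvfderiv (𝓡 n) (z i) y (E j) = if i = j then 1 else 0) (V : VField n M)
    (v : Tan n y) :
    D V y v = ∑ i, (mvfderiv (𝓡 n) (fun y => mvfderiv (𝓡 n) (z i) y (V y)) y v -
        ∑ b, mvfderiv (𝓡 n) (z b) y v * ∑ l, mvfderiv (𝓡 n) (z l) y (V y) *
          dualCov D (fun y => mvfderiv (𝓡 n) (z i) y) y (E b) (E l)) • E i := by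
  rw [eq_sum_smul_of_dual hy (D V y v)]
  refine Finset.sum_congr rfl fun i _ => ?_
  congr 1
  have h1 := dualCov_apply D (isSmoothForm_mvfderiv (z i)) (section_mdifferentiableAt V y) v
  have h2 : dualCov D (fun y => mvfderiv (𝓡 n) (z i) y) y v (V y) =
      ∑ b, mvfderiv (𝓡 n) (z b) y v * ∑ l, mvfderiv (𝓡 n) (z l) y (V y) *
        dualCov D (fun y => mvfderiv (𝓡 n) (z i) y) y (E b) (E l) := by
    let T : Tan n y →ₗ[ℝ] Cot n y := dualCovL D (fun y => mvfderiv (𝓡 n) (z i) y) y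
    have h3 : T v = ∑ b, mvfderiv (𝓡 n) (z b) y v • T (E b) := by
      conv_lhs => rw [eq_sum_smul_of_dual hy v, map_sum]
      exact Finset.sum_congr rfl fun b _ => map_smul T _ _
    refine (congrArg (fun L : Cot n y => L (V y)) h3).trans ?_
    simp only [sum_apply]
    refine Finset.sum_congr rfl fun b _ => ?_
    rw [smul_apply, smul_eq_mul]
    congr 1
    conv_lhs => rw [eq_sum_smul_of_dual hy (V y), map_sum]
    exact Finset.sum_congr rfl fun l _ => map_smul (T (E b)) _ _
  rw [← h2, h1]
  ring

/-- The Wagner equation on the forms `dz` is a linear system for the components of the covariant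
derivatives of `dz`. Its coefficients are smooth and it is injective. -/
theorem contMDiffAt_dualCov_of_wagner (hk : 0 < k) {σ : Π x : M, Contra n k x}
    (hσ : IsRegularConstantType σ) (hsym : ∀ x, σ x ∈ symPow k x) (hsm : IsSmoothContra σ)
    (D : AffConn n M)
    (hD : ∀ θ : Fin k → Π x : M, Cot n x, (∀ i, IsSmoothForm (θ i)) → ∀ (x : M) (v : Tan n x),
      mvfderiv (𝓡 n) (fun y => σ y (fun i => θ i y)) x v =
        ∑ i, σ x (Function.update (fun i => θ i x) i (dualCov D (θ i) x v)))
    {x₀ : M} {z : Fin n → SFun n M} {E : Fin n → VField n M}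
    (hzE : ∀ᶠ y in 𝓝 x₀, ∀ i j, mvfderiv (𝓡 n) (z i) y (E j y) = if i = j then 1 else 0)
    (b : Fin n) (il : Fin n × Fin n) :
    ContMDiffAt (𝓡 n) 𝓘(ℝ, ℝ) ∞
      (fun y => dualCov D (fun y => mvfderiv (𝓡 n) (z il.1) y) y (E b y) (E il.2 y)) x₀ := by
  refine contMDiffAt_of_linear_system
    (fun (il : Fin n × Fin n) (J : Fin k → Fin n) (y : M) => ∑ p, if J p = il.1 then
      σ y (Function.update (fun q => mvfderiv (𝓡 n) (z (J q)) y) p (mvfderiv (𝓡 n) (z il.2) y))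
      else 0)
    (fun J y => mvfderiv (𝓡 n) (fun y => σ y (fun p => mvfderiv (𝓡 n) (z (J p)) y)) y (E b y))
    (fun il y => dualCov D (fun y => mvfderiv (𝓡 n) (z il.1) y) y (E b y) (E il.2 y))
    (fun il J => ?_) (fun J => ?_) (fun c hc => ?_) ?_ il
  · refine contMDiffAt_finsetSum fun p _ => ?_
    by_cases h : J p = il.1
    · simp only [h, if_true]
      have h1 := hsm (fun q => z (Function.update J p il.2 q)) x₀
      refine h1.congr_of_eventuallyEq (Eventually.of_forall fun y => ?_)
      exact congrArg (σ y) (update_fun_apply (fun i => mvfderiv (𝓡 n) (z i) y) J p il.2).symm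
    · simp only [h, if_false]
      exact contMDiffAt_const
  · exact contMDiff_mvfderiv_apply
      ⟨fun y => σ y (fun p => mvfderiv (𝓡 n) (z (J p)) y), hsm fun p => z (J p)⟩ (E b) x₀
  · exact eq_zero_of_sum_mul_eq_zero hk hσ hsym (θ := fun i => mvfderiv (𝓡 n) (z i) x₀)
      (e := fun i => E i x₀) hzE.self_of_nhds c hc
  · filter_upwards [hzE] with y hy J
    have h1 := sum_mul_sum_ite (σ y) (fun i => mvfderiv (𝓡 n) (z i) y) J fun il =>
      dualCov D (fun y => mvfderiv (𝓡 n) (z il.1) y) y (E b y) (E il.2 y)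
    beta_reduce at h1 ⊢
    have h2 := hD (fun p y => mvfderiv (𝓡 n) (z (J p)) y) (fun p => isSmoothForm_mvfderiv _) y (E b y)
    rw [h1]
    refine Eq.trans ?_ h2.symm
    refine Finset.sum_congr rfl fun p _ => ?_
    have h3 := cot_eq_sum_smul_of_dual hy
      (dualCov D (fun y => mvfderiv (𝓡 n) (z (J p)) y) y (E b y))
    exact congrArg (fun φ => σ y (Function.update _ p φ)) h3.symm

/-- A connection satisfying the Wagner equation is smooth. -/
theorem contMDiff_of_wagner (hk : 0 < k) {σ : Π x : M, Contra n k x}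
    (hσ : IsRegularConstantType σ) (hsym : ∀ x, σ x ∈ symPow k x) (hsm : IsSmoothContra σ)
    (D : AffConn n M)
    (hD : ∀ θ : Fin k → Π x : M, Cot n x, (∀ i, IsSmoothForm (θ i)) → ∀ (x : M) (v : Tan n x),
      mvfderiv (𝓡 n) (fun y => σ y (fun i => θ i y)) x v =
        ∑ i, σ x (Function.update (fun i => θ i x) i (dualCov D (θ i) x v))) :
    CovariantDerivative.ContMDiffCovariantDerivative D ∞ := by
  refine contMDiffCovariantDerivative_of_apply D fun V X x₀ => ?_
  obtain ⟨z, E, hzE⟩ := exists_coordinates (n := n) x₀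
  refine contMDiffAt_congr_section
    (hzE.mono fun y hy => cov_eq_of_dual D (E := fun i => E i y) hy V (X y)) ?_
  have hdz : ∀ i (Y : VField n M),
      ContMDiffAt (𝓡 n) 𝓘(ℝ, ℝ) ∞ (fun y => mvfderiv (𝓡 n) (z i) y (Y y)) x₀ :=
    fun i Y => contMDiff_mvfderiv_apply (z i) Y x₀
  have ha := contMDiffAt_dualCov_of_wagner hk hσ hsym hsm D hD hzE
  refine ContMDiffAt.sum_section fun i _ => ContMDiffAt.smul_section ?_ (E i).contMDiff.contMDiffAt
  refine ContMDiffAt.sub ?_ (contMDiffAt_finsetSum fun b _ => (hdz b X).mul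
    (contMDiffAt_finsetSum fun l _ => (hdz l V).mul (ha b (i, l))))
  exact contMDiff_mvfderiv_apply (dirDeriv V (z i)) X x₀

/-- The Wagner connection exists. -/
theorem exists_isWagner (hk : 0 < k) {σ : Π x : M, Contra n k x}
    (hσ : IsRegularConstantType σ) (hsym : ∀ x, σ x ∈ symPow k x) (hsm : IsSmoothContra σ) :
    ∃ D : AffConn n M, IsWagner σ D := by
  choose z E hzE using fun x : M => exists_coordinates (n := n) x
  choose G hG using fun x => exists_covariant_forms hk hσ hsym hsm (hzE x)
  obtain ⟨D, hD⟩ := exists_aff_conn z (fun x i => E x i x) (fun x => (hzE x).self_of_nhds) G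
  have hW : ∀ θ : Fin k → Π x : M, Cot n x, (∀ i, IsSmoothForm (θ i)) → ∀ (x : M) (v : Tan n x),
      mvfderiv (𝓡 n) (fun y => σ y (fun i => θ i y)) x v =
        ∑ i, σ x (Function.update (fun i => θ i x) i (dualCov D (θ i) x v)) := by
    intro θ hθ x v
    refine mvfderiv_contra_eq hsm D (hzE x) v (fun J => ?_) hθ
    simp only [hD]
    exact hG x J v
  exact ⟨D, contMDiff_of_wagner hk hσ hsym hsm D hW, hW⟩

/-- The Wagner connection is unique. -/
theorem IsWagner.eq_extend (hk : 0 < k) {σ : Π x : M, Contra n k x}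
    (hσ : IsRegularConstantType σ) (hsym : ∀ x, σ x ∈ symPow k x) {D D' : AffConn n M}
    (hD : IsWagner σ D) (hD' : IsWagner σ D') (x : M) (w : Tan n x) :
    D (extend (Mdl n) w) x = D' (extend (Mdl n) w) x := by
  let b : Tan n x →L[ℝ] Tan n x →L[ℝ] Tan n x := D.difference D' x
  have hb : ∀ w, b w = D (extend (Mdl n) w) x - D' (extend (Mdl n) w) x := by
    intro w
    have h1 := IsCovariantDerivativeOn.difference_apply D.isCovariantDerivativeOnUniv
      D'.isCovariantDerivativeOnUniv (Set.mem_univ x) (mdifferentiableAt_extend_tan w)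
    rw [extend_apply_self] at h1
    exact h1
  let bf : Tan n x → Tan n x →L[ℝ] Tan n x := fun v => LinearMap.toContinuousLinearMap
    { toFun := fun w => b w v
      map_add' := fun w w' => by rw [map_add, add_apply]
      map_smul' := fun c w => by rw [map_smul, smul_apply]; rfl }
  have h0 : ∀ v, bf v = 0 := by
    intro v
    -- `B` is the difference of the two induced derivatives of 1-forms in the direction `v`, that
    -- is, minus the transpose of `w ↦ D_v w - D'_v w`. Subtracting the two Wagner equations shows
    -- that it stabilizes `σ`.
    let B : Cot n x →ₗ[ℝ] Cot n x :=
      { toFun := fun φ => -(φ.comp (bf v))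
        map_add' := fun φ ψ => by rw [ContinuousLinearMap.add_comp, neg_add]
        map_smul' := fun c φ => by rw [ContinuousLinearMap.smul_comp, smul_neg]; rfl }
    have hB0 : B = 0 := by
      refine eq_zero_of_sum_update_eq_zero hk hσ hsym B fun θ => ?_
      choose f hf using fun p => exists_mvfderiv_eq (n := n) (θ p)
      have h1 := hD.2 (fun p y => mvfderiv (𝓡 n) (f p) y) (fun p => isSmoothForm_mvfderiv _) x v
      have h2 := hD'.2 (fun p y => mvfderiv (𝓡 n) (f p) y) (fun p => isSmoothForm_mvfderiv _) x v
      have h3 := h1.symm.trans h2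
      rw [← sub_eq_zero, ← Finset.sum_sub_distrib] at h3
      refine Eq.trans (Finset.sum_congr rfl fun p _ => ?_) h3
      simp only [hf]
      rw [← (σ x).map_update_sub]
      congr 2
      ext w
      have h4 := dualCov_apply D (isSmoothForm_mvfderiv (f p)) (mdifferentiableAt_extend_tan w) v
      have h5 := dualCov_apply D' (isSmoothForm_mvfderiv (f p)) (mdifferentiableAt_extend_tan w) v
      rw [extend_apply_self] at h4 h5
      rw [sub_apply, h4, h5, hf]
      change -(θ p (b w v)) = _
      rw [hb, sub_apply, map_sub]
      ring
    ext1 w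
    rw [eq_sum_smul_of_dual (tcoord_tbasis x) (bf v w)]
    refine Finset.sum_eq_zero fun i _ => ?_
    have h6 := congrArg (fun L : Cot n x →ₗ[ℝ] Cot n x => L (tcoord x i) w) hB0
    have h7 : -(tcoord x i (bf v w)) = 0 := h6
    rw [neg_eq_zero.1 h7, zero_smul]
  rw [← sub_eq_zero, ← hb]
  ext1 v
  exact congrArg (fun L : Tan n x →L[ℝ] Tan n x => L w) (h0 v)

end Wagner

/-! ### Exterior derivatives of 1-forms. -/

section ExteriorDerivative

open Topology Filter

variable {n : ℕ} {M : Type*} [TopologicalSpace M] [ChartedSpace (EuclideanSpace ℝ (Fin n)) M]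
  [IsManifold (𝓡 n) ∞ M] [T2Space M]

theorem contDiffAt_comp_extChartAt_symm (f : SFun n M) (x : M) {z : Mdl n}
    (hz : z ∈ (extChartAt (𝓡 n) x).target) :
    ContDiffAt ℝ ∞ (fun z => f ((extChartAt (𝓡 n) x).symm z)) z := by
  have h1 : ContMDiffAt 𝓘(ℝ, Mdl n) (𝓡 n) ∞ (extChartAt (𝓡 n) x).symm z :=
    (contMDiffOn_extChartAt_symm x).contMDiffAt ((isOpen_extChartAt_target x).mem_nhds hz)
  exact (f.contMDiff.contMDiffAt.comp z h1).contDiffAt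

theorem fderiv_comp_extChartAt_symm (f : SFun n M) (x : M) (v : Tan n x) :
    fderiv ℝ (fun z => f ((extChartAt (𝓡 n) x).symm z)) (extChartAt (𝓡 n) x x)
      (mvfderiv (𝓡 n) (fun y : M => extChartAt (𝓡 n) x y) x v) = mvfderiv (𝓡 n) f x v := by
  have h1 : MDifferentiableAt 𝓘(ℝ, Mdl n) 𝓘(ℝ, ℝ)
      (f ∘ (extChartAt (𝓡 n) x).symm) (extChartAt (𝓡 n) x x) :=
    ((contDiffAt_comp_extChartAt_symm f x (mem_extChartAt_target x)).differentiableAt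
      (by simp)).mdifferentiableAt
  have h5 : f =ᶠ[𝓝 x] (f ∘ (extChartAt (𝓡 n) x).symm) ∘ extChartAt (𝓡 n) x := by
    filter_upwards [extChartAt_source_mem_nhds (I := 𝓡 n) x] with y hy
    exact congrArg f ((extChartAt (𝓡 n) x).left_inv hy).symm
  have h6 : mfderiv (𝓡 n) 𝓘(ℝ, ℝ) f x v = fderiv ℝ (f ∘ (extChartAt (𝓡 n) x).symm)
      (extChartAt (𝓡 n) x x) (mfderiv (𝓡 n) 𝓘(ℝ, Mdl n) (extChartAt (𝓡 n) x) x v) := by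
    rw [h5.mfderiv_eq, mfderiv_comp x h1 (mdifferentiableAt_extChartAt (mem_chart_source _ x)),
      mfderiv_eq_fderiv]
    rfl
  exact h6.symm

theorem mvfderiv_comp_mfderiv_extChartAt_symm (f : SFun n M) (x : M) {z : Mdl n}
    (hz : z ∈ (extChartAt (𝓡 n) x).target) :
    (mvfderiv (𝓡 n) f ((extChartAt (𝓡 n) x).symm z)).comp
      (mfderiv 𝓘(ℝ, Mdl n) (𝓡 n) (extChartAt (𝓡 n) x).symm z) =
    fderiv ℝ (fun z => f ((extChartAt (𝓡 n) x).symm z)) z := by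
  have h1 : ContMDiffAt 𝓘(ℝ, Mdl n) (𝓡 n) ∞ (extChartAt (𝓡 n) x).symm z :=
    (contMDiffOn_extChartAt_symm x).contMDiffAt ((isOpen_extChartAt_target x).mem_nhds hz)
  have h2 := mfderiv_comp z (sfun_mdifferentiableAt f ((extChartAt (𝓡 n) x).symm z))
    (h1.mdifferentiableAt (by simp))
  rw [mfderiv_eq_fderiv] at h2
  exact h2.symm

/-- The exterior derivative of `∑ a dz` is `∑ da ∧ dz`. -/
theorem extD_eq_of_eventually {ι : Type*} [Fintype ι] {θ : Π x : M, Cot n x} {x : M}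
    (a z : ι → SFun n M) (h : ∀ᶠ y in 𝓝 x, θ y = ∑ c, a c y • mvfderiv (𝓡 n) (z c) y)
    (v w : Tan n x) :
    extD θ x v w = ∑ c, (mvfderiv (𝓡 n) (a c) x v * mvfderiv (𝓡 n) (z c) x w -
      mvfderiv (𝓡 n) (a c) x w * mvfderiv (𝓡 n) (z c) x v) := by
  let φ := extChartAt (𝓡 n) x
  let ta : ι → Mdl n → ℝ := fun c u => a c (φ.symm u)
  let tz : ι → Mdl n → ℝ := fun c u => z c (φ.symm u)
  have hx : φ.symm (φ x) = x := extChartAt_to_inv x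
  have hform : formInChart θ x =ᶠ[𝓝 (φ x)] fun u => ∑ c, ta c u • fderiv ℝ (tz c) u := by
    have h1 : ContinuousAt φ.symm (φ x) := continuousAt_extChartAt_symm x
    have h2 : ∀ᶠ u in 𝓝 (φ x), θ (φ.symm u) =
        ∑ c, a c (φ.symm u) • mvfderiv (𝓡 n) (z c) (φ.symm u) :=
      h1.eventually (by rw [hx]; exact h)
    filter_upwards [h2, extChartAt_target_mem_nhds (I := 𝓡 n) x] with u hu hut
    rw [formInChart]
    refine (congrArg (fun ψ : Cot n (φ.symm u) =>
      ψ.comp (mfderiv 𝓘(ℝ, Mdl n) (𝓡 n) φ.symm u)) hu).trans ?_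
    refine ContinuousLinearMap.ext fun w : Mdl n => ?_
    have hR : (∑ c, ta c u • fderiv ℝ (tz c) u) w = ∑ c, ta c u • fderiv ℝ (tz c) u w := by
      simp only [sum_apply, smul_apply]
    refine Eq.trans ?_ hR.symm
    change (∑ c, a c (φ.symm u) • mvfderiv (𝓡 n) (z c) (φ.symm u) : Cot n (φ.symm u))
      (mfderiv 𝓘(ℝ, Mdl n) (𝓡 n) φ.symm u w) = _
    rw [sum_apply]
    refine Finset.sum_congr rfl fun c _ => ?_
    rw [smul_apply]
    congr 1
    exact congrArg (fun L : Mdl n →L[ℝ] ℝ => L w)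
      (mvfderiv_comp_mfderiv_extChartAt_symm (z c) x hut)
  have hta : ∀ c, HasFDerivAt (ta c) (fderiv ℝ (ta c) (φ x)) (φ x) := fun c =>
    ((contDiffAt_comp_extChartAt_symm (a c) x (mem_extChartAt_target x)).differentiableAt
      (by simp)).hasFDerivAt
  have htz : ∀ c, ContDiffAt ℝ ∞ (tz c) (φ x) := fun c =>
    contDiffAt_comp_extChartAt_symm (z c) x (mem_extChartAt_target x)
  have htz' : ∀ c, HasFDerivAt (fderiv ℝ (tz c)) (fderiv ℝ (fderiv ℝ (tz c)) (φ x)) (φ x) :=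
    fun c => (((htz c).fderiv_right (m := 1) (by norm_cast)).differentiableAt
      (by simp)).hasFDerivAt
  have hB := (HasFDerivAt.fun_sum (u := Finset.univ) fun c _ =>
    (hta c).smul (htz' c)).congr_of_eventuallyEq hform
  have hs : ∀ c, IsSymmSndFDerivAt ℝ (tz c) (φ x) := fun c =>
    (htz c).isSymmSndFDerivAt (by simp only [minSmoothness_of_isRCLikeNormedField]; exact ENat.LEInfty.out)
  have hval : ∀ v w, extD θ x v w = fderiv ℝ (formInChart θ x) (φ x)
      (mvfderiv (𝓡 n) (fun y : M => φ y) x v) (mvfderiv (𝓡 n) (fun y : M => φ y) x w) -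
      fderiv ℝ (formInChart θ x) (φ x)
      (mvfderiv (𝓡 n) (fun y : M => φ y) x w) (mvfderiv (𝓡 n) (fun y : M => φ y) x v) :=
    fun v w => rfl
  rw [hval, hB.fderiv]
  simp only [sum_apply, add_apply, smul_apply, ContinuousLinearMap.smulRight_apply, smul_eq_mul]
  rw [← Finset.sum_sub_distrib]
  refine Finset.sum_congr rfl fun c _ => ?_
  -- By symmetry, the second derivatives of the functions `z c` cancel in the antisymmetrization.
  rw [(hs c).eq (mvfderiv (𝓡 n) (fun y : M => φ y) x v)]
  have e : ∀ (f : SFun n M) (v : Tan n x), fderiv ℝ (fun u => f (φ.symm u)) (φ x)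
      (mvfderiv (𝓡 n) (fun y : M => φ y) x v) = mvfderiv (𝓡 n) f x v :=
    fun f v => fderiv_comp_extChartAt_symm f x v
  simp only [ta, tz, e]
  ring

/-- The value of a smooth form on a vector field, as a smooth function. -/
def IsSmoothForm.apply {θ : Π x : M, Cot n x} (hθ : IsSmoothForm θ) (X : VField n M) : SFun n M :=
  ⟨fun y => θ y (X y), hθ X⟩

theorem contMDiff_extD_apply {θ : Π x : M, Cot n x} (hθ : IsSmoothForm θ) (X Y : VField n M) :
    ContMDiff (𝓡 n) 𝓘(ℝ, ℝ) ∞ (fun y => extD θ y (X y) (Y y)) := by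
  intro x₀
  obtain ⟨z, E, hzE⟩ := exists_coordinates (n := n) x₀
  have h1 : ∀ᶠ y in 𝓝 x₀, extD θ y (X y) (Y y) = ∑ c,
      (mvfderiv (𝓡 n) (hθ.apply (E c)) y (X y) * mvfderiv (𝓡 n) (z c) y (Y y) -
        mvfderiv (𝓡 n) (hθ.apply (E c)) y (Y y) * mvfderiv (𝓡 n) (z c) y (X y)) := by
    filter_upwards [eventually_eventually_nhds.2 hzE] with y hy
    exact extD_eq_of_eventually (fun c => hθ.apply (E c)) z
      (hy.mono fun u hu => cot_eq_sum_smul_of_dual hu (θ u)) _ _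
  refine ContMDiffAt.congr_of_eventuallyEq ?_ h1
  exact contMDiffAt_finsetSum fun c _ =>
    ((contMDiff_mvfderiv_apply _ _ x₀).mul (contMDiff_mvfderiv_apply _ _ x₀)).sub
      ((contMDiff_mvfderiv_apply _ _ x₀).mul (contMDiff_mvfderiv_apply _ _ x₀))

/-- Adding `g df` with `dg` proportional to `df` does not change the exterior derivative. -/
theorem extD_add_smul_mvfderiv {θ : Π x : M, Cot n x} (hθ : IsSmoothForm θ) (g f : SFun n M) {x : M}
    {r : ℝ} (hr : mvfderiv (𝓡 n) g x = r • mvfderiv (𝓡 n) f x) :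
    extD (fun x => θ x + g x • mvfderiv (𝓡 n) f x) x = extD θ x := by
  obtain ⟨z, E, hzE⟩ := exists_coordinates (n := n) x
  have h1 : ∀ᶠ y in 𝓝 x, θ y = ∑ c, hθ.apply (E c) y • mvfderiv (𝓡 n) (z c) y :=
    hzE.mono fun u hu => cot_eq_sum_smul_of_dual hu (θ u)
  -- The index `none` carries the extra term `g df`; it contributes `dg ∧ df`, which is zero since
  -- `dg` is proportional to `df` at `x`.
  have h2 : ∀ᶠ y in 𝓝 x, θ y + g y • mvfderiv (𝓡 n) f y =
      ∑ c : Option (Fin n), (c.elim g fun c => hθ.apply (E c) : SFun n M) y •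
        mvfderiv (𝓡 n) (c.elim f z : SFun n M) y := by
    filter_upwards [h1] with y hy
    rw [Fintype.sum_option, hy, add_comm]
    rfl
  refine LinearMap.ext₂ fun v w => ?_
  rw [extD_eq_of_eventually _ _ h2, extD_eq_of_eventually _ _ h1, Fintype.sum_option]
  simp only [Option.elim, hr, smul_apply, smul_eq_mul]
  ring

end ExteriorDerivative

/-! ### Adding a scalar 1-form to a connection. -/

section ScalarForms

open Topology Filter

variable {n : ℕ} {M : Type*} [TopologicalSpace M] [ChartedSpace (EuclideanSpace ℝ (Fin n)) M]
  [IsManifold (𝓡 n) ∞ M] {F : Type*} [NormedAddCommGroup F] [NormedSpace ℝ F]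
  {V : M → Type*} [TopologicalSpace (TotalSpace F V)] [∀ x, AddCommGroup (V x)]
  [∀ x, Module ℝ (V x)] [∀ x, TopologicalSpace (V x)] [∀ x, IsTopologicalAddGroup (V x)]
  [∀ x, ContinuousSMul ℝ (V x)] [FiberBundle F V] [VectorBundle ℝ F V]
  [ContMDiffVectorBundle ∞ F V (𝓡 n)]

/-- The connection `∇ + a ⊗ id`. -/
def addScalar (N : CovariantDerivative (𝓡 n) F V) (a : Π x : M, Cot n x) :
    CovariantDerivative (𝓡 n) F V where
  toFun s x := N s x + (a x).smulRight (s x)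
  isCovariantDerivativeOnUniv :=
    { add := by
        intro s t x hs ht _
        rw [N.isCovariantDerivativeOnUniv.add hs ht]
        ext1 v
        simp only [add_apply, ContinuousLinearMap.smulRight_apply, Pi.add_apply, smul_add]
        abel
      leibniz := by
        intro s g x hs hg _
        rw [N.isCovariantDerivativeOnUniv.leibniz hs hg]
        ext1 v
        simp only [add_apply, smul_apply, ContinuousLinearMap.smulRight_apply, Pi.smul_apply',
          smul_add]
        rw [smul_comm (a x v)]
        abel }

theorem addScalar_apply (N : CovariantDerivative (𝓡 n) F V) (a : Π x : M, Cot n x)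
    (s : Π x, V x) (x : M) (v : Tan n x) : addScalar N a s x v = N s x v + a x v • s x := rfl

theorem contMDiff_addScalar [T2Space M] {N : CovariantDerivative (𝓡 n) F V}
    (hN : CovariantDerivative.ContMDiffCovariantDerivative N ∞) {a : Π x : M, Cot n x}
    (ha : IsSmoothForm a) :
    CovariantDerivative.ContMDiffCovariantDerivative (addScalar N a) ∞ :=
  contMDiffCovariantDerivative_of_apply _ fun s X =>
    (contMDiff_cov_apply hN s X).add_section ((ha X).smul_section s.contMDiff)

end ScalarForms

/-! ### Torsion forms, Chern connections and conformal changes. -/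

section Torsion

open Topology Filter

variable {n : ℕ} {M : Type*} [TopologicalSpace M] [ChartedSpace (EuclideanSpace ℝ (Fin n)) M]

theorem trace_eq_sum_of_dual {x : M} {θ : Fin n → Cot n x} {e : Fin n → Tan n x}
    (h : ∀ i j, θ i (e j) = if i = j then 1 else 0) (f : Tan n x →ₗ[ℝ] Tan n x) :
    LinearMap.trace ℝ (Tan n x) f = ∑ i, θ i (f (e i)) := by
  have h1 : f = ∑ i, (θ i : Tan n x →ₗ[ℝ] ℝ).smulRight (f (e i)) := by
    refine LinearMap.ext fun v => ?_
    conv_lhs => rw [eq_sum_smul_of_dual h v, map_sum]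
    simp
  conv_lhs => rw [h1, map_sum]
  simp

variable [IsManifold (𝓡 n) ∞ M]

theorem torsionForm_eq_sum_of_dual (D : AffConn n M) {x : M} {θ : Fin n → Cot n x}
    {e : Fin n → Tan n x} (h : ∀ i j, θ i (e j) = if i = j then 1 else 0) (u : Tan n x) :
    torsionForm D x u = ∑ i, θ i (D.torsion x u (e i)) :=
  trace_eq_sum_of_dual h (D.torsion x u : Tan n x →ₗ[ℝ] Tan n x)

theorem torsion_addScalar (D : AffConn n M) (a : Π x : M, Cot n x) (x : M) (u w : Tan n x) :
    (addScalar D a).torsion x u w = D.torsion x u w + (a x u • w - a x w • u) := by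
  rw [CovariantDerivative.torsion_apply_eq_extend, CovariantDerivative.torsion_apply_eq_extend]
  have h1 : ∀ w' u' : Tan n x, (addScalar D a) (extend (Mdl n) w') x u' =
      D (extend (Mdl n) w') x u' + a x u' • w' := by
    intro w' u'
    rw [addScalar_apply, extend_apply_self]
  simp only [extend_apply_self, h1]
  abel

/-- The torsion changes by `w ↦ a(u) w - a(w) u`, whose trace is `n a(u) - a(u)`. -/
theorem torsionForm_addScalar (D : AffConn n M) (a : Π x : M, Cot n x) (x : M) :
    torsionForm (addScalar D a) x = torsionForm D x + ((n : ℝ) - 1) • a x := by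
  ext u
  rw [torsionForm_eq_sum_of_dual _ (tcoord_tbasis x), add_apply,
    torsionForm_eq_sum_of_dual _ (tcoord_tbasis x)]
  simp only [torsion_addScalar, map_add, map_sub, map_smul, Finset.sum_add_distrib,
    Finset.sum_sub_distrib, tcoord_tbasis, if_true, smul_apply]
  congr 1
  have h1 : a x u = ∑ i, a x (tbasis x i) • tcoord x i u := by
    conv_lhs => rw [cot_eq_sum_smul_of_dual (tcoord_tbasis x) (a x)]
    simp
  rw [← h1]
  simp
  ring

theorem chernConn_apply (D : AffConn n M) (V : Π x : M, Tan n x) (x : M) (v : Tan n x) :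
    chernConn D V x v = D V x v - (1 / ((n : ℝ) - 1) * torsionForm D x v) • V x := by
  rw [sub_eq_add_neg, ← neg_smul, ← neg_mul, mul_smul]
  rfl

/-- The torsion form grows by `(n - 1) a`, so the Chern correction subtracts exactly the `a` that
was added. The division needs `n ≠ 1`. -/
theorem chernConn_addScalar (hn : 2 ≤ n) (D : AffConn n M) (a : Π x : M, Cot n x)
    (V : Π x : M, Tan n x) (x : M) : chernConn (addScalar D a) V x = chernConn D V x := by
  have h1 : (n : ℝ) - 1 ≠ 0 := by
    have : (2 : ℝ) ≤ n := by exact_mod_cast hn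
    linarith
  ext1 v
  rw [chernConn_apply, chernConn_apply, torsionForm_addScalar, addScalar_apply, add_apply,
    smul_apply, smul_eq_mul, mul_add, add_smul, ← mul_assoc, one_div_mul_cancel h1, one_mul]
  abel

theorem torsionForm_congr {D D' : AffConn n M} {x : M}
    (h : ∀ w : Tan n x, D (extend (Mdl n) w) x = D' (extend (Mdl n) w) x) :
    torsionForm D x = torsionForm D' x := by
  ext u
  rw [torsionForm_eq_sum_of_dual _ (tcoord_tbasis x), torsionForm_eq_sum_of_dual _ (tcoord_tbasis x)]
  refine Finset.sum_congr rfl fun i _ => ?_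
  rw [CovariantDerivative.torsion_apply_eq_extend, CovariantDerivative.torsion_apply_eq_extend,
    h, h]

theorem chernConn_congr {D D' : AffConn n M} {x : M}
    (h : ∀ w : Tan n x, D (extend (Mdl n) w) x = D' (extend (Mdl n) w) x) (w : Tan n x) :
    chernConn D (extend (Mdl n) w) x = chernConn D' (extend (Mdl n) w) x := by
  ext1 v
  rw [chernConn_apply, chernConn_apply, torsionForm_congr h, h]

variable [T2Space M]

theorem isSmoothForm_torsionForm {D : AffConn n M}
    (hD : CovariantDerivative.ContMDiffCovariantDerivative D ∞) : IsSmoothForm (torsionForm D) := by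
  intro X x₀
  obtain ⟨z, E, hzE⟩ := exists_coordinates (n := n) x₀
  have h1 : ∀ᶠ y in 𝓝 x₀, torsionForm D y (X y) = ∑ i, mvfderiv (𝓡 n) (z i) y
      (D (E i) y (X y) - D X y (E i y) - VectorField.mlieBracket (𝓡 n) X (E i) y) := by
    filter_upwards [hzE] with y hy
    rw [torsionForm_eq_sum_of_dual D hy]
    refine Finset.sum_congr rfl fun i _ => ?_
    rw [CovariantDerivative.torsion_apply D (section_mdifferentiableAt X y)
      (section_mdifferentiableAt (E i) y)]
  refine ContMDiffAt.congr_of_eventuallyEq ?_ h1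
  refine contMDiffAt_finsetSum fun i _ => contMDiffAt_mvfderiv_apply (z i) ?_
  refine ContMDiffAt.sub_section (ContMDiffAt.sub_section (contMDiff_cov_apply hD _ _ x₀)
    (contMDiff_cov_apply hD _ _ x₀)) ?_
  have hM : IsManifold (𝓡 n) (minSmoothness ℝ 2) M := by
    rw [minSmoothness_of_isRCLikeNormedField]
    infer_instance
  have hM' : IsManifold (𝓡 n) ((⊤ : ℕ∞) + 1 : WithTop ℕ∞) M :=
    inferInstanceAs (IsManifold (𝓡 n) ∞ M)
  exact ContMDiffAt.mlieBracket_vectorField (m := ⊤) (n := ⊤) (X.contMDiff x₀)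
    ((E i).contMDiff x₀) (by simp)

theorem IsSmoothForm.smul_const {θ : Π x : M, Cot n x} (hθ : IsSmoothForm θ) (c : ℝ) :
    IsSmoothForm (fun x => c • θ x) := fun X => contMDiff_const.mul (hθ X)

theorem IsSmoothForm.smul {θ : Π x : M, Cot n x} (hθ : IsSmoothForm θ) (f : SFun n M) :
    IsSmoothForm (fun x => f x • θ x) := fun X => f.contMDiff.mul (hθ X)

theorem contMDiff_chernConn {D : AffConn n M}
    (hD : CovariantDerivative.ContMDiffCovariantDerivative D ∞) :
    CovariantDerivative.ContMDiffCovariantDerivative (chernConn D) ∞ := by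
  refine contMDiffCovariantDerivative_of_apply _ fun V X => ?_
  simp only [chernConn_apply]
  exact (contMDiff_cov_apply hD V X).sub_section
    (((isSmoothForm_torsionForm hD).smul_const _ X).smul_section V.contMDiff)

theorem dualCov_addScalar (D : AffConn n M) (a : Π x : M, Cot n x) {θ : Π x : M, Cot n x}
    (hθ : IsSmoothForm θ) (x : M) (v : Tan n x) :
    dualCov (addScalar D a) θ x v = dualCov D θ x v - a x v • θ x := by
  ext w
  have h1 := dualCov_apply (addScalar D a) hθ (mdifferentiableAt_extend_tan w) v
  have h2 := dualCov_apply D hθ (mdifferentiableAt_extend_tan w) v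
  rw [extend_apply_self] at h1 h2
  rw [sub_apply, h1, h2, addScalar_apply, extend_apply_self, map_add, map_smul, smul_apply]
  simp only [smul_eq_mul]
  ring

theorem IsSmoothContra.contMDiff_apply {k : ℕ} {σ : Π x : M, Contra n k x} (hσ : IsSmoothContra σ)
    {θ : Fin k → Π x : M, Cot n x} (hθ : ∀ i, IsSmoothForm (θ i)) :
    ContMDiff (𝓡 n) 𝓘(ℝ, ℝ) ∞ (fun y => σ y (fun i => θ i y)) := by
  intro x₀
  obtain ⟨z, E, hzE⟩ := exists_coordinates (n := n) x₀
  have h1 : ∀ᶠ y in 𝓝 x₀, σ y (fun p => θ p y) = ∑ J : Fin k → Fin n,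
      (∏ p, θ p y (E (J p) y)) * σ y (fun p => mvfderiv (𝓡 n) (z (J p)) y) := by
    filter_upwards [hzE] with y hy
    have h2 : (fun p => θ p y) = fun p => ∑ i, θ p y (E i y) • mvfderiv (𝓡 n) (z i) y :=
      funext fun p => cot_eq_sum_smul_of_dual hy (θ p y)
    rw [h2, (σ y).map_sum]
    exact Finset.sum_congr rfl fun J _ => (σ y).map_smul_univ _ _
  refine ContMDiffAt.congr_of_eventuallyEq ?_ h1
  exact contMDiffAt_finsetSum fun J _ =>
    (contMDiffAt_finsetProd fun p _ => hθ p (E (J p)) x₀).mul (hσ (fun p => z (J p)) x₀)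

/-- The Wagner connection of a symbol multiplied by a function. -/
theorem IsWagner.addScalar_smul {m : ℕ} {σ : Π x : M, Contra n (m + 1) x} (hσ : IsSmoothContra σ)
    {D : AffConn n M} (hD : IsWagner σ D) (f g : SFun n M)
    (hg : ∀ x, ((m : ℝ) + 1) * f x * g x = -1) :
    IsWagner (fun x => f x • σ x) (addScalar D fun x => g x • mvfderiv (𝓡 n) f x) := by
  refine ⟨contMDiff_addScalar hD.1 ((isSmoothForm_mvfderiv f).smul g), fun θ hθ x v => ?_⟩
  have h1 := mvfderiv_mul (sfun_mdifferentiableAt f x)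
    ((hσ.contMDiff_apply hθ).contMDiffAt.mdifferentiableAt (by simp) (x := x))
  have h2 : mvfderiv (𝓡 n) (fun y => f y * σ y (fun i => θ i y)) x v =
      f x * mvfderiv (𝓡 n) (fun y => σ y (fun i => θ i y)) x v +
        σ x (fun i => θ i x) * mvfderiv (𝓡 n) f x v :=
    congrArg (fun L : Tan n x →L[ℝ] ℝ => L v) h1
  refine h2.trans ?_
  rw [hD.2 θ hθ]
  -- The induced connection on 1-forms changes by `-g df`. Each of the `m + 1` slots contributes `-f
  -- g df(v) σ`, and together these give the term `df(v) σ` of the product rule because `(m + 1) f g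
  -- = -1`.
  have h3 : ∀ i, (f x • σ x) (Function.update (fun i => θ i x) i
      (dualCov (addScalar D fun x => g x • mvfderiv (𝓡 n) f x) (θ i) x v)) =
      f x * σ x (Function.update (fun i => θ i x) i (dualCov D (θ i) x v)) -
        f x * (g x * mvfderiv (𝓡 n) f x v) * σ x (fun i => θ i x) := by
    intro i
    rw [dualCov_addScalar D _ (hθ i), smul_apply, (σ x).map_update_sub, (σ x).map_update_smul,
      Function.update_eq_self, smul_eq_mul, smul_apply, smul_eq_mul, smul_eq_mul]
    ring
  simp only [h3]
  rw [Finset.sum_sub_distrib, ← Finset.mul_sum, Finset.sum_const, Finset.card_univ,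
    Fintype.card_fin, nsmul_eq_mul]
  push_cast
  linear_combination ((mvfderiv (𝓡 n) f x v * σ x (fun i => θ i x))) * hg x

end Torsion

/-! ### Smoothness of the subsymbol. -/

section SmoothSubsymbol

open Topology Filter

variable {n : ℕ} {M : Type*} [TopologicalSpace M] [ChartedSpace (EuclideanSpace ℝ (Fin n)) M]
  [IsManifold (𝓡 n) ∞ M] [T2Space M]
  {ξ : M → Type*} [TopologicalSpace (TotalSpace ℝ ξ)]
  [∀ x, AddCommGroup (ξ x)] [∀ x, Module ℝ (ξ x)] [∀ x, TopologicalSpace (ξ x)]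
  [FiberBundle ℝ ξ] [VectorBundle ℝ ℝ ξ] [ContMDiffVectorBundle ∞ ℝ ξ (𝓡 n)]

variable [∀ x, IsTopologicalAddGroup (ξ x)] [∀ x, ContinuousSMul ℝ (ξ x)]

theorem contMDiff_contract {k : ℕ} {σ : Π x : M, Contra n k x} (hσ : IsSmoothContra σ)
    {η : Π x : M, (Fin k → Tan n x) → ξ x} (hη : IsSmoothTensor η) :
    ContMDiff (𝓡 n) ((𝓡 n).prod 𝓘(ℝ, ℝ)) ∞
      (fun y => (⟨y, contract (σ y) (η y)⟩ : TotalSpace ℝ ξ)) := by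
  intro x₀
  obtain ⟨z, E, hzE⟩ := exists_coordinates (n := n) x₀
  refine contMDiffAt_congr_section (t := fun y => ∑ J : Fin k → Fin n,
    σ y (fun a => mvfderiv (𝓡 n) (z (J a)) y) • η y (fun a => E (J a) y)) ?_ ?_
  · filter_upwards [hzE] with y hy
    obtain ⟨μ, hμ⟩ := hη.multilinear y
    rw [show η y = μ from funext hμ]
    exact contract_eq_of_dual hy (σ y) μ
  · exact ContMDiffAt.sum_section fun J _ => (hσ (fun a => z (J a)) x₀).smul_section
      (hη.smooth (fun a => E (J a)) x₀)

theorem isSmoothContra_subsymbol {m : ℕ} {A : Sec n ξ →ₗ[ℝ] Sec n ξ} (hA : IsDiffOp (m + 1) A)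
    {D : AffConn n M} {N : LinConn n ξ}
    (hD : CovariantDerivative.ContMDiffCovariantDerivative D ∞)
    (hN : CovariantDerivative.ContMDiffCovariantDerivative N ∞) :
    IsSmoothContra (subsymbol m A D N) := by
  let Q : Sec n ξ →ₗ[ℝ] Sec n ξ :=
    { toFun := fun s => ⟨quantize D N (principal m A) s,
        contMDiff_contract (isSmoothContra_principal hA) (isSmoothTensor_dSymPow hD hN (m + 1) s)⟩
      map_add' := fun s t => by
        ext x
        exact (quantizeAt hD hN (principal m A) x).map_add s t
      map_smul' := fun c s => by
        ext x
        exact (quantizeAt hD hN (principal m A) x).map_smul c s }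
  exact isSmoothContra_of_isSymbolAt (A := A - Q) fun x => isSymbolAt_subsymbol hA hD hN x

end SmoothSubsymbol

/-! ### Connections in a line bundle. -/

section LineConnections

open Topology Filter

variable {n : ℕ} {M : Type*} [TopologicalSpace M] [ChartedSpace (EuclideanSpace ℝ (Fin n)) M]
  [IsManifold (𝓡 n) ∞ M] [T2Space M]
  {ξ : M → Type*} [TopologicalSpace (TotalSpace ℝ ξ)]
  [∀ x, AddCommGroup (ξ x)] [∀ x, Module ℝ (ξ x)] [∀ x, TopologicalSpace (ξ x)]
  [FiberBundle ℝ ξ] [VectorBundle ℝ ℝ ξ] [ContMDiffVectorBundle ∞ ℝ ξ (𝓡 n)]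
  [∀ x, IsTopologicalAddGroup (ξ x)] [∀ x, ContinuousSMul ℝ (ξ x)]

/-- The difference of two connections in a line bundle is a 1-form. -/
theorem exists_form_eq_sub (N N' : LinConn n ξ) : ∃ a : Π x : M, Cot n x,
    ∀ (s : Π x, ξ x) (x : M), MDifferentiableAt (𝓡 n) ((𝓡 n).prod 𝓘(ℝ, ℝ))
      (fun y => (⟨y, s y⟩ : TotalSpace ℝ ξ)) x → ∀ u, N' s x u = N s x u + a x u • s x := by
  have h : ∀ x : M, ∃ a : Cot n x, ∀ s : Π x, ξ x, MDifferentiableAt (𝓡 n) ((𝓡 n).prod 𝓘(ℝ, ℝ))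
      (fun y => (⟨y, s y⟩ : TotalSpace ℝ ξ)) x → ∀ u, N' s x u = N s x u + a u • s x := by
    intro x
    obtain ⟨s₀, hs₀⟩ := exists_section_ne_zero (n := n) (ξ := ξ) x
    obtain ⟨c, hc1, hc⟩ := exists_linear_coeff hs₀.self_of_nhds
    -- The form is read off from one local generator `s₀`. For `s = f s₀` the terms with the
    -- derivative of `f` are the same for both connections.
    refine ⟨LinearMap.toContinuousLinearMap
      (c ∘ₗ ((N' s₀ x - N s₀ x : Tan n x →L[ℝ] ξ x) : Tan n x →ₗ[ℝ] ξ x)), fun s hs u => ?_⟩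
    have h1 : ∀ y, ∃ r : ℝ, s₀ y ≠ 0 → s y = r • s₀ y := by
      intro y
      by_cases hy : s₀ y = 0
      · exact ⟨0, fun h => absurd hy h⟩
      · obtain ⟨c, -, hc⟩ := exists_linear_coeff hy
        exact ⟨c (s y), fun _ => (hc _).symm⟩
    choose f hf using h1
    have hf' : ∀ᶠ y in 𝓝 x, s y = f y • s₀ y := hs₀.mono fun y hy => hf y hy
    have hd := mdifferentiableAt_coeff hs (s₀.contMDiff x) hs₀ hf'
    have hfs : MDifferentiableAt (𝓡 n) ((𝓡 n).prod 𝓘(ℝ, ℝ))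
        (fun y => (⟨y, f y • s₀ y⟩ : TotalSpace ℝ ξ)) x :=
      hd.smul_section (section_mdifferentiableAt s₀ x)
    have h2 : ∀ N : LinConn n ξ, N s x u = f x • N s₀ x u + mvfderiv (𝓡 n) f x u • s₀ x := by
      intro N
      rw [cov_congr N hfs hf']
      have h3 := N.isCovariantDerivativeOnUniv.leibniz (section_mdifferentiableAt s₀ x) hd
      exact congrArg (fun L : Tan n x →L[ℝ] ξ x => L u) h3
    rw [h2 N', h2 N, hf'.self_of_nhds]
    change _ = _ + c (N' s₀ x u - N s₀ x u) • f x • s₀ x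
    rw [smul_comm, hc, smul_sub]
    abel
  choose a ha using h
  exact ⟨a, fun s x hs u => ha x s hs u⟩

/-- Line bundles have smooth connections. -/
theorem exists_linConn [SigmaCompactSpace M] :
    ∃ N : LinConn n ξ, CovariantDerivative.ContMDiffCovariantDerivative N ∞ := by
  choose t ht using fun x : M => exists_section_ne_zero (n := n) (ξ := ξ) x
  choose U hU hUo hxU using fun x => eventually_nhds_iff.1 (ht x)
  obtain ⟨ρ, hρ⟩ := SmoothPartitionOfUnity.exists_isSubordinate (𝓡 n) (isClosed_univ (X := M)) U hUo
    (fun x _ => Set.mem_iUnion.2 ⟨x, hxU x⟩)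
  have hc : ∀ i y, ∃ c : ξ y →ₗ[ℝ] ℝ, t i y ≠ 0 → ∀ v, c v • t i y = v := by
    intro i y
    by_cases hy : t i y = 0
    · exact ⟨0, fun h => absurd hy h⟩
    · obtain ⟨c, -, hc⟩ := exists_linear_coeff hy
      exact ⟨c, fun _ => hc⟩
  choose c hc using hc
  have hne : ∀ i x, x ∈ tsupport (ρ i) → ∀ᶠ y in 𝓝 x, t i y ≠ 0 := fun i x hx =>
    (hUo i).mem_nhds (hρ i hx) |> fun h => Filter.mem_of_superset h fun y hy => hU i y hy
  have hcd : ∀ i (s : Π x, ξ x) x, x ∈ tsupport (ρ i) →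
      MDifferentiableAt (𝓡 n) ((𝓡 n).prod 𝓘(ℝ, ℝ)) (fun y => (⟨y, s y⟩ : TotalSpace ℝ ξ)) x →
      MDifferentiableAt (𝓡 n) 𝓘(ℝ, ℝ) (fun y => c i y (s y)) x := fun i s x hx hs =>
    mdifferentiableAt_coeff hs ((t i).contMDiff x) (hne i x hx)
      ((hne i x hx).mono fun y hy => (hc i y hy _).symm)
  let S : M → Finset M := fun x => (ρ.locallyFinite.point_finite x).toFinset
  have hS : ∀ x i, i ∈ S x ↔ ρ i x ≠ 0 := fun x i => by simp [S]
  have hts : ∀ x i, i ∈ S x → x ∈ tsupport (ρ i) := fun x i hi =>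
    subset_tsupport _ ((hS x i).1 hi)
  -- The flat connections with parallel sections `t i` are glued by the partition of unity. The
  -- coefficient functional `c i` is meaningful only where `t i` does not vanish, which holds on a
  -- neighbourhood of the support of `ρ i`.
  let N : LinConn n ξ :=
    { toFun := fun s x => ∑ i ∈ S x, ρ i x • (mvfderiv (𝓡 n) (fun y => c i y (s y)) x).smulRight (t i x)
      isCovariantDerivativeOnUniv :=
        { add := by
            intro s s' x hs hs' _
            rw [← Finset.sum_add_distrib]
            refine Finset.sum_congr rfl fun i hi => ?_
            have h1 := mvfderiv_add (hcd i s x (hts x i hi) hs) (hcd i s' x (hts x i hi) hs')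
            have h2 : (fun y => c i y ((s + s') y)) = (fun y => c i y (s y)) + fun y => c i y (s' y) := by
              funext y
              exact map_add _ _ _
            rw [h2, h1, ← smul_add]
            congr 1
            ext1 v
            exact add_smul _ _ _
          leibniz := by
            intro s g x hs hg _
            ext1 v
            have h1 : ∀ i ∈ S x, mvfderiv (𝓡 n) (fun y => c i y ((g • s) y)) x v =
                g x * mvfderiv (𝓡 n) (fun y => c i y (s y)) x v + c i x (s x) * mvfderiv (𝓡 n) g x v := by
              intro i hi
              have h1 := mvfderiv_mul hg (hcd i s x (hts x i hi) hs)
              have h2 : (fun y => c i y ((g • s) y)) = g * fun y => c i y (s y) := by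
                funext y
                exact (c i y).map_smul (g y) (s y)
              rw [h2, h1]
              rfl
            have h2 : s x = ∑ i ∈ S x, ρ i x • s x := by
              rw [← Finset.sum_smul]
              have h3 : ∑ᶠ i, ρ i x = 1 := ρ.sum_eq_one (Set.mem_univ x)
              rw [finsum_eq_sum_of_support_subset _ (s := S x) (fun i hi => (hS x i).2 hi)] at h3
              rw [h3, one_smul]
            rw [add_apply, smul_apply, ContinuousLinearMap.smulRight_apply]
            conv_rhs => rw [h2]
            rw [sum_apply, sum_apply, Finset.smul_sum, Finset.smul_sum, ← Finset.sum_add_distrib]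
            refine Finset.sum_congr rfl fun i hi => ?_
            rw [smul_apply, smul_apply, ContinuousLinearMap.smulRight_apply,
              ContinuousLinearMap.smulRight_apply, h1 i hi]
            conv_rhs => rw [← hc i x (hne i x (hts x i hi)).self_of_nhds (s x)]
            simp only [smul_smul, ← add_smul]
            congr 1
            ring } }
  refine ⟨N, contMDiffCovariantDerivative_of_apply N fun s X x₀ => ?_⟩
  obtain ⟨W, hW, hfin⟩ := ρ.locallyFinite x₀
  refine contMDiffAt_congr_section (t := fun y => ∑ i ∈ hfin.toFinset, ρ i y •
    mvfderiv (𝓡 n) (fun y => c i y (s y)) y (X y) • t i y) ?_ ?_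
  · filter_upwards [hW] with y hy
    have h1 : N s y (X y) = ∑ i ∈ S y, ρ i y •
        mvfderiv (𝓡 n) (fun y => c i y (s y)) y (X y) • t i y := by
      change (∑ i ∈ S y, ρ i y •
        (mvfderiv (𝓡 n) (fun y => c i y (s y)) y).smulRight (t i y) : Tan n y →L[ℝ] ξ y) (X y) = _
      rw [sum_apply]
      rfl
    rw [h1]
    refine Finset.sum_subset (fun i hi => ?_) fun i _ hi => ?_
    · rw [Set.Finite.mem_toFinset]
      exact ⟨y, (hS y i).1 hi, hy⟩
    · rw [show ρ i y = 0 by simpa [hS] using hi, zero_smul]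
  · refine ContMDiffAt.sum_section fun i _ => ?_
    by_cases hx : x₀ ∈ tsupport (ρ i)
    · obtain ⟨f, hf⟩ := exists_sfun_eventuallyEq (n := n) (fun y => c i y (s y)) x₀ (by
        filter_upwards [eventually_eventually_nhds.2 (hne i x₀ hx)] with y hy
        exact contMDiffAt_coeff s.contMDiff.contMDiffAt (t i).contMDiff.contMDiffAt hy
          (hy.mono fun u hu => (hc i u hu _).symm))
      refine contMDiffAt_congr_section
        (t := fun y => ρ i y • mvfderiv (𝓡 n) f y (X y) • t i y) ?_ ?_
      · filter_upwards [eventually_eventually_nhds.2 hf] with y hy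
        rw [mvfderiv_congr hy]
      · exact ((ρ i).contMDiff x₀).smul_section
          ((contMDiff_mvfderiv_apply f X x₀).smul_section ((t i).contMDiff x₀))
    · refine contMDiffAt_congr_section (t := fun y => (0 : ξ y)) ?_
        (contMDiff_zeroSection ℝ ξ x₀)
      filter_upwards [(isClosed_tsupport (ρ i)).isOpen_compl.mem_nhds hx] with y hy
      rw [image_eq_zero_of_notMem_tsupport hy, zero_smul]

end LineConnections

/-! ### The pairing on tensors defined by `ω` and `σ`. -/

section Pairing

open Topology Filter

variable {n m : ℕ} {M : Type*} [TopologicalSpace M] [ChartedSpace (EuclideanSpace ℝ (Fin n)) M]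

/-- The pairing `(γ, ψ) ↦ ⟨γ, ω̂ (ψ ⌟ σ)⟩`. -/
def omegaPairing {x : M} (om : LinearMap.BilinForm ℝ (Tan n x)) (σ : Contra n (m + 1) x) :
    Contra n m x →ₗ[ℝ] Cot n x →ₗ[ℝ] ℝ :=
  LinearMap.mk₂ ℝ (fun γ ψ => contract γ (omegaHat om (σ.curryLeft ψ)))
    (by intros; simp only [contract, add_apply, add_smul, Finset.sum_add_distrib])
    (by intros; simp only [contract, smul_apply, smul_assoc, Finset.smul_sum])
    (by
      intro γ ψ ψ'
      rw [map_add]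
      exact contract_add γ _ _)
    (by
      intro c γ ψ
      rw [map_smul]
      exact contract_smul γ c _)

theorem omegaPairing_apply {x : M} (om : LinearMap.BilinForm ℝ (Tan n x)) (σ : Contra n (m + 1) x)
    (γ : Contra n m x) (ψ : Cot n x) :
    omegaPairing om σ γ ψ = contract γ (omegaHat om (σ.curryLeft ψ)) := rfl

theorem mem_annSpace_iff {x : M} {om : LinearMap.BilinForm ℝ (Tan n x)} {σ : Contra n (m + 1) x}
    {γ : Contra n m x} (hγ : γ ∈ symPow m x) :
    γ ∈ annSpace om σ ↔ ∀ ψ, omegaPairing om σ γ ψ = 0 := by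
  constructor
  · rintro ⟨-, h⟩ ψ
    exact h _ ⟨ψ, rfl⟩
  · refine fun h => ⟨hγ, ?_⟩
    rintro _ ⟨ψ, rfl⟩
    exact h ψ

theorem annSpace_smul {x : M} (om : LinearMap.BilinForm ℝ (Tan n x)) (σ : Contra n (m + 1) x)
    {r : ℝ} (hr : r ≠ 0) : annSpace om (r • σ) = annSpace om σ := by
  have h1 : ∀ ψ, (r • σ).curryLeft ψ = σ.curryLeft (r • ψ) := by
    intro ψ
    rw [map_smul]
    rfl
  have h2 : contrSpace (r • σ) = contrSpace σ := by
    ext l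
    constructor
    · rintro ⟨ψ, rfl⟩
      exact ⟨r • ψ, (h1 ψ).symm⟩
    · rintro ⟨ψ, rfl⟩
      refine ⟨r⁻¹ • ψ, ?_⟩
      rw [h1, smul_smul, mul_inv_cancel₀ hr, one_smul]
  ext γ
  change (_ ∧ ∀ l ∈ contrSpace (r • σ), _) ↔ (_ ∧ ∀ l ∈ contrSpace σ, _)
  rw [h2]

/-- A nondegenerate pairing allows to correct each tensor by a unique contraction `a ⌟ σ`. -/
theorem exists_sub_curryLeft_mem {x : M} {om : LinearMap.BilinForm ℝ (Tan n x)}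
    {σ : Contra n (m + 1) x}
    (hinj : ∀ a : Cot n x, (∀ ψ, omegaPairing om σ (σ.curryLeft a) ψ = 0) → a = 0)
    (γ : Contra n m x) :
    ∃ a : Cot n x, ∀ ψ, omegaPairing om σ (γ - ((m : ℝ) + 1) • σ.curryLeft a) ψ = 0 := by
  let L := Fintype.linearCombination ℝ (tcoord (n := n) x)
  -- `T` is the matrix of the bilinear form `(a, ψ) ↦ ⟨a ⌟ σ, ω̂ (ψ ⌟ σ)⟩` on covectors. It is
  -- injective by `hinj`, hence surjective, which solves for `a`.
  let T : (Fin n → ℝ) →ₗ[ℝ] (Fin n → ℝ) := LinearMap.pi fun j =>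
    (omegaPairing om σ).flip (tcoord x j) ∘ₗ (σ.curryLeft : Cot n x →ₗ[ℝ] Contra n m x) ∘ₗ L
  have hall : ∀ γ : Contra n m x, (∀ j, omegaPairing om σ γ (tcoord x j) = 0) →
      ∀ ψ, omegaPairing om σ γ ψ = 0 := by
    intro γ h ψ
    rw [cot_eq_sum_smul_of_dual (tcoord_tbasis x) ψ, map_sum]
    refine Finset.sum_eq_zero fun i _ => ?_
    rw [map_smul, h, smul_zero]
  have hT : Function.Injective T := by
    rw [← LinearMap.ker_eq_bot, LinearMap.ker_eq_bot']
    intro w hw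
    have h1 : L w = 0 := hinj _ (hall _ fun j => congrFun hw j)
    funext i
    have h2 := congrArg (fun φ : Cot n x => φ (tbasis x i)) h1
    simpa [L, Fintype.linearCombination_apply, tcoord_tbasis] using h2
  obtain ⟨w, hw⟩ := LinearMap.injective_iff_surjective.1 hT
    fun j => ((m : ℝ) + 1)⁻¹ * omegaPairing om σ γ (tcoord x j)
  refine ⟨L w, hall _ fun j => ?_⟩
  have h1 : omegaPairing om σ (σ.curryLeft (L w)) (tcoord x j) =
    ((m : ℝ) + 1)⁻¹ * omegaPairing om σ γ (tcoord x j) := congrFun hw j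
  have hm : (m : ℝ) + 1 ≠ 0 := by positivity
  rw [map_sub, map_smul, LinearMap.sub_apply, LinearMap.smul_apply, h1, smul_eq_mul,
    mul_inv_cancel_left₀ hm, sub_self]

variable [IsManifold (𝓡 n) ∞ M] [T2Space M]

theorem IsSmoothContra.curryLeft {σ : Π x : M, Contra n (m + 1) x} (hσ : IsSmoothContra σ)
    {φ : Π x : M, Cot n x} (hφ : IsSmoothForm φ) :
    IsSmoothContra (fun x => (σ x).curryLeft (φ x)) := by
  intro f
  let θ : Fin (m + 1) → Π x : M, Cot n x := Fin.cons φ fun i y => mvfderiv (𝓡 n) (f i) y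
  have h1 := hσ.contMDiff_apply (θ := θ) (by
    intro i
    refine Fin.cases ?_ (fun i => ?_) i
    · exact hφ
    · exact isSmoothForm_mvfderiv (f i))
  have h2 : ∀ y, (fun i => θ i y) = Fin.cons (φ y) fun i => mvfderiv (𝓡 n) (f i) y := by
    intro y
    funext i
    refine Fin.cases ?_ (fun i => ?_) i <;> rfl
  simp only [h2] at h1
  exact h1

theorem contMDiff_omegaPairing {σ : Π x : M, Contra n (m + 1) x} (hσ : IsSmoothContra σ)
    {θ : Π x : M, Cot n x} (hθ : IsSmoothForm θ) {γ : Π x : M, Contra n m x}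
    (hγ : IsSmoothContra γ) {ψ : Π x : M, Cot n x} (hψ : IsSmoothForm ψ) :
    ContMDiff (𝓡 n) 𝓘(ℝ, ℝ) ∞ (fun y => omegaPairing (extD θ y) (σ y) (γ y) (ψ y)) := by
  intro x₀
  obtain ⟨z, E, hzE⟩ := exists_coordinates (n := n) x₀
  let φ : VField n M → Π y : M, Cot n y := fun X y =>
    LinearMap.toContinuousLinearMap ((extD θ y).flip (X y))
  have hφ : ∀ X, IsSmoothForm (φ X) := fun X Y => contMDiff_extD_apply hθ Y X
  have h1 : ∀ᶠ y in 𝓝 x₀, omegaPairing (extD θ y) (σ y) (γ y) (ψ y) = ∑ J : Fin m → Fin n,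
      γ y (fun a => mvfderiv (𝓡 n) (z (J a)) y) *
        (σ y).curryLeft (ψ y) (fun a => φ (E (J a)) y) := by
    filter_upwards [hzE] with y hy
    rw [omegaPairing_apply, contract_eq_of_dual hy]
    rfl
  refine ContMDiffAt.congr_of_eventuallyEq ?_ h1
  exact contMDiffAt_finsetSum fun J _ => (hγ (fun a => z (J a)) x₀).mul
    ((hσ.curryLeft hψ).contMDiff_apply (fun a => hφ (E (J a))) x₀)

/-- Tested on the differentials of coordinates, `ha` becomes a smooth square linear system for the
components of `a`, with injectivity given by `hinj`. -/
theorem isSmoothForm_of_omegaPairing {σ : Π x : M, Contra n (m + 1) x} (hσ : IsSmoothContra σ)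
    {θ : Π x : M, Cot n x} (hθ : IsSmoothForm θ) {γ : Π x : M, Contra n m x}
    (hγ : IsSmoothContra γ) {a : Π x : M, Cot n x}
    (hinj : ∀ x (a : Cot n x),
      (∀ ψ, omegaPairing (extD θ x) (σ x) ((σ x).curryLeft a) ψ = 0) → a = 0)
    (ha : ∀ x ψ, omegaPairing (extD θ x) (σ x)
      (γ x - ((m : ℝ) + 1) • (σ x).curryLeft (a x)) ψ = 0) : IsSmoothForm a := by
  intro X x₀
  obtain ⟨z, E, hzE⟩ := exists_coordinates (n := n) x₀
  have h1 : ∀ᶠ y in 𝓝 x₀, a y (X y) = ∑ i, a y (E i y) * mvfderiv (𝓡 n) (z i) y (X y) := by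
    filter_upwards [hzE] with y hy
    conv_lhs => rw [eq_sum_smul_of_dual hy (X y), map_sum]
    exact Finset.sum_congr rfl fun i _ => by rw [map_smul, smul_eq_mul, mul_comm]
  refine ContMDiffAt.congr_of_eventuallyEq ?_ h1
  refine contMDiffAt_finsetSum fun i _ => ContMDiffAt.mul ?_ (contMDiff_mvfderiv_apply (z i) X x₀)
  have hm : (m : ℝ) + 1 ≠ 0 := by positivity
  have hsum : ∀ (y : M) (c : Fin n → ℝ) (ψ : Cot n y),
      ∑ i, c i * (((m : ℝ) + 1) * omegaPairing (extD θ y) (σ y)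
        ((σ y).curryLeft (mvfderiv (𝓡 n) (z i) y)) ψ) =
      ((m : ℝ) + 1) * omegaPairing (extD θ y) (σ y)
        ((σ y).curryLeft (∑ i, c i • mvfderiv (𝓡 n) (z i) y)) ψ := by
    intro y c ψ
    rw [map_sum, map_sum, LinearMap.sum_apply, Finset.mul_sum]
    refine Finset.sum_congr rfl fun i _ => ?_
    rw [map_smul, map_smul, LinearMap.smul_apply, smul_eq_mul]
    ring
  refine contMDiffAt_of_linear_system
    (fun i j y => ((m : ℝ) + 1) * omegaPairing (extD θ y) (σ y)
      ((σ y).curryLeft (mvfderiv (𝓡 n) (z i) y)) (mvfderiv (𝓡 n) (z j) y))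
    (fun j y => omegaPairing (extD θ y) (σ y) (γ y) (mvfderiv (𝓡 n) (z j) y))
    (fun i y => a y (E i y)) (fun i j => ?_) (fun j => ?_) (fun c hc => ?_) ?_ i
  · exact contMDiffAt_const.mul (contMDiff_omegaPairing hσ hθ
      (hσ.curryLeft (isSmoothForm_mvfderiv (z i))) (isSmoothForm_mvfderiv (z j)) x₀)
  · exact contMDiff_omegaPairing hσ hθ hγ (isSmoothForm_mvfderiv (z j)) x₀
  · have hdual := hzE.self_of_nhds
    have h2 : ∑ i, c i • mvfderiv (𝓡 n) (z i) x₀ = 0 := by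
      refine hinj x₀ _ fun ψ => ?_
      rw [cot_eq_sum_smul_of_dual hdual ψ, map_sum]
      refine Finset.sum_eq_zero fun j _ => ?_
      have h3 := hc j
      rw [hsum] at h3
      rw [map_smul, (mul_eq_zero.1 h3).resolve_left hm, smul_zero]
    funext i
    have h3 := congrArg (fun φ : Cot n x₀ => φ (E i x₀)) h2
    simpa [hdual] using h3
  · filter_upwards [hzE] with y hy j
    rw [hsum, ← cot_eq_sum_smul_of_dual hy (a y)]
    have h2 := ha y (mvfderiv (𝓡 n) (z j) y)
    rw [map_sub, map_smul, LinearMap.sub_apply, LinearMap.smul_apply, smul_eq_mul] at h2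
    exact (sub_eq_zero.1 h2).symm

end Pairing

/-! ### Existence, uniqueness and conformal invariance of adapted connections. -/

section Adapted

open Topology Filter

variable {n m : ℕ} {M : Type*} [TopologicalSpace M] [ChartedSpace (EuclideanSpace ℝ (Fin n)) M]
  [IsManifold (𝓡 n) ∞ M] [T2Space M]
  {ξ : M → Type*} [TopologicalSpace (TotalSpace ℝ ξ)]
  [∀ x, AddCommGroup (ξ x)] [∀ x, Module ℝ (ξ x)] [∀ x, TopologicalSpace (ξ x)]
  [FiberBundle ℝ ξ] [VectorBundle ℝ ℝ ξ] [ContMDiffVectorBundle ∞ ℝ ξ (𝓡 n)]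
  [∀ x, IsTopologicalAddGroup (ξ x)] [∀ x, ContinuousSMul ℝ (ξ x)]
  {A : Sec n ξ →ₗ[ℝ] Sec n ξ}

/-- The Wagner connection in the definition of adapted connections may be prescribed. -/
theorem IsAdapted.mem_annSpace (hA : IsDiffOp (m + 1) A)
    (hreg : IsRegularConstantType (principal m A)) {D : AffConn n M}
    (hD : IsWagner (principal m A) D) {N : LinConn n ξ} (hN : IsAdapted m A N) (x : M) :
    subsymbol m A (chernConn D) N x ∈ annSpace (extD (torsionForm D) x) (principal m A x) := by
  obtain ⟨D', hD', h⟩ := hN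
  have h1 : ∀ x (w : Tan n x), D' (extend (Mdl n) w) x = D (extend (Mdl n) w) x :=
    hD'.eq_extend (Nat.succ_pos m) hreg (fun x => (isSymbolAt_principal hA x).1) hD
  have h2 : torsionForm D' = torsionForm D := funext fun x => torsionForm_congr (h1 x)
  rw [← h2, ← subsymbol_congr_aff A (fun x v => chernConn_congr (h1 x) v) N]
  exact h x

/-- Multiplication by `f` changes neither `ω`, the Chern connection nor `L⁰`, and multiplies the
subsymbol by `f`; membership in a linear subspace survives. -/
theorem IsAdapted.mulOp_comp (hn : 2 ≤ n) (hA : IsDiffOp (m + 1) A) {N : LinConn n ξ}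
    (hN : CovariantDerivative.ContMDiffCovariantDerivative N ∞) (h : IsAdapted m A N)
    (f : SFun n M) (hf : ∀ x, f x ≠ 0) : IsAdapted m (mulOp f ∘ₗ A) N := by
  obtain ⟨D, hD, hmem⟩ := h
  have hm : (m : ℝ) + 1 ≠ 0 := by positivity
  -- `g = -1 / ((m + 1) f)` makes `D + g df` the Wagner connection of `f σ`. Since `g` is a function
  -- of `f`, `dg` is proportional to `df`, and `g df` is closed.
  let g : SFun n M := ⟨fun x => -((m : ℝ) + 1)⁻¹ * (f x)⁻¹,
    contMDiff_const.mul (f.contMDiff.inv₀ hf)⟩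
  have hg : ∀ x, ((m : ℝ) + 1) * f x * g x = -1 := by
    intro x
    change ((m : ℝ) + 1) * f x * (-((m : ℝ) + 1)⁻¹ * (f x)⁻¹) = -1
    have := hf x
    field_simp
  have hdg : ∀ x, mvfderiv (𝓡 n) g x = (-(g x / f x)) • mvfderiv (𝓡 n) f x := by
    intro x
    have h1 := mvfderiv_mul (sfun_mdifferentiableAt f x) (sfun_mdifferentiableAt g x)
    have h2 : (f * g : M → ℝ) = fun _ => -((m : ℝ) + 1)⁻¹ := by
      funext y
      have h3 := hg y
      change f y * g y = _
      field_simp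
      linarith
    have h3 : mvfderiv (𝓡 n) (fun _ : M => -((m : ℝ) + 1)⁻¹) x = 0 := mvfderiv_const (I := 𝓡 n) _
    rw [h2, h3] at h1
    ext v
    have h4 := congrArg (fun φ : Cot n x => φ v) h1
    simp only [zero_apply, add_apply, smul_apply, smul_eq_mul] at h4 ⊢
    have := hf x
    field_simp
    linarith
  refine ⟨addScalar D fun x => g x • mvfderiv (𝓡 n) f x, ?_, fun x => ?_⟩
  · rw [show principal m (mulOp f ∘ₗ A) = fun x => f x • principal m A x from
      funext (principal_mulOp_comp hA f)]
    exact hD.addScalar_smul (isSmoothContra_principal hA) f g hg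
  · have h1 : torsionForm (addScalar D fun x => g x • mvfderiv (𝓡 n) f x) =
        fun x => torsionForm D x + (((n : ℝ) - 1) • g : SFun n M) x • mvfderiv (𝓡 n) f x := by
      funext x
      rw [torsionForm_addScalar, smul_smul]
      rfl
    have h2 : extD (torsionForm (addScalar D fun x => g x • mvfderiv (𝓡 n) f x)) x =
        extD (torsionForm D) x := by
      rw [h1]
      refine extD_add_smul_mvfderiv (isSmoothForm_torsionForm hD.1) _ f
        (r := ((n : ℝ) - 1) * -(g x / f x)) ?_
      rw [mvfderiv_sfun_smul, hdg, smul_smul]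
    rw [h2, principal_mulOp_comp hA, annSpace_smul _ _ (hf x),
      subsymbol_congr_aff (mulOp f ∘ₗ A) (D' := chernConn D)
        (fun x v => chernConn_addScalar hn D _ _ x) N,
      subsymbol_mulOp_comp hA (contMDiff_chernConn hD.1) hN]
    exact Submodule.smul_mem _ _ (hmem x)

/-- Multiplication by `1 / f` takes `f A` back to `A`. This reduces uniqueness for `f A` to
uniqueness for `A`. -/
theorem isAdapted_of_mulOp_comp (hn : 2 ≤ n) (hA : IsDiffOp (m + 1) A) {N : LinConn n ξ}
    (hN : CovariantDerivative.ContMDiffCovariantDerivative N ∞) (f : SFun n M) (hf : ∀ x, f x ≠ 0)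
    (h : IsAdapted m (mulOp f ∘ₗ A) N) : IsAdapted m A N := by
  let g : SFun n M := ⟨fun x => (f x)⁻¹, f.contMDiff.inv₀ hf⟩
  have h1 := h.mulOp_comp hn (isDiffOp_mulOp_comp hA f) hN g fun x => inv_ne_zero (hf x)
  have h2 : mulOp g ∘ₗ mulOp f ∘ₗ A = A := by
    refine LinearMap.ext fun s => ?_
    ext x
    change (f x)⁻¹ • f x • A s x = A s x
    rw [smul_smul, inv_mul_cancel₀ (hf x), one_smul]
  rwa [h2] at h1

/-- The pairing defined by a Chern regular operator is nondegenerate. -/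
theorem eq_zero_of_omegaPairing_eq_zero (hn : 2 ≤ n) (hA : IsChernRegular m A) {D : AffConn n M}
    (hD : IsWagner (principal m A) D) (x : M) (a : Cot n x)
    (ha : ∀ ψ, omegaPairing (extD (torsionForm D) x) (principal m A x)
      ((principal m A x).curryLeft a) ψ = 0) : a = 0 := by
  have hsym : ∀ x, principal m A x ∈ symPow (m + 1) x := fun x => (isSymbolAt_principal hA.1 x).1
  refine eq_zero_of_curryLeft_eq_zero (by omega) hA.2.1 hsym ?_
  have h1 : (principal m A x).curryLeft a ∈ contrSpace (principal m A x) ⊓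
      annSpace (extD (torsionForm D) x) (principal m A x) :=
    ⟨⟨a, rfl⟩, (mem_annSpace_iff (curryLeft_mem_symPow (hsym x) a)).2 ha⟩
  rw [(hA.2.2 D hD x).2] at h1
  exact h1

theorem exists_isAdapted [SigmaCompactSpace M] (hn : 2 ≤ n) (hA : IsChernRegular m A) :
    ∃ N : LinConn n ξ, CovariantDerivative.ContMDiffCovariantDerivative N ∞ ∧ IsAdapted m A N := by
  have hσ := isSmoothContra_principal hA.1
  -- The nondegeneracy clause of `IsChernRegular` is conditional on a Wagner connection; existence
  -- of `D` is what makes it usable here.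
  obtain ⟨D, hD⟩ := exists_isWagner (Nat.succ_pos m) hA.2.1
    (fun x => (isSymbolAt_principal hA.1 x).1) hσ
  have hC := contMDiff_chernConn hD.1
  obtain ⟨N₀, hN₀⟩ := exists_linConn (n := n) (ξ := ξ)
  have hinj := eq_zero_of_omegaPairing_eq_zero hn hA hD
  -- At each point, `a` is the correction of the subsymbol of the arbitrary connection `N₀` that
  -- brings it into the annihilator.
  choose a ha using fun x => exists_sub_curryLeft_mem (hinj x)
    (subsymbol m A (chernConn D) N₀ x)
  have has : IsSmoothForm a := isSmoothForm_of_omegaPairing hσ (isSmoothForm_torsionForm hD.1)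
    (isSmoothContra_subsymbol hA.1 hC hN₀) hinj ha
  have hN := contMDiff_addScalar hN₀ has
  refine ⟨addScalar N₀ a, hN, D, hD, fun x => ?_⟩
  rw [mem_annSpace_iff (isSymbolAt_subsymbol hA.1 hC hN x).1,
    subsymbol_of_add hA.1 hC hN₀ hN (fun s x _ u => addScalar_apply N₀ a s x u)]
  exact ha x

/-- The two subsymbols differ by `(m + 1) (a ⌟ σ)`, where `a` is the difference of the connections.
This tensor lies in `L` and in `L⁰`, hence vanishes, and then `a = 0`. -/
theorem sameConn_of_isAdapted (hn : 2 ≤ n) (hA : IsChernRegular m A) {N N' : LinConn n ξ}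
    (hN : CovariantDerivative.ContMDiffCovariantDerivative N ∞) (h : IsAdapted m A N)
    (hN' : CovariantDerivative.ContMDiffCovariantDerivative N' ∞) (h' : IsAdapted m A N') :
    SameConn N' N := by
  obtain ⟨D, hD, -⟩ := id h
  have hC := contMDiff_chernConn hD.1
  obtain ⟨a, ha⟩ := exists_form_eq_sub N N'
  intro s x hs
  have h1 := h.mem_annSpace hA.1 hA.2.1 hD x
  have h2 := h'.mem_annSpace hA.1 hA.2.1 hD x
  rw [subsymbol_of_add hA.1 hC hN hN' ha x] at h2
  have h3 := Submodule.sub_mem _ h1 h2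
  rw [sub_sub_cancel] at h3
  have hm : (m : ℝ) + 1 ≠ 0 := by positivity
  have h4 := (Submodule.smul_mem_iff _ hm).1 h3
  have h5 : a x = 0 := eq_zero_of_omegaPairing_eq_zero hn hA hD x (a x)
    ((mem_annSpace_iff h4.1).1 h4)
  ext1 v
  rw [ha s x hs, h5, zero_apply, zero_smul, add_zero]

end Adapted

end ChernReg

end

theorem mainTheorem9 {n m : ℕ} (hn : 2 ≤ n) (hm : 3 ≤ m + 1)
    {M : Type*} [TopologicalSpace M] [ChartedSpace (EuclideanSpace ℝ (Fin n)) M]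
    [IsManifold (𝓡 n) ∞ M] [T2Space M] [SigmaCompactSpace M]
    {ξ : M → Type*} [TopologicalSpace (TotalSpace ℝ ξ)]
    [∀ x, AddCommGroup (ξ x)] [∀ x, Module ℝ (ξ x)] [∀ x, TopologicalSpace (ξ x)]
    [∀ x, IsTopologicalAddGroup (ξ x)] [∀ x, ContinuousSMul ℝ (ξ x)]
    [FiberBundle ℝ ξ] [VectorBundle ℝ ℝ ξ] [ContMDiffVectorBundle ∞ ℝ ξ (𝓡 n)]
    (A : ChernReg.Sec n ξ →ₗ[ℝ] ChernReg.Sec n ξ) (hA : ChernReg.IsChernRegular m A) :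
    ∃ N : ChernReg.LinConn n ξ,
      CovariantDerivative.ContMDiffCovariantDerivative N ∞ ∧
      ChernReg.IsAdapted m A N ∧
      (∀ N' : ChernReg.LinConn n ξ, CovariantDerivative.ContMDiffCovariantDerivative N' ∞ →
        ChernReg.IsAdapted m A N' → ChernReg.SameConn N' N) ∧
      (∀ f : ChernReg.SFun n M, (∀ x, f x ≠ 0) →
        ChernReg.IsAdapted m (ChernReg.mulOp f ∘ₗ A) N ∧
        ∀ N' : ChernReg.LinConn n ξ, CovariantDerivative.ContMDiffCovariantDerivative N' ∞ →
          ChernReg.IsAdapted m (ChernReg.mulOp f ∘ₗ A) N' → ChernReg.SameConn N' N) := by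
  obtain ⟨N, hN, h⟩ := ChernReg.exists_isAdapted hn hA
  exact ⟨N, hN, h, fun N' hN' h' => ChernReg.sameConn_of_isAdapted hn hA hN h hN' h',
    fun f hf => ⟨h.mulOp_comp hn hA.1 hN f hf, fun N' hN' h' =>
      ChernReg.sameConn_of_isAdapted hn hA hN h hN'
        (ChernReg.isAdapted_of_mulOp_comp hn hA.1 hN' f hf h')⟩⟩
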